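/- Identify $\mathbb R^2$ with $\mathbb C$. Let $K\subset\mathbb C$ be a solid body: a compact set that is the closure of its connected, nonempty interior, with connected complement $\Omega=\mathbb C\setminus K$, such that, for some finite set $E$ (the corners), near every point of $\partial K\setminus E$ the set $\Omega$ is, in suitable Cartesian coordinates, the region above the graph of a $C^1$ function. A flow around $K$ is a differentiable vector field $v=(v^x,v^y)$ on $\Omega$ that * is incompressible and irrotational, $\nabla\cdot v=0$ and $\nabla\times v=0$ in $\Omega$; * satisfies the slip condition: for every $p\in\partial K\setminus E$ with normal $n(p)$, $n(p)\cdot v(z)\to0$ as $z\to p$, $z\in\Omega$; * is bounded near infinity and near every point of $\partial K\setminus E$, and square integrable on bounded subsets of $\Omega$ (these conditions hold in particular if $v$ is bounded on $\Omega$). Write $w=v^x-iv^y$ for the complex velocity. Then: 1. For every flow the velocity at infinity $w_\infty=\lim_{|z|\to\infty}w(z)$ exists, and the circulation $\Gamma=\oint_{|z|=R}v\cdot dx$ (counterclockwise) has the same value for all $R$ such that $K\subset\{|z|<R\}$. 2. Two flows around $K$ with the same $w_\infty$ and the same $\Gamma$ coincide on $\Omega$. 3. Suppose that $K$ has a protruding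 corner at $p\in\partial K$: there are $\Theta\in(\pi,2\pi)$ and $\alpha\in\mathbb R$ such that for every $\varepsilon>0$ there is $r>0$ such that for all $0<\rho<r$ the point $p+\rho e^{i(\alpha+\theta)}$ lies in $\Omega$ if $\varepsilon<\theta<\Theta-\varepsilon$, and in $K$ if $\Theta+\varepsilon<\theta<2\pi-\varepsilon$. Then two flows around $K$ with the same $w_\infty$ whose velocities are both bounded near $p$ coincide on $\Omega$; in particular they have the same $\Gamma$. -/

import Mathlib

open Set Filter Topology MeasureTheory

noncomputable section

/-- `Ω` is a one-sided `C¹` domain near `p`: in the orthonormal frame `(u, I * u)` centred at `p`,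
it is, inside a box, the set of points strictly above the graph of the `C¹` function `g`. -/
structure IsBoundaryChart (Ω : Set ℂ) (p u : ℂ) (g : ℝ → ℝ) (r : ℝ) : Prop where
  norm_eq_one : ‖u‖ = 1
  contDiff : ContDiff ℝ 1 g
  map_zero : g 0 = 0
  pos : 0 < r
  mem_iff : ∀ s t : ℝ, |s| < r → |t| < r →
    (p + u * ((s : ℂ) + (t : ℂ) * Complex.I) ∈ Ω ↔ g s < t)

/-- The normal at `p`, pointing into `Ω`, of the boundary described by a chart: the tangent
`u * (1 + g'(0) * I)` turned by a right angle (not normalised, never zero). -/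
def chartNormal (u : ℂ) (g : ℝ → ℝ) : ℂ :=
  Complex.I * (u * (1 + ((deriv g 0 : ℝ) : ℂ) * Complex.I))

/-- A solid body in the plane: the compact closure of a connected open set, with connected
complement, whose boundary is `C¹` except at finitely many points `E` (the corners). -/
structure IsBody (K E : Set ℂ) : Prop where
  isCompact : IsCompact K
  closure_interior : closure (interior K) = K
  isConnected_interior : IsConnected (interior K)
  isConnected_compl : IsConnected Kᶜ
  finite_corners : E.Finite
  exists_chart : ∀ p ∈ frontier K \ E, ∃ (u : ℂ) (g : ℝ → ℝ) (r : ℝ), IsBoundaryChart Kᶜ p u g r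

/-- At the boundary point `p` the body `K` has a corner whose exterior (fluid-side) angle is `Θ`:
up to arbitrarily small angular errors, near `p` the fluid fills the sector of directions
`α + θ`, `0 < θ < Θ`, and the body fills the sector `Θ < θ < 2π`. The two sides may be
straight or curved. -/
def HasExteriorAngle (K : Set ℂ) (p : ℂ) (Θ : ℝ) : Prop :=
  p ∈ frontier K ∧ ∃ α : ℝ, ∀ ε > 0, ∃ r > 0, ∀ ρ θ : ℝ, 0 < ρ → ρ < r →
    (ε < θ → θ < Θ - ε → p + ρ * Complex.exp ((α + θ : ℝ) * Complex.I) ∈ Kᶜ) ∧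
    (Θ + ε < θ → θ < 2 * Real.pi - ε → p + ρ * Complex.exp ((α + θ : ℝ) * Complex.I) ∈ K)

/-- A protruding corner: the exterior angle is larger than `π` (and less than `2π`). -/
def IsProtrudingCorner (K : Set ℂ) (p : ℂ) : Prop :=
  ∃ Θ : ℝ, Real.pi < Θ ∧ Θ < 2 * Real.pi ∧ HasExteriorAngle K p Θ

/-- Divergence `∂ₓ vˣ + ∂ᵧ vʸ` of the plane vector field `v = vˣ + i vʸ`. -/
def planeDiv (v : ℂ → ℂ) (z : ℂ) : ℝ :=
  (fderiv ℝ v z 1).re + (fderiv ℝ v z Complex.I).im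

/-- Scalar curl `∂ₓ vʸ - ∂ᵧ vˣ` of the plane vector field `v = vˣ + i vʸ`. -/
def planeCurl (v : ℂ → ℂ) (z : ℂ) : ℝ :=
  (fderiv ℝ v z 1).im - (fderiv ℝ v z Complex.I).re

/-- The velocity is bounded in the part of the fluid near `p`. -/
def VelocityBoundedNear (K : Set ℂ) (v : ℂ → ℂ) (p : ℂ) : Prop :=
  ∃ r > 0, ∃ C : ℝ, ∀ z ∈ Kᶜ, dist z p < r → ‖v z‖ ≤ C

/-- Incompressible irrotational flow around the body `K`, with velocity `v = vˣ + i vʸ` on `Kᶜ`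
and slip condition. The velocity is bounded at infinity and near every boundary point that is not
in `E`; near the points of `E` it is only required to be square integrable. Every velocity that
is bounded on `Kᶜ` meets these three size conditions. -/
structure IsFlow (K E : Set ℂ) (v : ℂ → ℂ) : Prop where
  differentiableOn : DifferentiableOn ℝ v Kᶜ
  incompressible : ∀ z ∈ Kᶜ, planeDiv v z = 0
  irrotational : ∀ z ∈ Kᶜ, planeCurl v z = 0
  slip : ∀ p ∈ frontier K \ E, ∀ (u : ℂ) (g : ℝ → ℝ) (r : ℝ), IsBoundaryChart Kᶜ p u g r →
    Tendsto (fun z => inner ℝ (chartNormal u g) (v z)) (𝓝[Kᶜ] p) (𝓝 0)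
  bounded_at_infinity : ∃ R C : ℝ, ∀ z ∈ Kᶜ, R < ‖z‖ → ‖v z‖ ≤ C
  bounded_near_regular : ∀ p ∈ frontier K \ E, VelocityBoundedNear K v p
  square_integrable : ∀ R : ℝ, IntegrableOn (fun z => ‖v z‖ ^ 2) (Kᶜ ∩ Metric.ball 0 R)

/-- The complex velocity `w = vˣ - i vʸ`. -/
def complexVelocity (v : ℂ → ℂ) (z : ℂ) : ℂ := (starRingEnd ℂ) (v z)

/-- The complex velocity tends to `wInf` at infinity. -/
def HasVelocityAtInfinity (v : ℂ → ℂ) (wInf : ℂ) : Prop :=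
  Tendsto (complexVelocity v) (Bornology.cobounded ℂ) (𝓝 wInf)

/-- The circulation `∫ v · dx` along every counterclockwise circle about the origin that encloses
the body is `Γ`. -/
def HasCirculation (K : Set ℂ) (v : ℂ → ℂ) (Γ : ℝ) : Prop :=
  ∀ R : ℝ, K ⊆ Metric.ball 0 R →
    ∫ θ in (0 : ℝ)..(2 * Real.pi),
      inner ℝ (v (circleMap 0 R θ)) (deriv (circleMap 0 R) θ) = Γ

end

/-! The complex velocity `w` is holomorphic on the fluid and bounded at infinity, so it extends
holomorphically in the coordinate `1/z`. This gives the velocity at infinity, and Cauchy's theorem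
makes the circulation independent of the circle. By linearity, uniqueness concerns a flow `v` with
`w → 0`. Then `w = a/z + O(1/z²)`, and `2πi a = ∮ w dz` has the circulation as real part and the
flux as imaginary part.

The main tool is a stream function `F` with `dF = Im (w dz)`. No boundary values of `v` are given,
so it is built weakly. The field `v`, extended by zero to `K`, is weakly divergence free in the
whole plane (`IsFlow.integral_fderiv_eq_zero`): at regular boundary points by the slip condition, at
the corners because finite sets have zero capacity and `v` is locally square integrable. Mollified
fields have stream functions, and a limit of these is locally Lipschitz wherever `v` is bounded
(`exists_stream_of_weak_div_eq_zero`). The extended field vanishes on the connected interior of `K`,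
so `F` can be normalised to be `0` there. By continuity it is `0` at every point of `K` near which
`v` is bounded.

Energy argument (`IsStreamFunction.eq_zero_of_neg`): a truncation of `F` at a negative level is an
admissible test function for the rotated field `i v`, which is also divergence free. Since `dF (i v)
= |v|²`, this forces `v = 0` where `F < 0`, provided the energy over the sublevel sets is finite. If
the circulation is zero then `a = 0`, the total energy is finite, and the argument applied to `F`
and `-F` gives `v = 0`.

At a protruding corner the flux is still zero, so `a = i b` with `b` real. If `b > 0`, then `F` is
positive near infinity, so the energy argument gives `F ≥ 0`, and Harnack's inequality gives `F >
0`. The fluid at the corner contains a sector of opening `κπ` with `κ > 1`. Harnack's inequality,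
pulled back to a disk by a power map, bounds `F` below by a multiple of `|z - p|^(1/κ)` on the
bisector. Bounded velocity would give `F ≤ C |z - p|`, a contradiction. The case `b < 0` follows by
changing the sign of `v`, and `b = 0` is the case of finite energy. -/

/-! ### Holomorphy and weak incompressibility in the interior of the fluid -/

/-- The complex velocity of an incompressible irrotational flow is holomorphic. -/
theorem IsFlow.differentiableOn_complexVelocity {K E : Set ℂ} {v : ℂ → ℂ} (hK : IsClosed K)
    (hv : IsFlow K E v) : DifferentiableOn ℂ (complexVelocity v) Kᶜ := by
  intro z hz
  have hd : DifferentiableAt ℝ v z :=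
    (hv.differentiableOn z hz).differentiableAt (hK.isOpen_compl.mem_nhds hz)
  have h1 := hv.incompressible z hz
  have h2 := hv.irrotational z hz
  unfold planeDiv at h1
  unfold planeCurl at h2
  have hw : HasFDerivAt (complexVelocity v)
      ((Complex.conjCLE : ℂ →L[ℝ] ℂ).comp (fderiv ℝ v z)) z :=
    (Complex.conjCLE : ℂ →L[ℝ] ℂ).hasFDerivAt.comp z hd.hasFDerivAt
  refine DifferentiableAt.differentiableWithinAt ?_
  rw [differentiableAt_complex_iff_differentiableAt_real]
  refine ⟨hw.differentiableAt, ?_⟩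
  rw [hw.fderiv]
  -- The real part of the Cauchy–Riemann equation for the conjugate field is the vanishing of the
  -- curl, the imaginary part that of the divergence.
  apply Complex.ext <;> simp <;> linarith

theorem complexVelocity_complexVelocity (v : ℂ → ℂ) (z : ℂ) :
    (starRingEnd ℂ) (complexVelocity v z) = v z := by
  simp [complexVelocity]

theorem continuousOn_of_complexVelocity {Ω : Set ℂ} {v : ℂ → ℂ}
    (hw : DifferentiableOn ℂ (complexVelocity v) Ω) : ContinuousOn v Ω := by
  have := Complex.continuous_conj.comp_continuousOn hw.continuousOn
  exact this.congr fun z _ => (complexVelocity_complexVelocity v z).symm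

/-- Integrals run over the whole plane while the velocity is controlled only in the fluid.
Continuity on a compact set outside which the integrand vanishes is enough. -/
theorem integrable_of_continuousOn_of_support_subset {E : Type*} [NormedAddCommGroup E]
    {S : Set ℂ} {f : ℂ → E} (hS : IsCompact S)
    (hf : ContinuousOn f S) (hsupp : ∀ z, z ∉ S → f z = 0) : Integrable f := by
  rw [← integrableOn_iff_integrable_of_support_subset (s := S)]
  · exact hf.integrableOn_compact hS
  · intro z hz
    by_contra h
    exact hz (hsupp z h)

theorem real_clm_complex_apply (L : ℂ →L[ℝ] ℝ) (z : ℂ) :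
    L z = z.re * L 1 + z.im * L Complex.I := by
  conv_lhs => rw [← Complex.re_add_im z]
  rw [map_add, mul_comm (z.im : ℂ)]
  have h1 : ((z.re : ℝ) : ℂ) = z.re • (1 : ℂ) := by simp
  have h2 : Complex.I * (z.im : ℂ) = z.im • Complex.I := by simp [mul_comm]
  rw [h1, h2, map_smul, map_smul, smul_eq_mul, smul_eq_mul]

theorem fderiv_eq_zero_of_notMem_tsupport {φ : ℂ → ℝ} {z : ℂ} (hz : z ∉ tsupport φ) :
    fderiv ℝ φ z = 0 := by
  by_contra h
  exact hz (support_fderiv_subset ℝ h)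

/-- A holomorphic complex velocity is weakly divergence free. -/
theorem integral_fderiv_apply_velocity_eq_zero {Ω : Set ℂ} (hΩ : IsOpen Ω) {v : ℂ → ℂ}
    (hw : DifferentiableOn ℂ (complexVelocity v) Ω) {φ : ℂ → ℝ} (hφ : ContDiff ℝ 1 φ)
    (hc : HasCompactSupport φ) (hs : tsupport φ ⊆ Ω) : ∫ z, fderiv ℝ φ z (v z) = 0 := by
  have hvc : ContinuousOn v Ω := continuousOn_of_complexVelocity hw
  have hwd : ∀ z ∈ Ω, HasFDerivAt v ((Complex.conjCLE : ℂ →L[ℝ] ℂ).comp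
      ((deriv (complexVelocity v) z • (1 : ℂ →L[ℂ] ℂ)).restrictScalars ℝ)) z := by
    intro z hz
    have h := ((hw z hz).differentiableAt (hΩ.mem_nhds hz)).hasDerivAt.complexToReal_fderiv
    have h2 := (Complex.conjCLE : ℂ →L[ℝ] ℂ).hasFDerivAt.comp z h
    refine (h2.congr_of_eventuallyEq ?_).congr_fderiv ?_
    · exact Eventually.of_forall fun y => (complexVelocity_complexVelocity v y).symm
    · ext; simp
  have hdc : ContinuousOn (deriv (complexVelocity v)) Ω := (hw.deriv hΩ).continuousOn
  have hre : ∀ z ∈ Ω, HasFDerivAt (fun y => (v y).re) (Complex.reCLM.comp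
      ((Complex.conjCLE : ℂ →L[ℝ] ℂ).comp
      ((deriv (complexVelocity v) z • (1 : ℂ →L[ℂ] ℂ)).restrictScalars ℝ))) z := fun z hz =>
    Complex.reCLM.hasFDerivAt.comp z (hwd z hz)
  have him : ∀ z ∈ Ω, HasFDerivAt (fun y => (v y).im) (Complex.imCLM.comp
      ((Complex.conjCLE : ℂ →L[ℝ] ℂ).comp
      ((deriv (complexVelocity v) z • (1 : ℂ →L[ℂ] ℂ)).restrictScalars ℝ))) z := fun z hz =>
    Complex.imCLM.hasFDerivAt.comp z (hwd z hz)
  -- The two partial derivatives that make up the divergence are `± Re w'`, so they cancel after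
  -- integration by parts.
  have hre1 : ∀ z ∈ Ω, fderiv ℝ (fun y => (v y).re) z 1 = (deriv (complexVelocity v) z).re := by
    intro z hz
    rw [(hre z hz).fderiv]; simp
  have him1 : ∀ z ∈ Ω, fderiv ℝ (fun y => (v y).im) z Complex.I =
      -(deriv (complexVelocity v) z).re := by
    intro z hz
    rw [(him z hz).fderiv]; simp
  have hφc : ∀ h : ℂ, Continuous fun z => fderiv ℝ φ z h := fun h =>
    (hφ.continuous_fderiv one_ne_zero).clm_apply continuous_const
  have hrec : ContinuousOn (fun z => (v z).re) (tsupport φ) :=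
    Complex.continuous_re.comp_continuousOn (hvc.mono hs)
  have himc : ContinuousOn (fun z => (v z).im) (tsupport φ) :=
    Complex.continuous_im.comp_continuousOn (hvc.mono hs)
  have hdrec : ContinuousOn (fun z => (deriv (complexVelocity v) z).re) (tsupport φ) :=
    Complex.continuous_re.comp_continuousOn (hdc.mono hs)
  have hφ0 : ∀ z, z ∉ tsupport φ → φ z = 0 := fun z hz => image_eq_zero_of_notMem_tsupport hz
  have hφ0' : ∀ z, z ∉ tsupport φ → fderiv ℝ φ z = 0 := fun z hz =>
    fderiv_eq_zero_of_notMem_tsupport hz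
  have i1 : Integrable fun z => (v z).re * fderiv ℝ φ z 1 :=
    integrable_of_continuousOn_of_support_subset hc (hrec.mul (hφc 1).continuousOn)
      fun z hz => by simp [hφ0' z hz]
  have i2 : Integrable fun z => (v z).im * fderiv ℝ φ z Complex.I :=
    integrable_of_continuousOn_of_support_subset hc (himc.mul (hφc _).continuousOn)
      fun z hz => by simp [hφ0' z hz]
  have e1 := integral_mul_fderiv_eq_neg_fderiv_mul_of_integrable (μ := volume)
    (f := fun z => (v z).re) (g := φ) (v := 1)
    (integrable_of_continuousOn_of_support_subset hc
      (((hdrec.congr fun z hz => hre1 z (hs hz))).mul hφ.continuous.continuousOn)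
      fun z hz => by simp [hφ0 z hz]) i1
    (integrable_of_continuousOn_of_support_subset hc (hrec.mul hφ.continuous.continuousOn)
      fun z hz => by simp [hφ0 z hz])
    (fun z hz => (hre z (hs hz)).differentiableAt) (fun z _ => hφ.differentiable one_ne_zero z)
  have e2 := integral_mul_fderiv_eq_neg_fderiv_mul_of_integrable (μ := volume)
    (f := fun z => (v z).im) (g := φ) (v := Complex.I)
    (integrable_of_continuousOn_of_support_subset hc
      (((hdrec.neg.congr fun z hz => him1 z (hs hz))).mul hφ.continuous.continuousOn)
      fun z hz => by simp [hφ0 z hz]) i2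
    (integrable_of_continuousOn_of_support_subset hc (himc.mul hφ.continuous.continuousOn)
      fun z hz => by simp [hφ0 z hz])
    (fun z hz => (him z (hs hz)).differentiableAt) (fun z _ => hφ.differentiable one_ne_zero z)
  simp_rw [real_clm_complex_apply (fderiv ℝ φ _) (v _)]
  rw [integral_add i1 i2, e1, e2, ← neg_add, neg_eq_zero, add_eq_zero_iff_eq_neg, ← integral_neg]
  congr 1
  ext z
  by_cases hz : z ∈ tsupport φ
  · rw [hre1 z (hs hz), him1 z (hs hz)]; ring
  · simp [hφ0 z hz]

/-! ### Logarithmic cutoffs: finite sets have zero capacity in the plane -/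

/-- A sequence of `C¹` cutoff functions vanishing near infinity and near the points of `E`, which
tends to `1` and whose Dirichlet integrals tend to zero. -/
structure IsCutoffSeq (E : Set ℂ) (χ : ℕ → ℂ → ℝ) : Prop where
  contDiff : ∀ n, ContDiff ℝ 1 (χ n)
  hasCompactSupport : ∀ n, HasCompactSupport (χ n)
  notMem_tsupport : ∀ n, ∀ e ∈ E, e ∉ tsupport (χ n)
  nonneg : ∀ n z, 0 ≤ χ n z
  le_one : ∀ n z, χ n z ≤ 1
  ae_tendsto : ∀ᵐ z, Tendsto (fun n => χ n z) atTop (𝓝 1)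
  tendsto_energy : Tendsto (fun n => ∫ z, ‖fderiv ℝ (χ n) z‖ ^ 2) atTop (𝓝 0)

theorem integrable_norm_fderiv_sq {χ : ℂ → ℝ} (h : ContDiff ℝ 1 χ) (hc : HasCompactSupport χ) :
    Integrable fun z => ‖fderiv ℝ χ z‖ ^ 2 :=
  integrable_of_continuousOn_of_support_subset hc
    ((h.continuous_fderiv one_ne_zero).norm.pow 2).continuousOn
    fun z hz => by simp [fderiv_eq_zero_of_notMem_tsupport hz]

/-- The smooth profile used to build logarithmic cutoffs. -/
noncomputable def cutoffProfile : ContDiffBump (0 : ℝ) := ⟨1, 2, one_pos, one_lt_two⟩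

/-- The logarithmic cutoff, equal to `1` for `|log ‖z‖| ≤ n + 1` and to `0` for
`|log ‖z‖| ≥ 2 (n + 1)`. -/
noncomputable def logCutoff (n : ℕ) (z : ℂ) : ℝ :=
  if z = 0 then 0 else cutoffProfile (Real.log ‖z‖ / (n + 1))

theorem logCutoff_eq_zero {n : ℕ} {z : ℂ} (h : 2 * ((n : ℝ) + 1) ≤ |Real.log ‖z‖|) :
    logCutoff n z = 0 := by
  unfold logCutoff
  split_ifs with hz
  · rfl
  · apply ContDiffBump.zero_of_le_dist
    have : (0 : ℝ) < n + 1 := by positivity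
    rw [Real.dist_eq, sub_zero, abs_div, abs_of_pos this, le_div_iff₀ this]
    exact h

theorem logCutoff_eq_zero_of_small {n : ℕ} {z : ℂ} (h : ‖z‖ < Real.exp (-(2 * ((n : ℝ) + 1)))) :
    logCutoff n z = 0 := by
  by_cases hz : z = 0
  · simp [logCutoff, hz]
  · apply logCutoff_eq_zero
    have h1 : Real.log ‖z‖ < -(2 * ((n : ℝ) + 1)) := by
      rwa [Real.log_lt_iff_lt_exp (norm_pos_iff.2 hz)]
    rw [abs_of_neg (by have : (0 : ℝ) ≤ n := n.cast_nonneg; linarith)]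
    linarith

theorem logCutoff_eq_zero_of_large {n : ℕ} {z : ℂ} (h : Real.exp (2 * ((n : ℝ) + 1)) < ‖z‖) :
    logCutoff n z = 0 := by
  apply logCutoff_eq_zero
  have hz : 0 < ‖z‖ := (Real.exp_pos _).trans h
  have h1 : 2 * ((n : ℝ) + 1) < Real.log ‖z‖ := by
    rwa [Real.lt_log_iff_exp_lt hz]
  exact h1.le.trans (le_abs_self _)

theorem eventually_logCutoff_eq (n : ℕ) {z : ℂ} (hz : z ≠ 0) :
    logCutoff n =ᶠ[𝓝 z] fun y => cutoffProfile (Real.log ‖y‖ / (n + 1)) := by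
  filter_upwards [isOpen_ne.mem_nhds hz] with y hy
  simp only [logCutoff]
  exact if_neg hy

theorem eventually_logCutoff_eq_zero (n : ℕ) : logCutoff n =ᶠ[𝓝 0] 0 := by
  filter_upwards [Metric.ball_mem_nhds (0 : ℂ) (Real.exp_pos (-(2 * ((n : ℝ) + 1))))] with y hy
  exact logCutoff_eq_zero_of_small (by simpa using hy)

theorem contDiff_logCutoff (n : ℕ) : ContDiff ℝ 1 (logCutoff n) := by
  rw [contDiff_iff_contDiffAt]
  intro z
  by_cases hz : z = 0
  · subst hz
    exact contDiffAt_const.congr_of_eventuallyEq (eventually_logCutoff_eq_zero n)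
  · refine ContDiffAt.congr_of_eventuallyEq ?_ (eventually_logCutoff_eq n hz)
    have h1 : ContDiffAt ℝ 1 (fun y : ℂ => Real.log ‖y‖ / (n + 1)) z :=
      ((contDiffAt_norm ℝ hz).log (norm_ne_zero_iff.2 hz)).div_const _
    exact (cutoffProfile.contDiff.contDiffAt).comp z h1

theorem hasCompactSupport_logCutoff (n : ℕ) : HasCompactSupport (logCutoff n) := by
  refine HasCompactSupport.of_support_subset_isCompact
    (isCompact_closedBall (0 : ℂ) (Real.exp (2 * ((n : ℝ) + 1)))) ?_
  intro z hz
  by_contra h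
  exact hz (logCutoff_eq_zero_of_large (by simpa using h))

/-- By the chain rule, slowing the profile down on the logarithmic scale gains the factor `1 / (n +
1)`. The remaining `1 / ‖z‖` is scale invariant for the Dirichlet integral in the plane. -/
theorem exists_norm_fderiv_logCutoff_le : ∃ C : ℝ, 0 ≤ C ∧ ∀ (n : ℕ) (z : ℂ),
    ‖fderiv ℝ (logCutoff n) z‖ ≤ C / ((n + 1) * ‖z‖) := by
  obtain ⟨C, hC⟩ := (cutoffProfile.hasCompactSupport.deriv).exists_bound_of_continuous
    (cutoffProfile.contDiff.continuous_deriv (n := 1) le_rfl)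
  have hC0 : 0 ≤ C := (norm_nonneg _).trans (hC 0)
  refine ⟨C, hC0, fun n z => ?_⟩
  have hn : (0 : ℝ) < n + 1 := by positivity
  by_cases hz : z = 0
  · subst hz
    rw [(eventually_logCutoff_eq_zero n).fderiv_eq]
    simp
  · rw [(eventually_logCutoff_eq n hz).fderiv_eq]
    have hz' : 0 < ‖z‖ := norm_pos_iff.2 hz
    have hN : HasFDerivAt (fun y : ℂ => ‖y‖) (fderiv ℝ (fun y : ℂ => ‖y‖) z) z :=
      ((contDiffAt_norm ℝ hz (n := 1)).differentiableAt one_ne_zero).hasFDerivAt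
    have hN1 : ‖fderiv ℝ (fun y : ℂ => ‖y‖) z‖ ≤ 1 := by
      simpa using norm_fderiv_le_of_lipschitz ℝ (x₀ := z) (lipschitzWith_one_norm (E := ℂ))
    have hL := (hN.log hz'.ne').mul_const ((n : ℝ) + 1)⁻¹
    have hp := (cutoffProfile.contDiff (n := 1)).differentiable one_ne_zero
      (Real.log ‖z‖ * ((n : ℝ) + 1)⁻¹)
    have hcomp := hp.hasDerivAt.comp_hasFDerivAt z hL
    have : (fun y : ℂ => cutoffProfile (Real.log ‖y‖ / (n + 1))) =
        (cutoffProfile : ℝ → ℝ) ∘ fun y : ℂ => Real.log ‖y‖ * ((n : ℝ) + 1)⁻¹ := by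
      ext y; simp [div_eq_mul_inv]
    rw [this, hcomp.fderiv, norm_smul, norm_smul, norm_smul, norm_inv, norm_inv, norm_norm,
      Real.norm_of_nonneg hn.le, div_eq_mul_inv, mul_inv]
    refine mul_le_mul (hC _) ?_ (by positivity) hC0
    refine mul_le_mul_of_nonneg_left ?_ (by positivity)
    exact (mul_le_mul_of_nonneg_left hN1 (by positivity)).trans (mul_one _).le

theorem fderiv_logCutoff_eq_zero {n : ℕ} {z : ℂ}
    (h : ‖z‖ ∉ Icc (Real.exp (-(2 * ((n : ℝ) + 1)))) (Real.exp (2 * ((n : ℝ) + 1)))) :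
    fderiv ℝ (logCutoff n) z = 0 := by
  have : logCutoff n =ᶠ[𝓝 z] 0 := by
    rw [mem_Icc, not_and_or, not_le, not_le] at h
    rcases h with h | h
    · filter_upwards [(isOpen_lt continuous_norm continuous_const).mem_nhds h] with y hy
      exact logCutoff_eq_zero_of_small hy
    · filter_upwards [(isOpen_lt continuous_const continuous_norm).mem_nhds h] with y hy
      exact logCutoff_eq_zero_of_large hy
  rw [this.fderiv_eq]
  simp

theorem integral_annulus_norm_inv_sq {a b : ℝ} (ha : 0 < a) (hab : a ≤ b) :
    ∫ z : ℂ, (Icc a b).indicator (fun r => (r ^ 2)⁻¹) ‖z‖ = 2 * Real.pi * Real.log (b / a) := by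
  rw [integral_fun_norm_addHaar]
  have h1 : ∫ y in Ioi (0 : ℝ), y ^ (Module.finrank ℝ ℂ - 1) •
      (Icc a b).indicator (fun r => (r ^ 2)⁻¹) y = Real.log (b / a) := by
    have h2 : ∀ y : ℝ, y ^ (Module.finrank ℝ ℂ - 1) • (Icc a b).indicator (fun r => (r ^ 2)⁻¹) y =
        (Icc a b).indicator (fun r => r⁻¹) y := by
      intro y
      by_cases hy : y ∈ Icc a b
      · have : y ≠ 0 := (ha.trans_le hy.1).ne'
        simp only [indicator_of_mem hy, Complex.finrank_real_complex]
        simp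
        field_simp
      · simp [indicator_of_notMem hy]
    simp_rw [h2]
    rw [setIntegral_indicator measurableSet_Icc,
      inter_eq_right.2 (show Icc a b ⊆ Ioi 0 from fun y hy => ha.trans_le hy.1),
      integral_Icc_eq_integral_Ioc,
      ← intervalIntegral.integral_of_le hab, integral_inv_of_pos ha (ha.trans_le hab)]
  rw [h1, Complex.finrank_real_complex]
  simp [Measure.real, Complex.volume_ball]
  ring

theorem integrable_annulus_norm_inv_sq {a b : ℝ} (ha : 0 < a) :
    Integrable fun z : ℂ => (Icc a b).indicator (fun r => (r ^ 2)⁻¹) ‖z‖ := by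
  have hS : IsCompact {z : ℂ | ‖z‖ ∈ Icc a b} :=
    (isCompact_closedBall (0 : ℂ) b).of_isClosed_subset (isClosed_Icc.preimage continuous_norm)
      fun z hz => by simpa using hz.2
  refine integrable_of_continuousOn_of_support_subset hS ?_ fun z hz =>
    indicator_of_notMem (s := Icc a b) hz _
  refine ContinuousOn.congr (f := fun z : ℂ => (‖z‖ ^ 2)⁻¹) ?_ fun z hz =>
    indicator_of_mem (s := Icc a b) hz _
  refine ContinuousOn.inv₀ (by fun_prop) fun z hz => ?_
  have : 0 < ‖z‖ := ha.trans_le hz.1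
  positivity

/-- On the annulus between radii `exp (∓2 (n + 1))` the integral of `‖z‖⁻²` is `2π · 4 (n + 1)`.
Against the prefactor `C² / (n + 1)²` this leaves an energy of order `1 / (n + 1)`. -/
theorem tendsto_energy_logCutoff :
    Tendsto (fun n => ∫ z, ‖fderiv ℝ (logCutoff n) z‖ ^ 2) atTop (𝓝 0) := by
  obtain ⟨C, hC0, hC⟩ := exists_norm_fderiv_logCutoff_le
  have hbd : ∀ n : ℕ, ∫ z, ‖fderiv ℝ (logCutoff n) z‖ ^ 2 ≤
      8 * Real.pi * C ^ 2 * (1 / ((n : ℝ) + 1)) := by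
    intro n
    have hn : (0 : ℝ) < n + 1 := by positivity
    set a := Real.exp (-(2 * ((n : ℝ) + 1))) with ha
    set b := Real.exp (2 * ((n : ℝ) + 1)) with hb
    have hpos : 0 < a := Real.exp_pos _
    have hab : a ≤ b := Real.exp_le_exp.2 (by linarith)
    have hle : ∀ z, ‖fderiv ℝ (logCutoff n) z‖ ^ 2 ≤
        (C ^ 2 / ((n : ℝ) + 1) ^ 2) * (Icc a b).indicator (fun r => (r ^ 2)⁻¹) ‖z‖ := by
      intro z
      by_cases hz : ‖z‖ ∈ Icc a b
      · rw [indicator_of_mem hz]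
        refine (pow_le_pow_left₀ (norm_nonneg _) (hC n z) 2).trans (le_of_eq ?_)
        rw [div_pow, mul_pow, div_mul_eq_div_div]
        rfl
      · rw [indicator_of_notMem hz, fderiv_logCutoff_eq_zero hz]; simp
    calc ∫ z, ‖fderiv ℝ (logCutoff n) z‖ ^ 2
        ≤ ∫ z : ℂ, (C ^ 2 / ((n : ℝ) + 1) ^ 2) *
            (Icc a b).indicator (fun r => (r ^ 2)⁻¹) ‖z‖ :=
          integral_mono (integrable_norm_fderiv_sq (contDiff_logCutoff n)
            (hasCompactSupport_logCutoff n)) ((integrable_annulus_norm_inv_sq hpos).const_mul _) hle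
      _ = 8 * Real.pi * C ^ 2 * (1 / ((n : ℝ) + 1)) := by
          rw [integral_const_mul, integral_annulus_norm_inv_sq hpos hab,
            Real.log_div (Real.exp_pos _).ne' (Real.exp_pos _).ne', Real.log_exp, Real.log_exp]
          field_simp
          ring
  refine squeeze_zero (fun n => integral_nonneg fun z => by positivity) hbd ?_
  simpa using (tendsto_one_div_add_atTop_nhds_zero_nat (𝕜 := ℝ)).const_mul (8 * Real.pi * C ^ 2)

theorem isCutoffSeq_logCutoff : IsCutoffSeq {0} logCutoff where
  contDiff := contDiff_logCutoff
  hasCompactSupport := hasCompactSupport_logCutoff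
  notMem_tsupport := by
    rintro n e rfl
    rw [notMem_tsupport_iff_eventuallyEq]
    exact eventually_logCutoff_eq_zero n
  nonneg n z := by
    unfold logCutoff
    split_ifs
    · exact le_rfl
    · exact cutoffProfile.nonneg
  le_one n z := by
    unfold logCutoff
    split_ifs
    · exact zero_le_one
    · exact cutoffProfile.le_one
  ae_tendsto := by
    have h0 : ∀ᵐ z : ℂ, z ≠ 0 := by simp [ae_iff]
    filter_upwards [h0] with z hz
    have h1 : Tendsto (fun n : ℕ => Real.log ‖z‖ / ((n : ℝ) + 1)) atTop (𝓝 0) := by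
      simpa [div_eq_mul_inv] using
        (tendsto_one_div_add_atTop_nhds_zero_nat (𝕜 := ℝ)).const_mul (Real.log ‖z‖)
    have h2 := (cutoffProfile.continuous.tendsto 0).comp h1
    rw [cutoffProfile.one_of_mem_closedBall (by simp [cutoffProfile])] at h2
    refine h2.congr fun n => ?_
    simp [logCutoff, hz]
  tendsto_energy := tendsto_energy_logCutoff

theorem IsCutoffSeq.translate {χ : ℕ → ℂ → ℝ} (h : IsCutoffSeq {0} χ) (e : ℂ) :
    IsCutoffSeq {e} fun n z => χ n (z - e) where
  contDiff n := (h.contDiff n).comp (contDiff_id.sub contDiff_const)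
  hasCompactSupport n :=
    (h.hasCompactSupport n).comp_homeomorph (Homeomorph.subRight e)
  notMem_tsupport := by
    rintro n x rfl
    have h0 := h.notMem_tsupport n 0 rfl
    rw [notMem_tsupport_iff_eventuallyEq] at h0 ⊢
    have : Tendsto (fun z : ℂ => z - x) (𝓝 x) (𝓝 0) := by
      simpa using (continuous_id.sub continuous_const).tendsto (x := x) (f := fun z : ℂ => z - x)
    exact this.eventually h0
  nonneg n z := h.nonneg n _
  le_one n z := h.le_one n _
  ae_tendsto := (measurePreserving_sub_right volume e).quasiMeasurePreserving.ae h.ae_tendsto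
  tendsto_energy := by
    refine h.tendsto_energy.congr fun n => ?_
    simp_rw [fderiv_comp_sub]
    exact (integral_sub_right_eq_self (fun z => ‖fderiv ℝ (χ n) z‖ ^ 2) e).symm

theorem norm_fderiv_mul_sq_le {a b : ℂ → ℝ} {z : ℂ} (ha : DifferentiableAt ℝ a z)
    (hb : DifferentiableAt ℝ b z) (ha1 : |a z| ≤ 1) (hb1 : |b z| ≤ 1) :
    ‖fderiv ℝ (fun y => a y * b y) z‖ ^ 2 ≤ 2 * ‖fderiv ℝ a z‖ ^ 2 + 2 * ‖fderiv ℝ b z‖ ^ 2 := by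
  rw [fderiv_fun_mul ha hb]
  have h : ‖a z • fderiv ℝ b z + b z • fderiv ℝ a z‖ ≤ ‖fderiv ℝ b z‖ + ‖fderiv ℝ a z‖ := by
    refine (norm_add_le _ _).trans (add_le_add ?_ ?_)
    · rw [norm_smul]; exact mul_le_of_le_one_left (norm_nonneg _) ha1
    · rw [norm_smul]; exact mul_le_of_le_one_left (norm_nonneg _) hb1
  nlinarith [norm_nonneg (a z • fderiv ℝ b z + b z • fderiv ℝ a z),
    sq_nonneg (‖fderiv ℝ b z‖ - ‖fderiv ℝ a z‖), norm_nonneg (fderiv ℝ b z),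
    norm_nonneg (fderiv ℝ a z)]

/-- Products of cutoffs remove the union of two exceptional sets. Both factors lie in `[0, 1]`, so
the energy of the product is at most twice the sum of the energies. -/
theorem IsCutoffSeq.mul {E₁ E₂ : Set ℂ} {χ₁ χ₂ : ℕ → ℂ → ℝ} (h₁ : IsCutoffSeq E₁ χ₁)
    (h₂ : IsCutoffSeq E₂ χ₂) : IsCutoffSeq (E₁ ∪ E₂) fun n z => χ₁ n z * χ₂ n z where
  contDiff n := (h₁.contDiff n).mul (h₂.contDiff n)
  hasCompactSupport n := (h₁.hasCompactSupport n).mul_right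
  notMem_tsupport n e he := by
    rcases he with he | he
    · exact fun h => h₁.notMem_tsupport n e he (tsupport_mul_subset_left h)
    · exact fun h => h₂.notMem_tsupport n e he (tsupport_mul_subset_right h)
  nonneg n z := mul_nonneg (h₁.nonneg n z) (h₂.nonneg n z)
  le_one n z := mul_le_one₀ (h₁.le_one n z) (h₂.nonneg n z) (h₂.le_one n z)
  ae_tendsto := by
    filter_upwards [h₁.ae_tendsto, h₂.ae_tendsto] with z hz₁ hz₂
    simpa using hz₁.mul hz₂
  tendsto_energy := by
    have hi₁ := fun n => integrable_norm_fderiv_sq (h₁.contDiff n) (h₁.hasCompactSupport n)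
    have hi₂ := fun n => integrable_norm_fderiv_sq (h₂.contDiff n) (h₂.hasCompactSupport n)
    refine squeeze_zero (g := fun n => 2 * (∫ z, ‖fderiv ℝ (χ₁ n) z‖ ^ 2) +
      2 * ∫ z, ‖fderiv ℝ (χ₂ n) z‖ ^ 2) (fun n => integral_nonneg fun z => by positivity) ?_ ?_
    · intro n
      rw [← integral_const_mul, ← integral_const_mul,
        ← integral_add ((hi₁ n).const_mul 2) ((hi₂ n).const_mul 2)]
      refine integral_mono (integrable_norm_fderiv_sq ((h₁.contDiff n).mul (h₂.contDiff n))
        (h₁.hasCompactSupport n).mul_right) (((hi₁ n).const_mul 2).add ((hi₂ n).const_mul 2)) ?_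
      intro z
      refine norm_fderiv_mul_sq_le ((h₁.contDiff n).differentiable one_ne_zero z)
        ((h₂.contDiff n).differentiable one_ne_zero z) ?_ ?_
      · rw [abs_of_nonneg (h₁.nonneg n z)]; exact h₁.le_one n z
      · rw [abs_of_nonneg (h₂.nonneg n z)]; exact h₂.le_one n z
    · simpa using (h₁.tendsto_energy.const_mul 2).add (h₂.tendsto_energy.const_mul 2)

/-- A finite set has vanishing capacity: it admits cutoffs of small Dirichlet integral. -/
theorem exists_isCutoffSeq {E : Set ℂ} (hE : E.Finite) : ∃ χ, IsCutoffSeq E χ := by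
  -- An additional puncture at `0` makes `logCutoff` serve as the base case; it also supplies the
  -- decay at infinity.
  suffices h : ∃ χ, IsCutoffSeq (E ∪ {0}) χ by
    obtain ⟨χ, hχ⟩ := h
    exact ⟨χ, { hχ with notMem_tsupport := fun n e he => hχ.notMem_tsupport n e (Or.inl he) }⟩
  induction E, hE using Set.Finite.induction_on with
  | empty => exact ⟨logCutoff, by simpa using isCutoffSeq_logCutoff⟩
  | @insert e s _ _ ih =>
    obtain ⟨χ, hχ⟩ := ih
    have := (isCutoffSeq_logCutoff.translate e).mul hχ
    rw [← union_assoc, ← insert_eq] at this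
    exact ⟨_, this⟩

/-- This is Cauchy–Schwarz. The error made by a cutoff disappears in the limit against any square
integrable field. -/
theorem IsCutoffSeq.tendsto_integral_fderiv_apply {E : Set ℂ} {χ : ℕ → ℂ → ℝ}
    (h : IsCutoffSeq E χ) {X : ℂ → ℂ} (hX : MemLp X 2) :
    Tendsto (fun n => ∫ z, fderiv ℝ (χ n) z (X z)) atTop (𝓝 0) := by
  refine squeeze_zero_norm (a := fun n => (∫ z, ‖fderiv ℝ (χ n) z‖ ^ 2) ^ (1 / 2 : ℝ) *
    (∫ z, ‖X z‖ ^ 2) ^ (1 / 2 : ℝ)) (fun n => ?_) ?_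
  · have hm : MemLp (fun z => ‖fderiv ℝ (χ n) z‖) (ENNReal.ofReal 2) := by
      rw [ENNReal.ofReal_ofNat]
      exact (((h.contDiff n).continuous_fderiv one_ne_zero).memLp_of_hasCompactSupport
        ((h.hasCompactSupport n).fderiv ℝ)).norm
    have hX' : MemLp (fun z => ‖X z‖) (ENNReal.ofReal 2) := by
      rw [ENNReal.ofReal_ofNat]; exact hX.norm
    have h1 := integral_mul_le_Lp_mul_Lq_of_nonneg (μ := volume) Real.HolderConjugate.two_two
      (Eventually.of_forall fun z => norm_nonneg (fderiv ℝ (χ n) z))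
      (Eventually.of_forall fun z => norm_nonneg (X z)) hm hX'
    simp only [Real.rpow_two] at h1
    refine le_trans ?_ h1
    refine norm_integral_le_of_norm_le (?_) (Eventually.of_forall fun z => ?_)
    · rw [ENNReal.ofReal_ofNat] at hm hX'
      exact hm.integrable_mul hX'
    · exact (fderiv ℝ (χ n) z).le_opNorm _
  · have := (h.tendsto_energy.rpow_const (p := 1 / 2) (Or.inr (by norm_num))).mul_const
      ((∫ z, ‖X z‖ ^ 2) ^ (1 / 2 : ℝ))
    simpa using this

/-! ### The slip condition as weak incompressibility up to the regular boundary -/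

/-- A smooth step: `0` on `(-∞, 1]`, `1` on `[2, ∞)`. -/
noncomputable def smoothStep (x : ℝ) : ℝ := Real.smoothTransition (x - 1)

theorem contDiff_smoothStep : ContDiff ℝ 2 smoothStep :=
  Real.smoothTransition.contDiff.comp (contDiff_id.sub contDiff_const)

theorem smoothStep_eq_zero {x : ℝ} (h : x ≤ 1) : smoothStep x = 0 :=
  Real.smoothTransition.zero_of_nonpos (by linarith)

theorem smoothStep_eq_one {x : ℝ} (h : 2 ≤ x) : smoothStep x = 1 :=
  Real.smoothTransition.one_of_one_le (by linarith)

theorem continuous_deriv_smoothStep : Continuous (deriv smoothStep) :=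
  contDiff_smoothStep.continuous_deriv (by norm_num)

theorem deriv_smoothStep_eq_zero {x : ℝ} (h : x ∉ Icc (1 : ℝ) 2) : deriv smoothStep x = 0 := by
  rw [mem_Icc, not_and_or, not_le, not_le] at h
  rcases h with h | h
  · have : smoothStep =ᶠ[𝓝 x] fun _ => 0 := by
      filter_upwards [Iio_mem_nhds h] with y hy using smoothStep_eq_zero (le_of_lt hy)
    rw [this.deriv_eq, deriv_const]
  · have : smoothStep =ᶠ[𝓝 x] fun _ => 1 := by
      filter_upwards [Ioi_mem_nhds h] with y hy using smoothStep_eq_one (le_of_lt hy)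
    rw [this.deriv_eq, deriv_const]

theorem hasCompactSupport_deriv_smoothStep : HasCompactSupport (deriv smoothStep) := by
  refine HasCompactSupport.of_support_subset_isCompact (isCompact_Icc (a := (1 : ℝ)) (b := 2)) ?_
  intro x hx
  by_contra h
  exact hx (deriv_smoothStep_eq_zero h)

/-- The height above the graph of `g`, in the frame `(u, I * u)` centred at `p`. -/
noncomputable def chartHeight (p u : ℂ) (g : ℝ → ℝ) (z : ℂ) : ℝ :=
  ((starRingEnd ℂ) u * (z - p)).im - g ((starRingEnd ℂ) u * (z - p)).re

theorem contDiff_chartHeight (p u : ℂ) {g : ℝ → ℝ} (hg : ContDiff ℝ 1 g) :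
    ContDiff ℝ 1 (chartHeight p u g) := by
  have h1 : ContDiff ℝ 1 fun z : ℂ => (starRingEnd ℂ) u * (z - p) := by fun_prop
  exact (Complex.imCLM.contDiff.comp h1).sub (hg.comp (Complex.reCLM.contDiff.comp h1))

/-- The gradient of the height at `z` is the normal of the graph at the foot of the vertical through
`z`. It is the vector that the slip condition pairs with the velocity. -/
theorem fderiv_chartHeight_apply (p u : ℂ) {g : ℝ → ℝ} (hg : ContDiff ℝ 1 g) (z h : ℂ) :
    fderiv ℝ (chartHeight p u g) z h = inner ℝ (Complex.I *
      (u * (1 + ((deriv g ((starRingEnd ℂ) u * (z - p)).re : ℝ) : ℂ) * Complex.I))) h := by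
  have h1 : HasFDerivAt (fun z : ℂ => (starRingEnd ℂ) u * (z - p))
      ((starRingEnd ℂ) u • (1 : ℂ →L[ℝ] ℂ)) z :=
    ((hasFDerivAt_id z).sub_const p).const_mul _
  have h2 := Complex.imCLM.hasFDerivAt.comp z h1
  have h3 := Complex.reCLM.hasFDerivAt.comp z h1
  have h4 := ((hg.differentiable one_ne_zero
    (((starRingEnd ℂ) u * (z - p)).re)).hasDerivAt).comp_hasFDerivAt z h3
  have h5 : HasFDerivAt (chartHeight p u g) _ z := h2.sub h4
  rw [h5.fderiv]
  simp [Complex.inner]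
  ring

theorem chart_coord {u : ℂ} (hu : ‖u‖ = 1) (p z : ℂ) :
    p + u * ((((starRingEnd ℂ) u * (z - p)).re : ℂ) +
      (((starRingEnd ℂ) u * (z - p)).im : ℂ) * Complex.I) = z := by
  rw [Complex.re_add_im, ← mul_assoc, Complex.mul_conj, Complex.normSq_eq_norm_sq, hu]
  simp

theorem chart_coord_symm {u : ℂ} (hu : ‖u‖ = 1) (p ζ : ℂ) :
    (starRingEnd ℂ) u * (p + u * ζ - p) = ζ := by
  rw [add_sub_cancel_left, ← mul_assoc, mul_comm _ u, Complex.mul_conj, Complex.normSq_eq_norm_sq,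
    hu]
  simp

theorem abs_re_chart_lt {p u : ℂ} (hu : ‖u‖ = 1) {r : ℝ} {z : ℂ} (hz : z ∈ Metric.ball p r) :
    |((starRingEnd ℂ) u * (z - p)).re| < r := by
  refine (Complex.abs_re_le_norm _).trans_lt ?_
  simpa [hu, dist_eq_norm] using hz

theorem abs_im_chart_lt {p u : ℂ} (hu : ‖u‖ = 1) {r : ℝ} {z : ℂ} (hz : z ∈ Metric.ball p r) :
    |((starRingEnd ℂ) u * (z - p)).im| < r := by
  refine (Complex.abs_im_le_norm _).trans_lt ?_
  simpa [hu, dist_eq_norm] using hz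

theorem IsBoundaryChart.mem_iff_chartHeight_pos {Ω : Set ℂ} {p u : ℂ} {g : ℝ → ℝ} {r : ℝ}
    (hc : IsBoundaryChart Ω p u g r) {z : ℂ} (hz : z ∈ Metric.ball p r) :
    z ∈ Ω ↔ 0 < chartHeight p u g z := by
  have := hc.mem_iff _ _ (abs_re_chart_lt hc.norm_eq_one hz) (abs_im_chart_lt hc.norm_eq_one hz)
  rw [chart_coord hc.norm_eq_one] at this
  rw [this, chartHeight, sub_pos]

theorem measurePreserving_chart {u : ℂ} (hu : ‖u‖ = 1) (p : ℂ) :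
    MeasurePreserving (fun x : ℝ × ℝ => p + u * ((x.1 : ℂ) + (x.2 : ℂ) * Complex.I)) := by
  have h1 := Complex.volume_preserving_equiv_real_prod.symm
  have hu' : u ∈ Submonoid.unitSphere ℂ := by simpa [Submonoid.unitSphere] using hu
  have h2 : MeasurePreserving (fun z : ℂ => u * z) := by
    exact (rotation (⟨u, hu'⟩ : Circle)).measurePreserving
  have h3 := measurePreserving_add_left (volume : Measure ℂ) p
  have h4 : (fun x : ℝ × ℝ => p + u * ((x.1 : ℂ) + (x.2 : ℂ) * Complex.I)) =
      ((fun z => p + z) ∘ fun z => u * z) ∘ Complex.measurableEquivRealProd.symm := by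
    funext x
    rw [← Complex.mk_eq_add_mul_I]
    rfl
  rw [h4]
  exact (h3.comp h2).comp h1

theorem measurableEmbedding_chart {u : ℂ} (hu : ‖u‖ = 1) (p : ℂ) :
    MeasurableEmbedding (fun x : ℝ × ℝ => p + u * ((x.1 : ℂ) + (x.2 : ℂ) * Complex.I)) := by
  have hcont : Continuous (fun x : ℝ × ℝ => p + u * ((x.1 : ℂ) + (x.2 : ℂ) * Complex.I)) := by
    fun_prop
  refine hcont.measurableEmbedding fun x y hxy => ?_
  have h0 : u ≠ 0 := by rintro rfl; simp at hu
  have h1 := mul_left_cancel₀ h0 (add_left_cancel hxy)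
  rw [← Complex.mk_eq_add_mul_I, ← Complex.mk_eq_add_mul_I] at h1
  exact Prod.ext (congrArg Complex.re h1) (congrArg Complex.im h1)

/-- Integration in graph coordinates with rescaled height. -/
theorem integral_eq_integral_chart {u : ℂ} (hu : ‖u‖ = 1) (p : ℂ) (g : ℝ → ℝ) {δ : ℝ}
    (hδ : 0 < δ) {G : ℂ → ℝ} (hG : Integrable G) :
    Integrable (fun s : ℝ => ∫ σ : ℝ,
      δ * G (p + u * ((s : ℂ) + ((g s + δ * σ : ℝ) : ℂ) * Complex.I))) ∧
    ∫ z, G z = ∫ s : ℝ, ∫ σ : ℝ,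
      δ * G (p + u * ((s : ℂ) + ((g s + δ * σ : ℝ) : ℂ) * Complex.I)) := by
  have hmp := measurePreserving_chart hu p
  have hme := measurableEmbedding_chart hu p
  have h1 : ∀ s : ℝ, ∫ σ : ℝ, δ * G (p + u * ((s : ℂ) + ((g s + δ * σ : ℝ) : ℂ) * Complex.I)) =
      ∫ t : ℝ, G (p + u * ((s : ℂ) + (t : ℂ) * Complex.I)) := by
    intro s
    rw [integral_const_mul]
    have h2 := Measure.integral_comp_mul_left
      (fun t : ℝ => G (p + u * ((s : ℂ) + ((g s + t : ℝ) : ℂ) * Complex.I))) δ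
    rw [h2, integral_add_left_eq_self
      (fun t : ℝ => G (p + u * ((s : ℂ) + (t : ℂ) * Complex.I))) (g s), abs_of_pos (inv_pos.2 hδ),
      smul_eq_mul, mul_inv_cancel_left₀ hδ.ne']
  simp_rw [h1]
  have hi : Integrable (fun x : ℝ × ℝ => G (p + u * ((x.1 : ℂ) + (x.2 : ℂ) * Complex.I))) :=
    hmp.integrable_comp_of_integrable hG
  refine ⟨hi.integral_prod_left, ?_⟩
  rw [← hmp.integral_comp hme G]
  exact integral_prod _ hi

/-- Near a regular boundary point, a bounded holomorphic velocity satisfying the slip condition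
is weakly divergence free up to the boundary. -/
theorem IsBoundaryChart.integral_fderiv_apply_eq_zero {Ω : Set ℂ} (hΩ : IsOpen Ω) {p u : ℂ}
    {g : ℝ → ℝ} {r C : ℝ} (hc : IsBoundaryChart Ω p u g r) {v : ℂ → ℂ}
    (hw : DifferentiableOn ℂ (complexVelocity v) Ω)
    (hC : ∀ z ∈ Ω, z ∈ Metric.ball p r → ‖v z‖ ≤ C)
    (hslip : ∀ s : ℝ, p + u * ((s : ℂ) + (g s : ℂ) * Complex.I) ∈ Metric.ball p r →
      Tendsto (fun z => inner ℝ (Complex.I * (u * (1 + ((deriv g s : ℝ) : ℂ) * Complex.I))) (v z))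
        (𝓝[Ω] (p + u * ((s : ℂ) + (g s : ℂ) * Complex.I))) (𝓝 0))
    {φ : ℂ → ℝ} (hφ : ContDiff ℝ 1 φ) (hφc : HasCompactSupport φ)
    (hφs : tsupport φ ⊆ Metric.ball p r) : ∫ z in Ω, fderiv ℝ φ z (v z) = 0 := by
  have hu := hc.norm_eq_one
  have hg := hc.contDiff
  have hvc : ContinuousOn v Ω := continuousOn_of_complexVelocity hw
  set τ := chartHeight p u g with hτ
  have hτd : ContDiff ℝ 1 τ := contDiff_chartHeight p u hg
  have hφ0 : ∀ z, z ∉ Metric.ball p r → φ z = 0 := fun z hz =>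
    image_eq_zero_of_notMem_tsupport fun h => hz (hφs h)
  have hφ0' : ∀ z, z ∉ Metric.ball p r → fderiv ℝ φ z = 0 := fun z hz =>
    fderiv_eq_zero_of_notMem_tsupport fun h => hz (hφs h)
  let δ : ℕ → ℝ := fun n => 1 / ((n : ℝ) + 1)
  have hδ : ∀ n, 0 < δ n := fun n => by positivity
  have hδ0 : Tendsto δ atTop (𝓝 0) := tendsto_one_div_add_atTop_nhds_zero_nat
  -- Since `φ μₙ` is supported in the fluid, the interior identity applies. The product rule splits
  -- it into `A`, which tends to the integral wanted, and `B`, which lives in the layer `δ n ≤ τ ≤ 2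
  -- δ n`.
  let μ : ℕ → ℂ → ℝ := fun n z => smoothStep (τ z / δ n)
  have hμd : ∀ n, ContDiff ℝ 1 (μ n) := fun n =>
    (contDiff_smoothStep.of_le (by norm_num)).comp (hτd.div_const _)
  have hμ0 : ∀ n z, τ z ≤ δ n → μ n z = 0 := fun n z h =>
    smoothStep_eq_zero (by rw [div_le_one (hδ n)]; exact h)
  have hμ' : ∀ n z, HasFDerivAt (μ n)
      ((deriv smoothStep (τ z / δ n) / δ n) • fderiv ℝ τ z) z := by
    intro n z
    have h1 := (hτd.differentiable one_ne_zero z).hasFDerivAt.mul_const (δ n)⁻¹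
    have h2 := ((contDiff_smoothStep.differentiable (by norm_num)
      (τ z * (δ n)⁻¹)).hasDerivAt).comp_hasFDerivAt z h1
    simp only [← div_eq_mul_inv, smul_smul] at h2
    exact h2
  let S : ℕ → Set ℂ := fun n => tsupport φ ∩ {z | δ n ≤ τ z}
  have hSc : ∀ n, IsCompact (S n) := fun n =>
    hφc.inter_right (isClosed_le continuous_const hτd.continuous)
  have hSΩ : ∀ n, S n ⊆ Ω := fun n z hz =>
    (hc.mem_iff_chartHeight_pos (hφs hz.1)).2 ((hδ n).trans_le hz.2)
  have hmu0 : ∀ n z, z ∉ S n → φ z * μ n z = 0 := by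
    intro n z hz
    by_cases h : z ∈ tsupport φ
    · rw [hμ0 n z, mul_zero]
      by_contra h'
      exact hz ⟨h, (not_le.1 h').le⟩
    · rw [image_eq_zero_of_notMem_tsupport h, zero_mul]
  have hsupp : ∀ n, tsupport (fun z => φ z * μ n z) ⊆ S n := by
    intro n
    refine closure_minimal (fun z hz => ?_) (hSc n).isClosed
    by_contra h
    exact hz (hmu0 n z h)
  let A : ℕ → ℂ → ℝ := fun n z => μ n z * fderiv ℝ φ z (v z)
  let B : ℕ → ℂ → ℝ := fun n z =>
    φ z * (deriv smoothStep (τ z / δ n) / δ n * fderiv ℝ τ z (v z))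
  have hAi : ∀ n, Integrable (A n) := by
    intro n
    refine integrable_of_continuousOn_of_support_subset (hSc n) ?_ ?_
    · exact (hμd n).continuous.continuousOn.mul
        ((hφ.continuous_fderiv one_ne_zero).continuousOn.clm_apply (hvc.mono (hSΩ n)))
    · intro z hz
      by_cases h : z ∈ tsupport φ
      · simp only [A]
        rw [hμ0 n z, zero_mul]
        by_contra h'
        exact hz ⟨h, (not_le.1 h').le⟩
      · simp [A, fderiv_eq_zero_of_notMem_tsupport h]
  have hB0 : ∀ n z, z ∉ S n → B n z = 0 := by
    intro n z hz
    by_cases h : z ∈ tsupport φ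
    · simp only [B]
      rw [deriv_smoothStep_eq_zero, zero_div, zero_mul, mul_zero]
      intro h'
      exact hz ⟨h, by simpa [one_le_div (hδ n)] using h'.1⟩
    · simp [B, image_eq_zero_of_notMem_tsupport h]
  have hBc : ∀ n, ContinuousOn (B n) Ω := by
    intro n
    refine hφ.continuous.continuousOn.mul (ContinuousOn.mul ?_ ?_)
    · exact ((continuous_deriv_smoothStep.comp (hτd.continuous.div_const _)).div_const
        _).continuousOn
    · exact (hτd.continuous_fderiv one_ne_zero).continuousOn.clm_apply hvc
  have hBi : ∀ n, Integrable (B n) := fun n =>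
    integrable_of_continuousOn_of_support_subset (hSc n) ((hBc n).mono (hSΩ n)) (hB0 n)
  have hBcont : ∀ n, Continuous (B n) := by
    intro n
    refine continuous_of_tsupport fun z hz => ?_
    have : tsupport (B n) ⊆ S n := by
      refine closure_minimal (fun z hz => ?_) (hSc n).isClosed
      by_contra h
      exact hz (hB0 n z h)
    exact (hBc n).continuousAt (hΩ.mem_nhds (hSΩ n (this hz)))
  have hsum : ∀ n, (∫ z, A n z) + ∫ z, B n z = 0 := by
    intro n
    rw [← integral_add (hAi n) (hBi n), ← integral_fderiv_apply_velocity_eq_zero hΩ hw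
      (hφ.mul (hμd n)) hφc.mul_right ((hsupp n).trans (hSΩ n))]
    congr 1
    ext z
    have h1 := (hφ.differentiable one_ne_zero z).hasFDerivAt.fun_mul (hμ' n z)
    rw [h1.fderiv]
    simp [A, B]
    ring
  obtain ⟨Mφ, hMφ⟩ := hφc.exists_bound_of_continuous hφ.continuous
  have hAlim : Tendsto (fun n => ∫ z, A n z) atTop (𝓝 (∫ z in Ω, fderiv ℝ φ z (v z))) := by
    rw [← integral_indicator hΩ.measurableSet]
    refine tendsto_integral_of_dominated_convergence (fun z => ‖fderiv ℝ φ z‖ * |C|)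
      (fun n => (hAi n).aestronglyMeasurable) ?_ ?_ ?_
    · exact (integrable_of_continuousOn_of_support_subset hφc
        (hφ.continuous_fderiv one_ne_zero).norm.continuousOn
        fun z hz => by simp [fderiv_eq_zero_of_notMem_tsupport hz]).mul_const _
    · intro n
      refine Eventually.of_forall fun z => ?_
      by_cases hz : z ∈ Metric.ball p r
      · by_cases hz' : z ∈ Ω
        · simp only [A, norm_mul]
          have h1 : ‖μ n z‖ ≤ 1 := by
            have h0 : 0 ≤ μ n z := Real.smoothTransition.nonneg _
            rw [Real.norm_of_nonneg h0]
            exact Real.smoothTransition.le_one _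
          have h2 : ‖fderiv ℝ φ z (v z)‖ ≤ ‖fderiv ℝ φ z‖ * |C| :=
            ((fderiv ℝ φ z).le_opNorm _).trans (mul_le_mul_of_nonneg_left
              ((hC z hz' hz).trans (le_abs_self C)) (norm_nonneg _))
          exact (mul_le_of_le_one_left (norm_nonneg _) h1).trans h2
        · have : τ z ≤ δ n :=
            (not_lt.1 fun h => hz' ((hc.mem_iff_chartHeight_pos hz).2 h)).trans (hδ n).le
          simp only [A, hμ0 n z this, zero_mul, norm_zero]
          positivity
      · simp [A, hφ0' z hz]
    · refine Eventually.of_forall fun z => ?_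
      by_cases hz : z ∈ Metric.ball p r
      · by_cases hz' : z ∈ Ω
        · rw [indicator_of_mem hz']
          have hpos := (hc.mem_iff_chartHeight_pos hz).1 hz'
          have hev : ∀ᶠ n in atTop, δ n < τ z / 2 := hδ0.eventually_lt_const (half_pos hpos)
          refine tendsto_const_nhds.congr' ?_
          filter_upwards [hev] with n hn
          simp only [A, μ]
          rw [smoothStep_eq_one, one_mul]
          rw [le_div_iff₀ (hδ n)]
          linarith
        · rw [indicator_of_notMem hz']
          refine tendsto_const_nhds.congr fun n => ?_
          have : τ z ≤ δ n :=
            (not_lt.1 fun h => hz' ((hc.mem_iff_chartHeight_pos hz).2 h)).trans (hδ n).le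
          simp only [A, hμ0 n z this, zero_mul]
      · have : ∀ n, A n z = 0 := fun n => by simp [A, hφ0' z hz]
        simp only [this]
        by_cases hz' : z ∈ Ω
        · simp [indicator_of_mem hz', hφ0' z hz]
        · simp [indicator_of_notMem hz']
  -- The thickness of the layer compensates the factor `1 / δ n`. With the height written as `δ n *
  -- σ` the integrand has a bound independent of `n`, and it tends to `0` pointwise by slip at the
  -- foot point.
  have hBlim : Tendsto (fun n => ∫ z, B n z) atTop (𝓝 0) := by
    let q : ℕ → ℝ → ℝ → ℂ := fun n s σ =>
      p + u * ((s : ℂ) + ((g s + δ n * σ : ℝ) : ℂ) * Complex.I)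
    have hqre : ∀ n s σ, ((starRingEnd ℂ) u * (q n s σ - p)).re = s := by
      intro n s σ
      simp only [q]
      rw [chart_coord_symm hu]
      simp
    have hqτ : ∀ n s σ, τ (q n s σ) = δ n * σ := by
      intro n s σ
      rw [hτ, chartHeight, hqre]
      simp only [q]
      rw [chart_coord_symm hu]
      simp
    let N : ℝ → ℂ := fun s => Complex.I * (u * (1 + ((deriv g s : ℝ) : ℂ) * Complex.I))
    have hNn : ∀ s, ‖N s‖ ≤ 1 + |deriv g s| := by
      intro s
      simp only [N, norm_mul, Complex.norm_I, hu, one_mul]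
      refine (norm_add_le _ _).trans ?_
      simp
    have hBq : ∀ n s σ, δ n * B n (q n s σ) =
        φ (q n s σ) * (deriv smoothStep σ * inner ℝ (N s) (v (q n s σ))) := by
      intro n s σ
      simp only [B]
      rw [hqτ, mul_div_cancel_left₀ _ (hδ n).ne', hτ, fderiv_chartHeight_apply p u hg, hqre]
      have := (hδ n).ne'
      simp only [N]
      field_simp
    have hint := fun n => integral_eq_integral_chart hu p g (hδ n) (hBi n)
    have hg'c : Continuous (deriv g) := hg.continuous_deriv le_rfl
    obtain ⟨D, hD⟩ := (isCompact_Icc (a := -r) (b := r)).exists_bound_of_continuousOn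
      hg'c.continuousOn
    let M : ℝ := Mφ * ((1 + D) * |C|)
    have hbound : ∀ n s σ, ‖δ n * B n (q n s σ)‖ ≤
        (Icc (-r) r).indicator (fun _ => M) s * ‖deriv smoothStep σ‖ := by
      intro n s σ
      by_cases hz : q n s σ ∈ Metric.ball p r
      · have hs : |s| < r := by
          have := abs_re_chart_lt hu hz
          rwa [hqre] at this
        have hs' : s ∈ Icc (-r) r := ⟨(abs_lt.1 hs).1.le, (abs_lt.1 hs).2.le⟩
        rw [indicator_of_mem hs', hBq]
        by_cases hσ : σ ∈ Icc (1 : ℝ) 2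
        · have hΩq : q n s σ ∈ Ω := by
            rw [hc.mem_iff_chartHeight_pos hz, ← hτ, hqτ]
            exact mul_pos (hδ n) (by linarith [hσ.1])
          have h1 : ‖inner ℝ (N s) (v (q n s σ))‖ ≤ (1 + D) * |C| := by
            refine (norm_inner_le_norm _ _).trans (mul_le_mul ?_ ?_ (norm_nonneg _) ?_)
            · exact (hNn s).trans (by have := hD s hs'; rw [Real.norm_eq_abs] at this; linarith)
            · exact (hC _ hΩq hz).trans (le_abs_self C)
            · have := (norm_nonneg _).trans (hD s hs'); linarith
          have h2 := hMφ (q n s σ)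
          rw [norm_mul, norm_mul]
          calc ‖φ (q n s σ)‖ * (‖deriv smoothStep σ‖ * ‖inner ℝ (N s) (v (q n s σ))‖)
              ≤ Mφ * (‖deriv smoothStep σ‖ * ((1 + D) * |C|)) := by
                refine mul_le_mul h2 (mul_le_mul_of_nonneg_left h1 (norm_nonneg _)) (by positivity)
                  ((norm_nonneg _).trans h2)
            _ = M * ‖deriv smoothStep σ‖ := by simp only [M]; ring
        · rw [deriv_smoothStep_eq_zero hσ]; simp
      · have hM : 0 ≤ (Icc (-r) r).indicator (fun _ => M) s := by
          refine indicator_nonneg (fun s' hs' => ?_) s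
          have h1 := (norm_nonneg _).trans (hMφ 0)
          have h2 := (norm_nonneg _).trans (hD s' hs')
          positivity
        rw [hBq, hφ0 _ hz, zero_mul, norm_zero]
        exact mul_nonneg hM (norm_nonneg _)
    have hstep : Integrable fun σ => ‖deriv smoothStep σ‖ :=
      (continuous_deriv_smoothStep.integrable_of_hasCompactSupport
        hasCompactSupport_deriv_smoothStep).norm
    have hpt : ∀ s σ, Tendsto (fun n => δ n * B n (q n s σ)) atTop (𝓝 0) := by
      intro s σ
      by_cases hσ : σ ∈ Icc (1 : ℝ) 2
      swap
      · refine tendsto_const_nhds.congr fun n => ?_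
        rw [hBq, deriv_smoothStep_eq_zero hσ]; simp
      have hq : Tendsto (fun n => q n s σ) atTop
          (𝓝 (p + u * ((s : ℂ) + (g s : ℂ) * Complex.I))) := by
        have h1 : Tendsto (fun n => g s + δ n * σ) atTop (𝓝 (g s)) := by
          simpa using (hδ0.mul_const σ).const_add (g s)
        have h2 : Continuous fun t : ℝ => p + u * ((s : ℂ) + (t : ℂ) * Complex.I) := by fun_prop
        exact (h2.tendsto (g s)).comp h1
      by_cases hp : p + u * ((s : ℂ) + (g s : ℂ) * Complex.I) ∈ Metric.ball p r
      · have hev := hq.eventually (Metric.isOpen_ball.mem_nhds hp)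
        have hqΩ : Tendsto (fun n => q n s σ) atTop
            (𝓝[Ω] (p + u * ((s : ℂ) + (g s : ℂ) * Complex.I))) := by
          refine tendsto_nhdsWithin_iff.2 ⟨hq, ?_⟩
          filter_upwards [hev] with n hn
          rw [hc.mem_iff_chartHeight_pos hn, ← hτ, hqτ]
          exact mul_pos (hδ n) (by linarith [hσ.1])
        have h3 := (hslip s hp).comp hqΩ
        have h4 := ((hφ.continuous.tendsto _).comp hq).mul (h3.const_mul (deriv smoothStep σ))
        simp only [mul_zero] at h4
        refine h4.congr fun n => ?_
        rw [hBq]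
        rfl
      · have hnot : p + u * ((s : ℂ) + (g s : ℂ) * Complex.I) ∈ (tsupport φ)ᶜ :=
          fun h => hp (hφs h)
        refine tendsto_const_nhds.congr' ?_
        filter_upwards [hq.eventually ((isClosed_tsupport φ).isOpen_compl.mem_nhds hnot)] with n hn
        rw [hBq, image_eq_zero_of_notMem_tsupport hn, zero_mul]
    -- Dominated convergence is used twice, first along each vertical line and then in `s`.
    have hinner : ∀ s, Tendsto (fun n => ∫ σ, δ n * B n (q n s σ)) atTop (𝓝 0) := by
      intro s
      have := tendsto_integral_of_dominated_convergence (f := fun _ => (0 : ℝ))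
        (F := fun n σ => δ n * B n (q n s σ)) (μ := volume)
        (fun σ => (Icc (-r) r).indicator (fun _ => M) s * ‖deriv smoothStep σ‖)
        (fun n => ?_) (hstep.const_mul _) (fun n => Eventually.of_forall fun σ => hbound n s σ)
        (Eventually.of_forall fun σ => hpt s σ)
      · simpa using this
      · refine Continuous.aestronglyMeasurable (continuous_const.mul ((hBcont n).comp ?_))
        simp only [q]
        fun_prop
    have houter := tendsto_integral_of_dominated_convergence (f := fun _ => (0 : ℝ))
      (F := fun n s => ∫ σ, δ n * B n (q n s σ)) (μ := volume)
      (fun s => (Icc (-r) r).indicator (fun _ => M) s * ∫ σ, ‖deriv smoothStep σ‖)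
      (fun n => (hint n).1.aestronglyMeasurable) ?_ (fun n => Eventually.of_forall fun s => ?_)
      (Eventually.of_forall fun s => hinner s)
    · simp only [integral_zero] at houter
      exact houter.congr fun n => (hint n).2.symm
    · refine Integrable.mul_const ?_ _
      rw [integrable_indicator_iff measurableSet_Icc]
      exact integrableOn_const (by simp)
    · rw [← integral_const_mul]
      exact norm_integral_le_of_norm_le (hstep.const_mul _)
        (Eventually.of_forall fun σ => hbound n s σ)
  have h := hAlim.add hBlim
  simp only [hsum, add_zero] at h
  exact (tendsto_nhds_unique tendsto_const_nhds h).symm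

theorem IsBoundaryChart.mono {Ω : Set ℂ} {p u : ℂ} {g : ℝ → ℝ} {r r' : ℝ}
    (hc : IsBoundaryChart Ω p u g r) (hr' : 0 < r') (h : r' ≤ r) :
    IsBoundaryChart Ω p u g r' :=
  ⟨hc.norm_eq_one, hc.contDiff, hc.map_zero, hr',
    fun s t hs ht => hc.mem_iff s t (hs.trans_le h) (ht.trans_le h)⟩

/-- The slip condition refers to the centre of a chart. Sliding the chart along the graph makes it
available at all nearby boundary points, with the same frame direction `u`. -/
theorem IsBoundaryChart.recenter {Ω : Set ℂ} {p u : ℂ} {g : ℝ → ℝ} {r s r' : ℝ}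
    (hc : IsBoundaryChart Ω p u g r) (hr' : 0 < r') (hs : |s| + r' ≤ r) (hgs : |g s| + r' ≤ r) :
    IsBoundaryChart Ω (p + u * ((s : ℂ) + (g s : ℂ) * Complex.I)) u
      (fun x => g (s + x) - g s) r' where
  norm_eq_one := hc.norm_eq_one
  contDiff := (hc.contDiff.comp (contDiff_const.add contDiff_id)).sub contDiff_const
  map_zero := by simp
  pos := hr'
  mem_iff a b ha hb := by
    have h1 : |s + a| < r := (abs_add_le _ _).trans_lt (by linarith)
    have h2 : |g s + b| < r := (abs_add_le _ _).trans_lt (by linarith)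
    have h3 := hc.mem_iff (s + a) (g s + b) h1 h2
    rw [sub_lt_iff_lt_add', ← h3]
    push_cast
    ring_nf

theorem IsBoundaryChart.mem_frontier {K : Set ℂ} {p u : ℂ} {g : ℝ → ℝ} {r : ℝ}
    (hc : IsBoundaryChart Kᶜ p u g r) : p ∈ frontier K := by
  refine ⟨subset_closure ?_, fun hint => ?_⟩
  · by_contra h
    have := (hc.mem_iff 0 0 (by simpa using hc.pos) (by simpa using hc.pos)).1 (by simpa using h)
    exact this.ne hc.map_zero
  · obtain ⟨ε, hε, hsub⟩ := Metric.isOpen_iff.1 isOpen_interior p hint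
    have hr := hc.pos
    set t := min (ε / 2) (r / 2) with ht
    have ht0 : 0 < t := lt_min (half_pos hε) (half_pos hr)
    have htε : t < ε := (min_le_left _ _).trans_lt (half_lt_self hε)
    have htr : t < r := (min_le_right _ _).trans_lt (half_lt_self hr)
    have h1 := (hc.mem_iff 0 t (by simpa using hr) (by rwa [abs_of_pos ht0])).2
      (by rw [hc.map_zero]; exact ht0)
    refine h1 (interior_subset (hsub ?_))
    simp [dist_eq_norm, hc.norm_eq_one, abs_of_pos ht0, htε]

/-! ### From local to global weak incompressibility -/

/-- Every point which is not a corner has a neighbourhood in which a flow, extended by zero to the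
body, is weakly divergence free. -/
theorem IsFlow.exists_ball_integral_eq_zero {K E : Set ℂ} (hK : IsBody K E) {v : ℂ → ℂ}
    (hv : IsFlow K E v) {x : ℂ} (hx : x ∉ E) : ∃ ρ > 0, ∀ φ : ℂ → ℝ, ContDiff ℝ 1 φ →
      HasCompactSupport φ → tsupport φ ⊆ Metric.ball x ρ →
      ∫ z in Kᶜ, fderiv ℝ φ z (v z) = 0 := by
  have hKc : IsClosed K := hK.isCompact.isClosed
  have hΩ : IsOpen Kᶜ := hKc.isOpen_compl
  have hw := hv.differentiableOn_complexVelocity hKc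
  by_cases hxK : x ∈ K
  swap
  · obtain ⟨ρ, hρ, hsub⟩ := Metric.isOpen_iff.1 hΩ x hxK
    refine ⟨ρ, hρ, fun φ hφ hc hs => ?_⟩
    rw [setIntegral_eq_integral_of_forall_compl_eq_zero]
    · exact integral_fderiv_apply_velocity_eq_zero hΩ hw hφ hc (hs.trans hsub)
    · intro z hz
      rw [fderiv_eq_zero_of_notMem_tsupport fun h => hz (hsub (hs h))]
      rfl
  by_cases hxi : x ∈ interior K
  · obtain ⟨ρ, hρ, hsub⟩ := Metric.isOpen_iff.1 isOpen_interior x hxi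
    refine ⟨ρ, hρ, fun φ hφ hc hs => ?_⟩
    refine setIntegral_eq_zero_of_forall_eq_zero fun z hz => ?_
    rw [fderiv_eq_zero_of_notMem_tsupport fun h => hz (interior_subset (hsub (hs h)))]
    rfl
  have hxf : x ∈ frontier K \ E := ⟨⟨subset_closure hxK, hxi⟩, hx⟩
  obtain ⟨u, g, r, hc⟩ := hK.exists_chart x hxf
  obtain ⟨r₁, hr₁, C, hC⟩ := hv.bounded_near_regular x hxf
  obtain ⟨r₂, hr₂, hE⟩ := Metric.isOpen_iff.1 hK.finite_corners.isClosed.isOpen_compl x hx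
  -- This radius fits inside the chart and inside the region of bounded velocity, and it keeps the
  -- ball free of corners.
  set ρ := min r (min r₁ r₂) with hρ
  have hρ0 : 0 < ρ := lt_min hc.pos (lt_min hr₁ hr₂)
  have hcρ := hc.mono hρ0 (min_le_left _ _)
  refine ⟨ρ, hρ0, fun φ hφ hφc hs => ?_⟩
  refine hcρ.integral_fderiv_apply_eq_zero hΩ hw (C := C) (fun z hz hzb => hC z hz ?_) ?_ hφ hφc hs
  · exact (Metric.mem_ball.1 hzb).trans_le ((min_le_right _ _).trans (min_le_left _ _))
  · intro s hsb
    have hsb' : ‖(s : ℂ) + (g s : ℂ) * Complex.I‖ < ρ := by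
      simpa [dist_eq_norm, hc.norm_eq_one] using hsb
    have h1 : |s| < ρ := by
      have := (Complex.abs_re_le_norm ((s : ℂ) + (g s : ℂ) * Complex.I)).trans_lt hsb'
      simpa using this
    have h2 : |g s| < ρ := by
      have := (Complex.abs_im_le_norm ((s : ℂ) + (g s : ℂ) * Complex.I)).trans_lt hsb'
      simpa using this
    have h3 := hcρ.recenter (s := s) (r' := min (ρ - |s|) (ρ - |g s|))
      (lt_min (by linarith) (by linarith))
      (by linarith [min_le_left (ρ - |s|) (ρ - |g s|)])
      (by linarith [min_le_right (ρ - |s|) (ρ - |g s|)])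
    have h4 := hv.slip _ ⟨h3.mem_frontier, ?_⟩ _ _ _ h3
    · simp only [chartNormal, deriv_sub_const, deriv_comp_const_add, add_zero] at h4
      exact h4
    · exact hE (Metric.ball_subset_ball ((min_le_right _ _).trans (min_le_right _ _)) hsb)

theorem integrableOn_fderiv_apply {Ω : Set ℂ} {v : ℂ → ℂ} (hv : LocallyIntegrable (Ω.indicator v))
    (hΩ : MeasurableSet Ω) {φ : ℂ → ℝ} (hφ : ContDiff ℝ 1 φ) (hc : HasCompactSupport φ) :
    IntegrableOn (fun z => fderiv ℝ φ z (v z)) Ω := by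
  have h1 : ∀ h : ℂ, Integrable fun z => fderiv ℝ φ z h • Ω.indicator v z := fun h =>
    hv.integrable_smul_left_of_hasCompactSupport
      ((hφ.continuous_fderiv one_ne_zero).clm_apply continuous_const)
      (hc.fderiv_apply ℝ h)
  have h2 := ((h1 1).re).add ((h1 Complex.I).im)
  rw [← integrable_indicator_iff hΩ]
  refine h2.congr (Eventually.of_forall fun z => ?_)
  by_cases hz : z ∈ Ω
  · simp only [Pi.add_apply, indicator_of_mem hz]
    rw [real_clm_complex_apply _ (v z)]
    simp
    ring
  · simp [indicator_of_notMem hz]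

/-- Local weak divergence freeness implies the global one, away from the corners. -/
theorem integral_fderiv_eq_zero_of_local {Ω E : Set ℂ} {v : ℂ → ℂ} (hΩ : MeasurableSet Ω)
    (hv : LocallyIntegrable (Ω.indicator v))
    (hloc : ∀ x ∉ E, ∃ ρ > 0, ∀ φ : ℂ → ℝ, ContDiff ℝ 1 φ → HasCompactSupport φ →
      tsupport φ ⊆ Metric.ball x ρ → ∫ z in Ω, fderiv ℝ φ z (v z) = 0)
    {φ : ℂ → ℝ} (hφ : ContDiff ℝ 1 φ) (hc : HasCompactSupport φ)
    (hs : ∀ e ∈ E, e ∉ tsupport φ) : ∫ z in Ω, fderiv ℝ φ z (v z) = 0 := by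
  choose! ρ hρ hρint using hloc
  have hcover : ∃ t : Finset ℂ, (∀ x ∈ t, x ∉ E) ∧
      tsupport φ ⊆ ⋃ x ∈ t, Metric.ball x (ρ x / 2) := by
    obtain ⟨t, ht, hts⟩ := hc.isCompact.elim_nhds_subcover (fun x => Metric.ball x (ρ x / 2))
      fun x hx => Metric.ball_mem_nhds x (half_pos (hρ x fun h => hs x h hx))
    exact ⟨t, fun x hx h => hs x h (ht x hx), hts⟩
  obtain ⟨t, htE, ht⟩ := hcover
  clear hs
  -- The partition of unity is built one ball at a time: `β φ` is supported in the ball about `x`,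
  -- and `(1 - β) φ` vanishes on the half ball, so its support is covered by the remaining half
  -- balls.
  induction t using Finset.induction_on generalizing φ with
  | empty =>
    refine setIntegral_eq_zero_of_forall_eq_zero fun z _ => ?_
    rw [fderiv_eq_zero_of_notMem_tsupport fun h => by simpa using ht h]
    rfl
  | insert x t hxt ih =>
    have hxE : x ∉ E := htE x (Finset.mem_insert_self _ _)
    let β : ContDiffBump x := ⟨ρ x / 2, ρ x * (3 / 4), half_pos (hρ x hxE), by
      have := hρ x hxE; linarith⟩
    have hβ : ContDiff ℝ 1 β := β.contDiff
    have hβφ : ContDiff ℝ 1 fun z => β z * φ z := hβ.mul hφ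
    have hβφ' : ContDiff ℝ 1 fun z => (1 - β z) * φ z := (contDiff_const.sub hβ).mul hφ
    have hc1 : HasCompactSupport fun z => β z * φ z := hc.mul_left
    have hc2 : HasCompactSupport fun z => (1 - β z) * φ z := hc.mul_left
    have e1 : ∫ z in Ω, fderiv ℝ (fun z => β z * φ z) z (v z) = 0 := by
      refine hρint x hxE _ hβφ hc1 ((tsupport_mul_subset_left).trans ?_)
      rw [β.tsupport_eq]
      refine Metric.closedBall_subset_ball ?_
      have := hρ x hxE
      change ρ x * (3 / 4) < ρ x
      linarith
    have e2 : ∫ z in Ω, fderiv ℝ (fun z => (1 - β z) * φ z) z (v z) = 0 := by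
      refine ih hβφ' hc2 (fun y hy => htE y (Finset.mem_insert_of_mem hy)) ?_
      intro z hz
      have h1 := ht (tsupport_mul_subset_right hz)
      rw [Finset.set_biUnion_insert] at h1
      refine h1.resolve_left fun hzb => ?_
      have : (fun z => (1 - β z) * φ z) =ᶠ[𝓝 z] 0 := by
        filter_upwards [Metric.isOpen_ball.mem_nhds hzb] with y hy
        have : β y = 1 := β.one_of_mem_closedBall (Metric.ball_subset_closedBall hy)
        simp [this]
      exact (notMem_tsupport_iff_eventuallyEq.2 this) hz
    have hsum : ∀ z, fderiv ℝ φ z = fderiv ℝ (fun z => β z * φ z) z +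
        fderiv ℝ (fun z => (1 - β z) * φ z) z := by
      intro z
      rw [← fderiv_fun_add (hβφ.differentiable one_ne_zero z)
        (hβφ'.differentiable one_ne_zero z)]
      congr 1
      ext y
      ring
    simp_rw [hsum, add_apply]
    rw [integral_add (integrableOn_fderiv_apply hv hΩ hβφ hc1)
      (integrableOn_fderiv_apply hv hΩ hβφ' hc2), e1, e2, add_zero]

theorem IsFlow.memLp_indicator {K E : Set ℂ} (hK : IsCompact K) {v : ℂ → ℂ}
    (hv : IsFlow K E v) (R : ℝ) : MemLp ((Kᶜ ∩ Metric.ball 0 R).indicator v) 2 := by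
  have hΩ := hK.isClosed.isOpen_compl
  have hm : MeasurableSet (Kᶜ ∩ Metric.ball (0 : ℂ) R) :=
    (hΩ.inter Metric.isOpen_ball).measurableSet
  rw [memLp_indicator_iff_restrict hm, memLp_two_iff_integrable_sq_norm]
  · exact hv.square_integrable R
  · exact (hv.differentiableOn.continuousOn.mono inter_subset_left).aestronglyMeasurable hm

theorem IsFlow.locallyIntegrable {K E : Set ℂ} (hK : IsCompact K) {v : ℂ → ℂ}
    (hv : IsFlow K E v) : LocallyIntegrable (Kᶜ.indicator v) := by
  intro x
  refine ⟨Metric.ball 0 (‖x‖ + 1), Metric.isOpen_ball.mem_nhds (by simp), ?_⟩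
  have h1 : LocallyIntegrable ((Kᶜ ∩ Metric.ball 0 (‖x‖ + 1)).indicator v) :=
    (hv.memLp_indicator hK _).locallyIntegrable (by norm_num)
  have h2 : IntegrableOn ((Kᶜ ∩ Metric.ball 0 (‖x‖ + 1)).indicator v)
      (Metric.ball 0 (‖x‖ + 1)) :=
    (h1.integrableOn_isCompact (isCompact_closedBall 0 (‖x‖ + 1))).mono_set
      Metric.ball_subset_closedBall
  refine h2.congr_fun (fun z hz => ?_) measurableSet_ball
  by_cases hzK : z ∈ Kᶜ
  · rw [indicator_of_mem hzK, indicator_of_mem (s := Kᶜ ∩ Metric.ball 0 _) ⟨hzK, hz⟩]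
  · rw [indicator_of_notMem hzK, indicator_of_notMem fun h => hzK h.1]

/-- A flow, extended by zero to the body, is weakly divergence free in the whole plane. -/
theorem IsFlow.integral_fderiv_eq_zero {K E : Set ℂ} (hK : IsBody K E) {v : ℂ → ℂ}
    (hv : IsFlow K E v) {φ : ℂ → ℝ} (hφ : ContDiff ℝ 1 φ) (hc : HasCompactSupport φ) :
    ∫ z in Kᶜ, fderiv ℝ φ z (v z) = 0 := by
  have hΩ := hK.isCompact.isClosed.isOpen_compl
  have hm : MeasurableSet Kᶜ := hΩ.measurableSet
  have hli := hv.locallyIntegrable hK.isCompact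
  obtain ⟨χ, hχ⟩ := exists_isCutoffSeq hK.finite_corners
  have hzero : ∀ n, ∫ z in Kᶜ, fderiv ℝ (fun y => χ n y * φ y) z (v z) = 0 := fun n =>
    integral_fderiv_eq_zero_of_local hm hli
      (fun x hx => hv.exists_ball_integral_eq_zero hK hx) ((hχ.contDiff n).mul hφ) hc.mul_left
      fun e he h => hχ.notMem_tsupport n e he (tsupport_mul_subset_left h)
  have hφi := integrableOn_fderiv_apply hli hm hφ hc
  obtain ⟨R, hR⟩ := hc.isCompact.isBounded.subset_ball (0 : ℂ)
  obtain ⟨M, hM⟩ := hc.exists_bound_of_continuous hφ.continuous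
  -- The velocity is square integrable only on bounded sets, hence the ball, which contains the
  -- support of `φ`. The term in which `χ n` is differentiated pairs its differential with `X`, so
  -- it tends to `0`.
  set X : ℂ → ℂ := fun z => φ z • (Kᶜ ∩ Metric.ball 0 R).indicator v z with hX
  have hXL : MemLp X 2 := by
    refine (hv.memLp_indicator hK.isCompact R).of_le_mul (c := M)
      (hφ.continuous.aestronglyMeasurable.smul
        (hv.memLp_indicator hK.isCompact R).aestronglyMeasurable)
      (Eventually.of_forall fun z => ?_)
    rw [hX, norm_smul]
    exact mul_le_mul_of_nonneg_right (hM z) (norm_nonneg _)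
  have hlim := hχ.tendsto_integral_fderiv_apply hXL
  have hdec : ∀ n, ∫ z in Kᶜ, χ n z * fderiv ℝ φ z (v z) = - ∫ z, fderiv ℝ (χ n) z (X z) := by
    intro n
    have hi1 : IntegrableOn (fun z => χ n z * fderiv ℝ φ z (v z)) Kᶜ := by
      refine Integrable.mono hφi (((hχ.contDiff n).continuous.aestronglyMeasurable).mul
        hφi.aestronglyMeasurable) (Eventually.of_forall fun z => ?_)
      rw [norm_mul, Real.norm_of_nonneg (hχ.nonneg n z)]
      exact mul_le_of_le_one_left (norm_nonneg _) (hχ.le_one n z)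
    have hi2 := integrableOn_fderiv_apply hli hm ((hχ.contDiff n).mul hφ) hc.mul_left
    have hpt : ∀ z, fderiv ℝ (fun y => χ n y * φ y) z (v z) - χ n z * fderiv ℝ φ z (v z) =
        φ z * fderiv ℝ (χ n) z (v z) := by
      intro z
      rw [fderiv_fun_mul ((hχ.contDiff n).differentiable one_ne_zero z)
        (hφ.differentiable one_ne_zero z)]
      simp
    have h3 : ∫ z in Kᶜ, φ z * fderiv ℝ (χ n) z (v z) = ∫ z, fderiv ℝ (χ n) z (X z) := by
      rw [← integral_indicator hm]
      congr 1
      ext z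
      simp only [hX]
      rw [map_smul, smul_eq_mul]
      by_cases hzs : z ∈ tsupport φ
      · by_cases hzK : z ∈ Kᶜ
        · rw [indicator_of_mem hzK, indicator_of_mem (s := Kᶜ ∩ Metric.ball 0 _) ⟨hzK, hR hzs⟩]
        · rw [indicator_of_notMem hzK, indicator_of_notMem fun h => hzK h.1, map_zero, mul_zero]
      · have h0 := image_eq_zero_of_notMem_tsupport hzs
        rw [h0, zero_mul]
        by_cases hzK : z ∈ Kᶜ
        · rw [indicator_of_mem hzK, h0, zero_mul]
        · rw [indicator_of_notMem hzK]
    rw [← h3, ← integral_congr_ae (Eventually.of_forall hpt), integral_sub hi2 hi1, hzero n]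
    simp
  have hlim2 : Tendsto (fun n => ∫ z in Kᶜ, χ n z * fderiv ℝ φ z (v z)) atTop
      (𝓝 (∫ z in Kᶜ, fderiv ℝ φ z (v z))) := by
    refine tendsto_integral_of_dominated_convergence (fun z => ‖fderiv ℝ φ z (v z)‖)
      (fun n => ((hχ.contDiff n).continuous.aestronglyMeasurable).mul hφi.aestronglyMeasurable)
      hφi.norm (fun n => Eventually.of_forall fun z => ?_) ?_
    · rw [norm_mul, Real.norm_of_nonneg (hχ.nonneg n z)]
      exact mul_le_of_le_one_left (norm_nonneg _) (hχ.le_one n z)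
    · filter_upwards [ae_restrict_of_ae hχ.ae_tendsto] with z hz
      simpa using hz.mul_const (fderiv ℝ φ z (v z))
  simp only [hdec] at hlim2
  have := tendsto_nhds_unique hlim2 hlim.neg
  simpa using this

/-! ### Stream functions of weakly divergence free fields -/

open scoped Convolution

/-- The flux form: `fluxForm a h` is the flux of the constant field `a` across the segment `h`. -/
noncomputable def fluxForm : ℂ →L[ℝ] ℂ →L[ℝ] ℝ :=
  (ContinuousLinearMap.compL ℝ ℂ ℂ ℝ Complex.imCLM).comp
    ((ContinuousLinearMap.mul ℝ ℂ).comp (Complex.conjCLE : ℂ →L[ℝ] ℂ))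

theorem fluxForm_apply (a h : ℂ) : fluxForm a h = ((starRingEnd ℂ) a * h).im := by
  simp [fluxForm]

theorem norm_fluxForm_le (a : ℂ) : ‖fluxForm a‖ ≤ ‖a‖ := by
  refine ContinuousLinearMap.opNorm_le_bound _ (norm_nonneg _) fun h => ?_
  rw [fluxForm_apply]
  refine (Complex.abs_im_le_norm _).trans ?_
  simp

/-- This is the source of the energy: the differential of the stream function, evaluated on the
rotated velocity, is the squared speed. -/
theorem fluxForm_self_mul_I (a : ℂ) : fluxForm a (Complex.I * a) = ‖a‖ ^ 2 := by
  rw [fluxForm_apply, ← Complex.normSq_eq_norm_sq, Complex.normSq_apply]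
  simp

theorem eq_zero_of_fluxForm_eq_zero {a : ℂ} (h : fluxForm a = 0) : a = 0 := by
  have := fluxForm_self_mul_I a
  rw [h] at this
  simpa using this.symm

/-- The mollification of a weakly divergence free field is divergence free. -/
theorem div_convolution_eq_zero {V : ℂ → ℂ} (hV : LocallyIntegrable V)
    (hdiv : ∀ φ : ℂ → ℝ, ContDiff ℝ 1 φ → HasCompactSupport φ → ∫ z, fderiv ℝ φ z (V z) = 0)
    {f : ℂ → ℝ} (hf : ContDiff ℝ 1 f) (hfc : HasCompactSupport f) (x : ℂ) :
    (fderiv ℝ (f ⋆[ContinuousLinearMap.lsmul ℝ ℝ, volume] V) x 1).re +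
      (fderiv ℝ (f ⋆[ContinuousLinearMap.lsmul ℝ ℝ, volume] V) x Complex.I).im = 0 := by
  have hd := hfc.hasFDerivAt_convolution_left (ContinuousLinearMap.lsmul ℝ ℝ) hf hV x
  rw [hd.fderiv]
  have hex := (hfc.fderiv (𝕜 := ℝ)).convolutionExists_left
    ((ContinuousLinearMap.lsmul ℝ ℝ : ℝ →L[ℝ] ℂ →L[ℝ] ℂ).precompL ℂ)
    (hf.continuous_fderiv one_ne_zero) hV x
  have happ : ∀ h : ℂ, (fderiv ℝ f ⋆[(ContinuousLinearMap.lsmul ℝ ℝ).precompL ℂ, volume] V) x h =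
      ∫ t, fderiv ℝ f t h • V (x - t) := by
    intro h
    rw [convolution_def, ContinuousLinearMap.integral_apply hex]
    rfl
  have hint : ∀ h : ℂ, Integrable fun t => fderiv ℝ f t h • V (x - t) := fun h =>
    hex.integrable.apply_continuousLinearMap h
  rw [happ, happ]
  have e1 : (∫ t, fderiv ℝ f t 1 • V (x - t)).re = ∫ t, (fderiv ℝ f t 1 • V (x - t)).re :=
    (integral_re (hint 1)).symm
  have e2 : (∫ t, fderiv ℝ f t Complex.I • V (x - t)).im =
      ∫ t, (fderiv ℝ f t Complex.I • V (x - t)).im :=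
    (integral_im (hint Complex.I)).symm
  have e3 : ∀ t, (fderiv ℝ f t 1 • V (x - t)).re + (fderiv ℝ f t Complex.I • V (x - t)).im =
      fderiv ℝ f t (V (x - t)) := by
    intro t
    rw [real_clm_complex_apply _ (V (x - t))]
    simp
    ring
  rw [e1, e2]
  refine ((integral_add (hint 1).re (hint Complex.I).im).symm.trans
    (integral_congr_ae (Eventually.of_forall e3))).trans ?_
  -- The divergence at `x` is, up to sign, the weak identity tested with the reflected kernel.
  have hφ : ContDiff ℝ 1 fun t => f (x - t) := hf.comp (contDiff_const.sub contDiff_id)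
  have hφc : HasCompactSupport fun t => f (x - t) :=
    hfc.comp_homeomorph (Homeomorph.subLeft x)
  have h0 := hdiv _ hφ hφc
  rw [← integral_sub_left_eq_self _ volume x] at h0
  refine Eq.trans ?_ (neg_eq_zero.2 h0)
  rw [← integral_neg]
  congr 1
  ext t
  have hd : HasFDerivAt (fun t => f (x - t)) (-(fderiv ℝ f t)) (x - t) := by
    have h1 : HasFDerivAt f (fderiv ℝ f t) (x - (x - t)) := by
      rw [sub_sub_cancel]
      exact (hf.differentiable one_ne_zero t).hasFDerivAt
    have h2 := h1.comp (x - t) ((hasFDerivAt_id (x - t)).const_sub x)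
    refine h2.congr_fderiv ?_
    ext; simp
  rw [hd.fderiv]
  simp

/-- A divergence free `C¹` field in the plane has a stream function. -/
theorem exists_hasFDerivAt_fluxForm {W : ℂ → ℂ} (hW : Differentiable ℝ W)
    (hdiv : ∀ z, (fderiv ℝ W z 1).re + (fderiv ℝ W z Complex.I).im = 0) (z₀ : ℂ) :
    ∃ F : ℂ → ℝ, F z₀ = 0 ∧ ∀ z, HasFDerivAt F (fluxForm (W z)) z := by
  have hd : ∀ z, HasFDerivAt (fun z => fluxForm (W z)) (fluxForm.comp (fderiv ℝ W z)) z := fun z =>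
    fluxForm.hasFDerivAt.comp z (hW z).hasFDerivAt
  -- Poincaré's lemma on the plane: the flux form of `W` is closed precisely because the divergence
  -- vanishes.
  obtain ⟨F, hF⟩ := Convex.exists_forall_hasFDerivAt_of_fderiv_symmetric
    (ω := fun z => fluxForm (W z)) convex_univ isOpen_univ
    (fun z _ => (hd z).differentiableAt.differentiableWithinAt) (by
      intro a _ x y
      rw [(hd a).fderiv]
      simp only [ContinuousLinearMap.comp_apply]
      have hlin : ∀ y : ℂ, fderiv ℝ W a y =
          y.re • fderiv ℝ W a 1 + y.im • fderiv ℝ W a Complex.I := by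
        intro y
        rw [← map_smul, ← map_smul, ← map_add]
        congr 1
        simp
      rw [hlin x, hlin y]
      simp only [fluxForm_apply]
      have := hdiv a
      simp
      linear_combination (x.re * y.im - x.im * y.re) * this)
  exact ⟨fun z => F z - F z₀, by simp, fun z => (hF z trivial).sub_const _⟩

/-- The points near which `V` is bounded. -/
def locallyBoundedSet (V : ℂ → ℂ) : Set ℂ :=
  {z | ∃ r > 0, ∃ C : ℝ, ∀ y ∈ Metric.ball z r, ‖V y‖ ≤ C}

theorem isOpen_locallyBoundedSet (V : ℂ → ℂ) : IsOpen (locallyBoundedSet V) := by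
  rw [Metric.isOpen_iff]
  rintro z ⟨r, hr, C, hC⟩
  refine ⟨r, hr, fun y hy => ?_⟩
  obtain ⟨ε, hε, hsub⟩ := Metric.isOpen_iff.1 Metric.isOpen_ball y hy
  exact ⟨ε, hε, C, fun x hx => hC x (hsub hx)⟩

theorem ContinuousAt.mem_locallyBoundedSet {V : ℂ → ℂ} {z : ℂ} (h : ContinuousAt V z) :
    z ∈ locallyBoundedSet V := by
  obtain ⟨r, hr, hV⟩ := Metric.continuousAt_iff.1 h 1 one_pos
  refine ⟨r, hr, ‖V z‖ + 1, fun y hy => ?_⟩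
  have := hV (Metric.mem_ball.1 hy)
  rw [dist_eq_norm] at this
  linarith [norm_sub_norm_le (V y) (V z)]

/-- A weakly divergence free field which is locally bounded off a set that does not separate the
plane has a locally Lipschitz stream function there. -/
theorem exists_stream_of_weak_div_eq_zero {V : ℂ → ℂ} (hV : LocallyIntegrable V)
    (hdiv : ∀ φ : ℂ → ℝ, ContDiff ℝ 1 φ → HasCompactSupport φ → ∫ z, fderiv ℝ φ z (V z) = 0)
    (hB : IsPreconnected (locallyBoundedSet V)) {z₀ : ℂ} (hz₀ : z₀ ∈ locallyBoundedSet V) :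
    ∃ F : ℂ → ℝ, F z₀ = 0 ∧
      (∀ z r C, 0 < r → (∀ y ∈ Metric.ball z r, ‖V y‖ ≤ C) →
        ∀ x ∈ Metric.ball z (r / 2), ∀ y ∈ Metric.ball z (r / 2), |F x - F y| ≤ 3 * C * ‖x - y‖) ∧
      ∀ z, ContinuousAt V z → HasFDerivAt F (fluxForm (V z)) z := by
  let b : ℕ → ContDiffBump (0 : ℂ) := fun n =>
    ⟨1 / (2 * ((n : ℝ) + 1)), 1 / ((n : ℝ) + 1), by positivity, by
      refine one_div_lt_one_div_of_lt (by positivity) ?_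
      have : (0 : ℝ) < n + 1 := by positivity
      linarith⟩
  have hb0 : Tendsto (fun n => (b n).rOut) atTop (𝓝 0) := tendsto_one_div_add_atTop_nhds_zero_nat
  let W : ℕ → ℂ → ℂ := fun n => (b n).normed volume ⋆[ContinuousLinearMap.lsmul ℝ ℝ, volume] V
  have hbd : ∀ n, ContDiff ℝ 1 ((b n).normed volume) := fun n => (b n).contDiff_normed
  have hWd : ∀ n, Differentiable ℝ (W n) := fun n x =>
    ((b n).hasCompactSupport_normed.hasFDerivAt_convolution_left _ (hbd n) hV x).differentiableAt
  have hWdiv : ∀ n z, (fderiv ℝ (W n) z 1).re + (fderiv ℝ (W n) z Complex.I).im = 0 := fun n z =>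
    div_convolution_eq_zero hV hdiv (hbd n) (b n).hasCompactSupport_normed z
  choose F hF0 hF using fun n => exists_hasFDerivAt_fluxForm (hWd n) (hWdiv n) z₀
  have hVm : AEStronglyMeasurable V := hV.aestronglyMeasurable
  -- Used with `c = 0` for uniform Lipschitz bounds, where `‖W n‖ ≤ C + 2 C` explains the constant
  -- `3 C`, and with `c = V z` for convergence of the differentials near a point of continuity.
  have hWapprox : ∀ {z : ℂ} {r ε : ℝ} {c : ℂ}, 0 < r →
      (∀ y ∈ Metric.ball z r, dist (V y) c ≤ ε) →
      ∀ᶠ n in atTop, ∀ y ∈ Metric.ball z (r / 2), dist (W n y) (V y) ≤ 2 * ε := by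
    intro z r ε c hr hε
    filter_upwards [hb0.eventually_lt_const (half_pos hr)] with n hn y hy
    refine (b n).dist_normed_convolution_le hVm fun x hx => ?_
    have hyr : y ∈ Metric.ball z r := Metric.ball_subset_ball (by linarith) hy
    have hxr : x ∈ Metric.ball z r := by
      rw [Metric.mem_ball] at *
      linarith [dist_triangle x y z]
    linarith [dist_triangle_right (V x) (V y) c, hε x hxr, hε y hyr]
  have hFlip : ∀ {z : ℂ} {r C : ℝ}, 0 < r → (∀ y ∈ Metric.ball z r, ‖V y‖ ≤ C) →
      ∀ᶠ n in atTop, ∀ x ∈ Metric.ball z (r / 2), ∀ y ∈ Metric.ball z (r / 2),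
        |F n x - F n y| ≤ 3 * C * ‖x - y‖ := by
    intro z r C hr hC
    filter_upwards [hWapprox (c := 0) hr fun y hy => by simpa using hC y hy] with n hn x hx y hy
    have := (convex_ball z (r / 2)).norm_image_sub_le_of_norm_hasFDerivWithin_le (𝕜 := ℝ)
      (f := F n) (C := 3 * C) (fun w _ => (hF n w).hasFDerivWithinAt) (fun w hw => ?_) hy hx
    · simpa using this
    · refine (norm_fluxForm_le _).trans ?_
      have h1 := hn w hw
      have h2 := hC w (Metric.ball_subset_ball (by linarith) hw)
      rw [dist_eq_norm] at h1
      linarith [norm_sub_norm_le (W n w) (V w)]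
  -- The Lipschitz bounds make boundedness of the sequence an open and closed condition on the
  -- locally bounded set, and it holds at `z₀` by the normalisation. Connectedness spreads it
  -- everywhere.
  let S : Set ℂ := {z | ∃ M : ℝ, ∀ᶠ n in atTop, |F n z| ≤ M}
  have hSloc : ∀ {z : ℂ} {r C : ℝ}, 0 < r → (∀ y ∈ Metric.ball z r, ‖V y‖ ≤ C) →
      ∀ x ∈ Metric.ball z (r / 2), ∀ y ∈ Metric.ball z (r / 2), x ∈ S → y ∈ S := by
    rintro z r C hr hC x hx y hy ⟨M, hM⟩
    refine ⟨M + 3 * C * ‖y - x‖, ?_⟩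
    filter_upwards [hM, hFlip hr hC] with n h1 h2
    have := h2 y hy x hx
    linarith [abs_sub_abs_le_abs_sub (F n y) (F n x)]
  have hBS : locallyBoundedSet V ⊆ S := by
    have := hB.subset_of_closure_inter_subset (u := locallyBoundedSet V ∩ S) ?_ ?_ ?_
    · exact this.trans inter_subset_right
    · rw [Metric.isOpen_iff]
      rintro z ⟨hzB, hzS⟩
      obtain ⟨ε, hε, hsub⟩ := Metric.isOpen_iff.1 (isOpen_locallyBoundedSet V) z hzB
      obtain ⟨r, hr, C, hC⟩ := hzB
      refine ⟨min ε (r / 2), lt_min hε (half_pos hr), fun y hy => ⟨hsub ?_, ?_⟩⟩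
      · exact Metric.ball_subset_ball (min_le_left _ _) hy
      · exact hSloc hr hC z (Metric.mem_ball_self (half_pos hr)) y
          (Metric.ball_subset_ball (min_le_right _ _) hy) hzS
    · exact ⟨z₀, hz₀, hz₀, 0, Eventually.of_forall fun n => by simp [hF0]⟩
    · rintro z ⟨hzc, hzB⟩
      refine ⟨hzB, ?_⟩
      obtain ⟨r, hr, C, hC⟩ := hzB
      obtain ⟨y, hyu, hy⟩ := Metric.mem_closure_iff.1 hzc (r / 2) (half_pos hr)
      exact hSloc hr hC y (by rwa [Metric.mem_ball, dist_comm]) z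
        (Metric.mem_ball_self (half_pos hr)) hyu.2
  -- Along an ultrafilter every bounded real sequence converges, so the limit exists at all points
  -- at once, with no extraction of subsequences.
  let l : Ultrafilter ℕ := Ultrafilter.of atTop
  have hl : (l : Filter ℕ) ≤ atTop := Ultrafilter.of_le _
  have hlim : ∀ z, ∃ a : ℝ, z ∈ locallyBoundedSet V → Tendsto (fun n => F n z) l (𝓝 a) := by
    intro z
    by_cases hz : z ∈ locallyBoundedSet V
    · obtain ⟨M, hM⟩ := hBS hz
      obtain ⟨a, -, ha⟩ := (isCompact_Icc (a := -M) (b := M)).ultrafilter_le_nhds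
        (l.map fun n => F n z) (by
          rw [le_principal_iff]
          exact (hM.filter_mono hl).mono fun n hn => abs_le.1 hn)
      exact ⟨a, fun _ => ha⟩
    · exact ⟨0, fun h => absurd h hz⟩
  choose G hG using hlim
  have hGL : ∀ z r C, 0 < r → (∀ y ∈ Metric.ball z r, ‖V y‖ ≤ C) →
      ∀ x ∈ Metric.ball z (r / 2), ∀ y ∈ Metric.ball z (r / 2),
        |G x - G y| ≤ 3 * C * ‖x - y‖ := by
    intro z r C hr hC x hx y hy
    have hmem : ∀ x ∈ Metric.ball z (r / 2), x ∈ locallyBoundedSet V := by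
      intro x hx
      obtain ⟨ε, hε, hsub⟩ := Metric.isOpen_iff.1 Metric.isOpen_ball x
        (Metric.ball_subset_ball (by linarith) hx : x ∈ Metric.ball z r)
      exact ⟨ε, hε, C, fun y hy => hC y (hsub hy)⟩
    have h1 := ((hG x (hmem x hx)).sub (hG y (hmem y hy))).abs
    exact le_of_tendsto h1 (((hFlip hr hC).filter_mono hl).mono fun n hn => hn x hx y hy)
  refine ⟨G, ?_, hGL, fun z hz => ?_⟩
  · have := hG z₀ hz₀
    simp only [hF0] at this
    exact (tendsto_nhds_unique this tendsto_const_nhds)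
  -- For each `ε` the differentials are eventually `ε`-close on some neighbourhood of `z`, so the
  -- limit may be differentiated at `z`.
  · refine hasFDerivAt_of_tendstoUniformlyOnFilter (𝕜 := ℝ) (l := (l : Filter ℕ))
      (f' := fun n y => fluxForm (W n y)) (g' := fun y => fluxForm (V y)) (f := F) ?_
      (Eventually.of_forall fun n => hF n.1 n.2) ?_
    · rw [Metric.tendstoUniformlyOnFilter_iff]
      intro ε hε
      obtain ⟨r, hr, hVr⟩ := Metric.continuousAt_iff.1 hz (ε / 4) (by linarith)
      have h1 := hWapprox (z := z) (c := V z) (ε := ε / 4) hr fun y hy =>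
        (hVr (Metric.mem_ball.1 hy)).le
      have h2 := (h1.filter_mono hl).prod_mk (Metric.ball_mem_nhds z (half_pos hr))
      refine h2.mono ?_
      rintro ⟨n, y⟩ ⟨hn, hy⟩
      rw [dist_comm, dist_eq_norm, ← map_sub]
      refine (norm_fluxForm_le _).trans_lt ?_
      have := hn y hy
      rw [dist_eq_norm] at this
      linarith
    · filter_upwards [(isOpen_locallyBoundedSet V).mem_nhds hz.mem_locallyBoundedSet] with y hy
        using hG y hy

/-! ### The stream function of a flow around a body -/

/-- A stream function of the flow `v` around `K`, vanishing on the body. -/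
structure IsStreamFunction (K : Set ℂ) (v : ℂ → ℂ) (F : ℂ → ℝ) : Prop where
  hasFDerivAt : ∀ z ∈ Kᶜ, HasFDerivAt F (fluxForm (v z)) z
  exists_abs_le : ∀ z ∈ K, VelocityBoundedNear K v z →
    ∃ r > 0, ∃ C : ℝ, ∀ x ∈ Metric.ball z r, |F x| ≤ C * ‖x - z‖

theorem IsStreamFunction.neg {K : Set ℂ} {v : ℂ → ℂ} {F : ℂ → ℝ} (h : IsStreamFunction K v F) :
    IsStreamFunction K (fun z => -v z) fun z => -F z where
  hasFDerivAt z hz := by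
    rw [map_neg]
    exact (h.hasFDerivAt z hz).neg
  exists_abs_le z hz hb := by
    have hb' : VelocityBoundedNear K v z := by simpa [VelocityBoundedNear] using hb
    simpa using h.exists_abs_le z hz hb'

theorem IsStreamFunction.contDiffOn {K : Set ℂ} (hK : IsClosed K) {v : ℂ → ℂ} {F : ℂ → ℝ}
    (h : IsStreamFunction K v F) (hv : ContinuousOn v Kᶜ) : ContDiffOn ℝ 1 F Kᶜ := by
  rw [show (1 : WithTop ℕ∞) = 0 + 1 from rfl,
    contDiffOn_succ_iff_fderiv_of_isOpen hK.isOpen_compl]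
  refine ⟨fun z hz => (h.hasFDerivAt z hz).differentiableAt.differentiableWithinAt,
    by simp, ?_⟩
  rw [contDiffOn_zero]
  exact (fluxForm.continuous.comp_continuousOn hv).congr fun z hz => (h.hasFDerivAt z hz).fderiv

theorem velocityBoundedNear_of_notMem {K E : Set ℂ} {v : ℂ → ℂ} (hv : IsFlow K E v) {z : ℂ}
    (hzK : z ∈ K) (hz : z ∉ E) : VelocityBoundedNear K v z := by
  by_cases hi : z ∈ interior K
  · obtain ⟨r, hr, hsub⟩ := Metric.isOpen_iff.1 isOpen_interior z hi
    exact ⟨r, hr, 0, fun y hy hyr => absurd (interior_subset (hsub hyr)) hy⟩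
  · exact hv.bounded_near_regular z ⟨⟨subset_closure hzK, hi⟩, hz⟩

theorem VelocityBoundedNear.exists_indicator_le {K : Set ℂ} {v : ℂ → ℂ} {z : ℂ}
    (h : VelocityBoundedNear K v z) :
    ∃ r > 0, ∃ C : ℝ, ∀ y ∈ Metric.ball z r, ‖Kᶜ.indicator v y‖ ≤ C := by
  obtain ⟨r, hr, C, hC⟩ := h
  refine ⟨r, hr, |C|, fun y hy => ?_⟩
  by_cases hyK : y ∈ Kᶜ
  · rw [indicator_of_mem hyK]
    exact (hC y hyK hy).trans (le_abs_self C)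
  · rw [indicator_of_notMem hyK, norm_zero]
    exact abs_nonneg C

/-- Every flow around a solid body has a stream function vanishing on the body. -/
theorem IsFlow.exists_isStreamFunction {K E : Set ℂ} (hK : IsBody K E) {v : ℂ → ℂ}
    (hv : IsFlow K E v) : ∃ F, IsStreamFunction K v F := by
  have hKc : IsClosed K := hK.isCompact.isClosed
  have hΩ : IsOpen Kᶜ := hKc.isOpen_compl
  set V : ℂ → ℂ := Kᶜ.indicator v with hVdef
  have hVcont : ∀ z ∈ Kᶜ, ContinuousAt V z := by
    intro z hz
    refine (hv.differentiableOn.continuousOn.continuousAt (hΩ.mem_nhds hz)).congr ?_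
    filter_upwards [hΩ.mem_nhds hz] with y hy
    exact (indicator_of_mem hy v).symm
  have hVzero : ∀ z ∈ interior K, V =ᶠ[𝓝 z] fun _ => 0 := by
    intro z hz
    filter_upwards [isOpen_interior.mem_nhds hz] with y hy
    exact indicator_of_notMem (s := Kᶜ) (fun h => h (interior_subset hy)) v
  have hbdd : (locallyBoundedSet V)ᶜ ⊆ E := by
    intro z hz
    by_contra hzE
    refine hz ?_
    by_cases hzK : z ∈ K
    · exact (velocityBoundedNear_of_notMem hv hzK hzE).exists_indicator_le
    · exact (hVcont z hzK).mem_locallyBoundedSet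
  -- Only corners can be missing from this set, and removing countably many points does not
  -- disconnect the plane.
  have hconn : IsPreconnected (locallyBoundedSet V) := by
    have := ((hK.finite_corners.subset hbdd).countable).isConnected_compl_of_one_lt_rank
      (by rw [Complex.rank_real_complex]; norm_num)
    rw [compl_compl] at this
    exact this.isPreconnected
  have hdiv : ∀ φ : ℂ → ℝ, ContDiff ℝ 1 φ → HasCompactSupport φ →
      ∫ z, fderiv ℝ φ z (V z) = 0 := by
    intro φ hφ hc
    rw [← hv.integral_fderiv_eq_zero hK hφ hc, ← integral_indicator hΩ.measurableSet]
    congr 1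
    ext z
    by_cases hz : z ∈ Kᶜ
    · rw [hVdef, indicator_of_mem hz, indicator_of_mem hz]
    · rw [hVdef, indicator_of_notMem hz, indicator_of_notMem hz, map_zero]
  obtain ⟨z₀, hz₀⟩ := hK.isConnected_interior.nonempty
  have hint0 : ∀ z ∈ interior K, ContinuousAt V z := fun z hz =>
    continuousAt_const.congr (hVzero z hz).symm
  obtain ⟨F, hF0, hFL, hFd⟩ := exists_stream_of_weak_div_eq_zero
    (hv.locallyIntegrable hK.isCompact) hdiv hconn (hint0 z₀ hz₀).mem_locallyBoundedSet
  -- The extended field vanishes on the interior, which is connected, so `F` keeps there its value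
  -- at `z₀`.
  have hFint : ∀ z ∈ interior K, F z = 0 := by
    intro z hz
    have hd : ∀ z ∈ interior K, HasFDerivAt F (0 : ℂ →L[ℝ] ℝ) z := by
      intro z hz
      have := hFd z (hint0 z hz)
      rwa [show Kᶜ.indicator v z = 0 from (hVzero z hz).self_of_nhds, map_zero] at this
    rw [← hF0]
    exact isOpen_interior.is_const_of_fderiv_eq_zero (𝕜 := ℝ)
      hK.isConnected_interior.isPreconnected
      (fun z hz => (hd z hz).differentiableAt.differentiableWithinAt)
      (fun z hz => (hd z hz).fderiv) hz hz₀
  refine ⟨F, fun z hz => ?_, fun z hzK hb => ?_⟩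
  · have := hFd z (hVcont z hz)
    rwa [indicator_of_mem hz] at this
  · obtain ⟨r, hr, C, hC⟩ := hb.exists_indicator_le
    have hC0 : 0 ≤ C := (norm_nonneg _).trans (hC z (Metric.mem_ball_self hr))
    have hzself := Metric.mem_ball_self (x := z) (half_pos hr)
    -- The Lipschitz bound near `z` carries the value `0` from the interior to its closure `K`. This
    -- includes corners near which the velocity is bounded, as the corner argument requires.
    have hFz : F z = 0 := by
      have hzc : z ∈ closure (interior K) := by rwa [hK.closure_interior]
      refine abs_nonpos_iff.1 (le_of_forall_pos_le_add fun ε hε => ?_)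
      obtain ⟨y, hyi, hy⟩ := Metric.mem_closure_iff.1 hzc (min (r / 2) (ε / (3 * C + 1)))
        (lt_min (half_pos hr) (by positivity))
      have h1 := hFL z r C hr hC z hzself y
        (by rw [Metric.mem_ball, dist_comm]; exact hy.trans_le (min_le_left _ _))
      rw [hFint y hyi, sub_zero] at h1
      rw [dist_eq_norm] at hy
      have h2 : ‖z - y‖ ≤ ε / (3 * C + 1) := (hy.trans_le (min_le_right _ _)).le
      calc |F z| ≤ 3 * C * ‖z - y‖ := h1
        _ ≤ (3 * C + 1) * (ε / (3 * C + 1)) := by gcongr; linarith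
        _ = 0 + ε := by field_simp; ring
    refine ⟨r / 2, half_pos hr, 3 * C, fun x hx => ?_⟩
    have := hFL z r C hr hC x hx z hzself
    rwa [hFz, sub_zero] at this

/-! ### The energy argument -/

/-- Squaring makes the positive part continuously differentiable. This smooths the truncation and
later the negative part of the stream function. -/
theorem hasDerivAt_max_zero_sq (x : ℝ) :
    HasDerivAt (fun y : ℝ => max y 0 ^ 2) (2 * max x 0) x := by
  rcases lt_trichotomy x 0 with h | h | h
  · rw [max_eq_right h.le, mul_zero]
    refine (hasDerivAt_const x (0 : ℝ)).congr_of_eventuallyEq ?_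
    filter_upwards [Iio_mem_nhds h] with y hy
    rw [max_eq_right (le_of_lt hy)]
    simp
  · subst h
    have hO : (fun y : ℝ => max y 0 ^ 2) =O[𝓝 0] fun y : ℝ => ‖y - 0‖ ^ 2 := by
      refine Asymptotics.IsBigO.of_bound 1 (Eventually.of_forall fun y => ?_)
      have h1 : |max y 0| ≤ |y| := by
        rw [abs_of_nonneg (le_max_right y 0)]
        exact max_le (le_abs_self y) (abs_nonneg y)
      simp only [norm_pow, sub_zero, one_mul, Real.norm_eq_abs, abs_abs]
      exact pow_le_pow_left₀ (abs_nonneg _) h1 2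
    have := hO.hasFDerivAt (𝕜 := ℝ) one_lt_two
    rw [hasDerivAt_iff_hasFDerivAt]
    simpa using this
  · rw [max_eq_left h.le]
    have h2 : HasDerivAt (fun y : ℝ => y ^ 2) (2 * x) x := by
      simpa using hasDerivAt_pow 2 x
    refine h2.congr_of_eventuallyEq ?_
    filter_upwards [Ioi_mem_nhds h] with y hy
    rw [max_eq_left (le_of_lt hy)]

/-- A bounded nondecreasing `C¹` truncation, vanishing on `[c, ∞)` and strictly increasing on
`(-∞, c]`. -/
noncomputable def truncation (c y : ℝ) : ℝ := -(max (c - y) 0 ^ 2 / (1 + max (c - y) 0 ^ 2))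

/-- The derivative of `truncation c`. -/
noncomputable def truncationDeriv (c y : ℝ) : ℝ :=
  2 * max (c - y) 0 / (1 + max (c - y) 0 ^ 2) ^ 2

theorem hasDerivAt_truncation (c y : ℝ) :
    HasDerivAt (truncation c) (truncationDeriv c y) y := by
  have h1 : HasDerivAt (fun y : ℝ => max (c - y) 0 ^ 2) (-(2 * max (c - y) 0)) y := by
    have := (hasDerivAt_max_zero_sq (c - y)).comp y ((hasDerivAt_id y).const_sub c)
    rwa [mul_neg_one] at this
  have hpos : (1 + max (c - y) 0 ^ 2) ≠ 0 := by positivity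
  have h2 := (h1.div (h1.const_add 1) hpos).neg
  refine h2.congr_deriv ?_
  unfold truncationDeriv
  field_simp
  ring

theorem contDiff_truncation (c : ℝ) : ContDiff ℝ 1 (truncation c) := by
  rw [contDiff_one_iff_deriv]
  refine ⟨fun y => (hasDerivAt_truncation c y).differentiableAt, ?_⟩
  have : deriv (truncation c) = truncationDeriv c :=
    funext fun y => (hasDerivAt_truncation c y).deriv
  rw [this]
  unfold truncationDeriv
  have hpos : ∀ y : ℝ, (1 + max (c - y) 0 ^ 2) ^ 2 ≠ 0 := fun y => by positivity
  fun_prop (disch := exact hpos _)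

theorem continuous_truncationDeriv (c : ℝ) : Continuous (truncationDeriv c) := by
  unfold truncationDeriv
  have hpos : ∀ y : ℝ, (1 + max (c - y) 0 ^ 2) ^ 2 ≠ 0 := fun y => by positivity
  fun_prop (disch := exact hpos _)

theorem truncation_eq_zero {c y : ℝ} (h : c ≤ y) : truncation c y = 0 := by
  rw [truncation, max_eq_right (by linarith)]
  simp

theorem truncationDeriv_nonneg (c y : ℝ) : 0 ≤ truncationDeriv c y := by
  unfold truncationDeriv
  positivity

theorem truncationDeriv_pos {c y : ℝ} (h : y < c) : 0 < truncationDeriv c y := by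
  rw [truncationDeriv, max_eq_left (by linarith)]
  have : 0 < c - y := by linarith
  positivity

theorem truncationDeriv_eq_zero_of_truncation_eq_zero {c y : ℝ} (h : truncation c y = 0) :
    truncationDeriv c y = 0 := by
  have hpos : (1 + max (c - y) 0 ^ 2) ≠ 0 := by positivity
  have h1 : max (c - y) 0 = 0 := by
    unfold truncation at h
    simpa [hpos] using h
  simp [truncationDeriv, h1]

theorem abs_truncation_le_one (c y : ℝ) : |truncation c y| ≤ 1 := by
  rw [truncation, abs_neg, abs_of_nonneg (by positivity), div_le_one (by positivity)]
  linarith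

/-- The energy argument: where a stream function of finite energy below the body level is
negative, the velocity vanishes. -/
theorem IsStreamFunction.eq_zero_of_neg {K E : Set ℂ} (hK : IsBody K E) {v : ℂ → ℂ}
    (hv : IsFlow K E v) {F : ℂ → ℝ} (hF : IsStreamFunction K v F)
    (hen : ∀ c < 0, IntegrableOn (fun z => ‖v z‖ ^ 2) (Kᶜ ∩ {z | F z < c})) {z₀ : ℂ}
    (hz₀ : z₀ ∈ Kᶜ) (hneg : F z₀ < 0) : v z₀ = 0 := by
  have hKc : IsClosed K := hK.isCompact.isClosed
  have hΩ : IsOpen Kᶜ := hKc.isOpen_compl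
  have hm : MeasurableSet Kᶜ := hΩ.measurableSet
  have hw := hv.differentiableOn_complexVelocity hKc
  have hvc : ContinuousOn v Kᶜ := hv.differentiableOn.continuousOn
  have hFc : ContDiffOn ℝ 1 F Kᶜ := hF.contDiffOn hKc hvc
  set c := F z₀ / 2 with hcdef
  have hc0 : c < 0 := by linarith
  obtain ⟨χ, hχ⟩ := exists_isCutoffSeq hK.finite_corners
  -- Near a point of `K` that is not a corner, `F` is small and hence above `c < 0`, so the
  -- truncation vanishes. Near the corners `χ n` vanishes. The product is therefore an interior test
  -- function.
  let φ : ℕ → ℂ → ℝ := fun n z => χ n z * truncation c (F z)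
  have hφK : ∀ n, ∀ z ∈ K, φ n =ᶠ[𝓝 z] 0 := by
    intro n z hz
    by_cases hzE : z ∈ E
    · have h0 := notMem_tsupport_iff_eventuallyEq.1 (hχ.notMem_tsupport n z hzE)
      filter_upwards [h0] with y hy
      simp only [φ, hy, Pi.zero_apply, zero_mul]
    · obtain ⟨r, hr, C, hC⟩ := hF.exists_abs_le z hz (velocityBoundedNear_of_notMem hv hz hzE)
      have h1 : Tendsto (fun x => C * ‖x - z‖) (𝓝 z) (𝓝 0) := by
        have : Continuous fun x : ℂ => C * ‖x - z‖ := by fun_prop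
        simpa using this.tendsto z
      filter_upwards [h1.eventually_lt_const (neg_pos.2 hc0), Metric.ball_mem_nhds z hr]
        with y hy hyr
      have h2 := abs_le.1 (hC y hyr)
      simp only [φ, Pi.zero_apply]
      rw [truncation_eq_zero (by linarith), mul_zero]
  have hφd : ∀ n, ContDiff ℝ 1 (φ n) := by
    intro n
    rw [contDiff_iff_contDiffAt]
    intro z
    by_cases hz : z ∈ K
    · exact contDiffAt_const.congr_of_eventuallyEq (hφK n z hz)
    · exact (hχ.contDiff n).contDiffAt.mul ((contDiff_truncation c).contDiffAt.comp z
        (hFc.contDiffAt (hΩ.mem_nhds hz)))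
  have hφc : ∀ n, HasCompactSupport (φ n) := fun n => (hχ.hasCompactSupport n).mul_right
  have hφs : ∀ n, tsupport (φ n) ⊆ Kᶜ := fun n z hz hzK =>
    notMem_tsupport_iff_eventuallyEq.2 (hφK n z hzK) hz
  -- The rotated field has complex velocity `-i w`, again holomorphic, so it is weakly divergence
  -- free in the fluid.
  have hw' : DifferentiableOn ℂ (complexVelocity fun z => Complex.I * v z) Kᶜ := by
    refine (hw.const_mul (-Complex.I)).congr fun z _ => ?_
    simp [complexVelocity]
  have hzero : ∀ n, ∫ z, fderiv ℝ (φ n) z (Complex.I * v z) = 0 := fun n =>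
    integral_fderiv_apply_velocity_eq_zero hΩ hw' (hφd n) (hφc n) (hφs n)
  let X : ℂ → ℂ := Kᶜ.indicator fun z => truncation c (F z) • (Complex.I * v z)
  have hXL : MemLp X 2 := by
    have hTF : ContinuousOn (fun z => truncation c (F z)) Kᶜ :=
      (contDiff_truncation c).continuous.comp_continuousOn hFc.continuousOn
    have hmeas : MeasurableSet (Kᶜ ∩ {z | F z < c}) :=
      (hFc.continuousOn.isOpen_inter_preimage hΩ isOpen_Iio).measurableSet
    have hL : MemLp ((Kᶜ ∩ {z | F z < c}).indicator v) 2 := by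
      rw [memLp_indicator_iff_restrict hmeas, memLp_two_iff_integrable_sq_norm]
      · exact hen c hc0
      · exact (hvc.mono inter_subset_left).aestronglyMeasurable hmeas
    refine hL.of_le ?_ (Eventually.of_forall fun z => ?_)
    · rw [aestronglyMeasurable_indicator_iff hm]
      exact (hTF.smul (continuousOn_const.mul hvc)).aestronglyMeasurable hm
    · by_cases hz : z ∈ Kᶜ
      · by_cases hzc : F z < c
        · rw [indicator_of_mem (s := Kᶜ ∩ {z | F z < c}) ⟨hz, hzc⟩]
          simp only [X, indicator_of_mem hz]
          rw [norm_smul, norm_mul, Complex.norm_I, one_mul]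
          exact mul_le_of_le_one_left (norm_nonneg _) (abs_truncation_le_one _ _)
        · simp only [X, indicator_of_mem hz]
          rw [truncation_eq_zero (not_lt.1 hzc), zero_smul, norm_zero]
          exact norm_nonneg _
      · simp only [X, indicator_of_notMem hz, norm_zero]
        exact norm_nonneg _
  have hlim := hχ.tendsto_integral_fderiv_apply hXL
  let P : ℂ → ℝ := Kᶜ.indicator fun z => truncationDeriv c (F z) * ‖v z‖ ^ 2
  have hP0 : ∀ z, 0 ≤ P z := fun z => indicator_nonneg
    (fun z _ => mul_nonneg (truncationDeriv_nonneg _ _) (by positivity)) z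
  have hPc : ContinuousOn (fun z => truncationDeriv c (F z) * ‖v z‖ ^ 2) Kᶜ :=
    ((continuous_truncationDeriv c).comp_continuousOn hFc.continuousOn).mul (hvc.norm.pow 2)
  -- Differentiating the truncation along `i v` produces the energy density `P`; differentiating `χ
  -- n` leaves an error against the square integrable field `X`.
  have hpt : ∀ n z, fderiv ℝ (φ n) z (Complex.I * v z) - χ n z * P z = fderiv ℝ (χ n) z (X z) := by
    intro n z
    by_cases hz : z ∈ Kᶜ
    · have h1 := (hasDerivAt_truncation c (F z)).comp_hasFDerivAt z (hF.hasFDerivAt z hz)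
      have h2 := ((hχ.contDiff n).differentiable one_ne_zero z).hasFDerivAt.fun_mul h1
      have h3 : HasFDerivAt (φ n) _ z := h2
      rw [h3.fderiv]
      simp only [P, X, indicator_of_mem hz, add_apply, smul_apply, smul_eq_mul, map_smul,
        fluxForm_self_mul_I, Function.comp]
      ring
    · simp only [P, X, indicator_of_notMem hz]
      rw [(hφK n z (not_not.1 hz)).fderiv_eq]
      simp
  have hPi : ∀ n, Integrable fun z => χ n z * P z := by
    intro n
    refine integrable_of_continuousOn_of_support_subset (hφc n) ?_ fun z hz => ?_
    · refine (hχ.contDiff n).continuous.continuousOn.mul ((hPc.mono (hφs n)).congr fun z hz => ?_)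
      exact indicator_of_mem (hφs n hz) _
    · by_cases hzK : z ∈ Kᶜ
      · have h0 : χ n z * truncation c (F z) = 0 :=
          image_eq_zero_of_notMem_tsupport (f := φ n) hz
        simp only [P, indicator_of_mem hzK]
        rcases mul_eq_zero.1 h0 with h | h
        · rw [h, zero_mul]
        · rw [truncationDeriv_eq_zero_of_truncation_eq_zero h, zero_mul, mul_zero]
      · simp only [P, indicator_of_notMem hzK, mul_zero]
  have hφi : ∀ n, Integrable fun z => fderiv ℝ (φ n) z (Complex.I * v z) := fun n =>
    integrable_of_continuousOn_of_support_subset (hφc n)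
      (((hφd n).continuous_fderiv one_ne_zero).continuousOn.clm_apply
        (continuousOn_const.mul (hvc.mono (hφs n))))
      fun z hz => by simp [fderiv_eq_zero_of_notMem_tsupport hz]
  have hPlim : Tendsto (fun n => ∫ z, χ n z * P z) atTop (𝓝 0) := by
    have h1 : ∀ n, -∫ z, fderiv ℝ (χ n) z (X z) = ∫ z, χ n z * P z := by
      intro n
      rw [← integral_congr_ae (Eventually.of_forall (hpt n)), integral_sub (hφi n) (hPi n),
        hzero n]
      simp
    simpa using hlim.neg.congr h1
  -- Fatou's lemma passes to the limit in the cutoffs, and nonnegativity turns a zero integral into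
  -- vanishing almost everywhere. Continuity then gives every point of the fluid.
  have hPae : ∀ᵐ z, P z = 0 := by
    have hmeasP : ∀ n, AEMeasurable fun z => ENNReal.ofReal (χ n z * P z) := fun n =>
      (hPi n).aemeasurable.ennreal_ofReal
    have hfatou := lintegral_liminf_le' (u := atTop) hmeasP
    have hR : liminf (fun n => ∫⁻ z, ENNReal.ofReal (χ n z * P z)) atTop = 0 := by
      refine Tendsto.liminf_eq ?_
      have h2 : ∀ n, ∫⁻ z, ENNReal.ofReal (χ n z * P z) = ENNReal.ofReal (∫ z, χ n z * P z) :=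
        fun n => (ofReal_integral_eq_lintegral_ofReal (hPi n)
          (Eventually.of_forall fun z => mul_nonneg (hχ.nonneg n z) (hP0 z))).symm
      simp_rw [h2]
      have h3 := (ENNReal.continuous_ofReal.tendsto 0).comp hPlim
      rwa [ENNReal.ofReal_zero] at h3
    have hcongr : ∫⁻ z, liminf (fun n => ENNReal.ofReal (χ n z * P z)) atTop =
        ∫⁻ z, ENNReal.ofReal (P z) := by
      refine lintegral_congr_ae ?_
      filter_upwards [hχ.ae_tendsto] with z hχz
      refine Tendsto.liminf_eq ?_
      have h3 := (ENNReal.continuous_ofReal.tendsto (1 * P z)).comp (hχz.mul_const (P z))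
      rwa [one_mul] at h3
    have hPm : AEMeasurable P :=
      ((aestronglyMeasurable_indicator_iff hm).2 (hPc.aestronglyMeasurable hm)).aemeasurable
    rw [hR, nonpos_iff_eq_zero, hcongr, lintegral_eq_zero_iff' hPm.ennreal_ofReal] at hfatou
    filter_upwards [hfatou] with z hz
    exact le_antisymm (ENNReal.ofReal_eq_zero.1 hz) (hP0 z)
  have hEq : EqOn (fun z => truncationDeriv c (F z) * ‖v z‖ ^ 2) (fun _ => 0) Kᶜ := by
    refine Measure.eqOn_open_of_ae_eq (μ := volume) ?_ hΩ hPc continuousOn_const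
    rw [EventuallyEq, ae_restrict_iff' hm]
    filter_upwards [hPae] with z hz hzK
    simpa only [P, indicator_of_mem hzK] using hz
  have h4 := hEq hz₀
  have h5 : truncationDeriv c (F z₀) ≠ 0 := (truncationDeriv_pos (by linarith)).ne'
  simpa [h5] using h4

/-! ### Linear operations on flows -/

theorem isFlow_zero (K E : Set ℂ) : IsFlow K E fun _ => 0 where
  differentiableOn := differentiableOn_const 0
  incompressible z _ := by simp [planeDiv]
  irrotational z _ := by simp [planeCurl]
  slip p _ u g r _ := by simpa using tendsto_const_nhds
  bounded_at_infinity := ⟨0, 0, fun z _ _ => by simp⟩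
  bounded_near_regular p _ := ⟨1, one_pos, 0, fun z _ _ => by simp⟩
  square_integrable R := by simp

theorem VelocityBoundedNear.sub {K : Set ℂ} {v₁ v₂ : ℂ → ℂ} {p : ℂ}
    (h₁ : VelocityBoundedNear K v₁ p) (h₂ : VelocityBoundedNear K v₂ p) :
    VelocityBoundedNear K (fun z => v₁ z - v₂ z) p := by
  obtain ⟨r₁, hr₁, C₁, hC₁⟩ := h₁
  obtain ⟨r₂, hr₂, C₂, hC₂⟩ := h₂
  refine ⟨min r₁ r₂, lt_min hr₁ hr₂, C₁ + C₂, fun z hz hd => ?_⟩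
  exact (norm_sub_le _ _).trans (add_le_add (hC₁ z hz (hd.trans_le (min_le_left _ _)))
    (hC₂ z hz (hd.trans_le (min_le_right _ _))))

theorem IsFlow.sub {K E : Set ℂ} (hK : IsCompact K) {v₁ v₂ : ℂ → ℂ} (h₁ : IsFlow K E v₁)
    (h₂ : IsFlow K E v₂) : IsFlow K E fun z => v₁ z - v₂ z := by
  have hΩ := hK.isClosed.isOpen_compl
  have hf : ∀ z ∈ Kᶜ, fderiv ℝ (fun z => v₁ z - v₂ z) z = fderiv ℝ v₁ z - fderiv ℝ v₂ z :=
    fun z hz => fderiv_fun_sub ((h₁.differentiableOn z hz).differentiableAt (hΩ.mem_nhds hz))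
      ((h₂.differentiableOn z hz).differentiableAt (hΩ.mem_nhds hz))
  refine ⟨h₁.differentiableOn.sub h₂.differentiableOn, fun z hz => ?_, fun z hz => ?_, ?_, ?_, ?_,
    fun R => ?_⟩
  · have e₁ := h₁.incompressible z hz
    have e₂ := h₂.incompressible z hz
    unfold planeDiv at *
    rw [hf z hz]
    simp
    linarith
  · have e₁ := h₁.irrotational z hz
    have e₂ := h₂.irrotational z hz
    unfold planeCurl at *
    rw [hf z hz]
    simp
    linarith
  · intro p hp u g r hc
    have := (h₁.slip p hp u g r hc).sub (h₂.slip p hp u g r hc)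
    simpa only [inner_sub_right, sub_zero] using this
  · obtain ⟨R₁, C₁, hC₁⟩ := h₁.bounded_at_infinity
    obtain ⟨R₂, C₂, hC₂⟩ := h₂.bounded_at_infinity
    refine ⟨max R₁ R₂, C₁ + C₂, fun z hz hR => ?_⟩
    exact (norm_sub_le _ _).trans (add_le_add (hC₁ z hz ((le_max_left _ _).trans_lt hR))
      (hC₂ z hz ((le_max_right _ _).trans_lt hR)))
  · exact fun p hp => (h₁.bounded_near_regular p hp).sub (h₂.bounded_near_regular p hp)
  · have hm : MeasurableSet (Kᶜ ∩ Metric.ball (0 : ℂ) R) :=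
      (hΩ.inter Metric.isOpen_ball).measurableSet
    have hL := ((memLp_indicator_iff_restrict hm).1 (h₁.memLp_indicator hK R)).sub
      ((memLp_indicator_iff_restrict hm).1 (h₂.memLp_indicator hK R))
    exact (memLp_two_iff_integrable_sq_norm hL.aestronglyMeasurable).1 hL

theorem IsFlow.neg {K E : Set ℂ} (hK : IsCompact K) {v : ℂ → ℂ} (h : IsFlow K E v) :
    IsFlow K E fun z => -v z := by
  simpa using (isFlow_zero K E).sub hK h

/-! ### Behaviour at infinity: limit velocity, circulation and residue -/

theorem mem_compl_of_le_norm {K : Set ℂ} {R : ℝ} (hR : K ⊆ Metric.ball 0 R) {z : ℂ}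
    (hz : R ≤ ‖z‖) : z ∈ Kᶜ := fun h => by
  have := hR h
  rw [mem_ball_zero_iff] at this
  linarith

/-- The velocity at infinity exists. -/
theorem IsFlow.exists_hasVelocityAtInfinity {K E : Set ℂ} (hK : IsCompact K) {v : ℂ → ℂ}
    (hv : IsFlow K E v) : ∃ wInf, HasVelocityAtInfinity v wInf := by
  have hw := hv.differentiableOn_complexVelocity hK.isClosed
  have hΩ := hK.isClosed.isOpen_compl
  obtain ⟨R, hR⟩ := hK.isBounded.subset_ball (0 : ℂ)
  obtain ⟨R₁, C, hC⟩ := hv.bounded_at_infinity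
  have hinv : Tendsto (Inv.inv : ℂ → ℂ) (𝓝[≠] 0) (Bornology.cobounded ℂ) :=
    tendsto_inv₀_nhdsNE_zero
  have hfar : ∀ M : ℝ, ∀ᶠ ζ : ℂ in 𝓝[≠] 0, M < ‖ζ⁻¹‖ := fun M =>
    (tendsto_norm_cobounded_atTop.comp hinv).eventually_gt_atTop M
  -- In the coordinate `ζ = 1/z` infinity is an isolated singularity of a bounded holomorphic
  -- function, hence removable.
  have h1 : Tendsto (fun ζ => complexVelocity v ζ⁻¹) (𝓝[≠] 0)
      (𝓝 (limUnder (𝓝[≠] 0) fun ζ => complexVelocity v ζ⁻¹)) := by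
    refine Complex.tendsto_limUnder_of_differentiable_on_punctured_nhds_of_bounded_under ?_ ?_
    · filter_upwards [hfar R, self_mem_nhdsWithin] with ζ hζ hζ0
      have hmem : ζ⁻¹ ∈ Kᶜ := mem_compl_of_le_norm hR hζ.le
      exact ((hw _ hmem).differentiableAt (hΩ.mem_nhds hmem)).comp ζ (differentiableAt_inv hζ0)
    · refine isBoundedUnder_of_eventually_le (a := C + ‖complexVelocity v (0 : ℂ)⁻¹‖) ?_
      filter_upwards [hfar R, hfar R₁] with ζ hζ hζ₁
      refine (norm_sub_le _ _).trans (add_le_add_left ?_ _)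
      have := hC _ (mem_compl_of_le_norm hR hζ.le) hζ₁
      simpa [complexVelocity] using this
  refine ⟨_, (h1.comp tendsto_inv₀_cobounded').congr fun z => ?_⟩
  simp

/-- Along a curve, `w dz = (vˣ dx + vʸ dy) + i (vˣ dy - vʸ dx)`: the real part measures circulation,
the imaginary part flux. -/
theorem integral_inner_circleMap_eq {v : ℂ → ℂ} {R : ℝ} (hR : 0 ≤ R)
    (hw : ContinuousOn (complexVelocity v) (Metric.sphere 0 R)) :
    ∫ θ in (0 : ℝ)..(2 * Real.pi), inner ℝ (v (circleMap 0 R θ)) (deriv (circleMap 0 R) θ) =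
      (∮ z in C(0, R), complexVelocity v z).re := by
  have hci : CircleIntegrable (complexVelocity v) 0 R := hw.circleIntegrable hR
  rw [circleIntegral, ← Complex.reCLM_apply,
    ← ContinuousLinearMap.intervalIntegral_comp_comm _ hci.out]
  refine intervalIntegral.integral_congr fun θ _ => ?_
  simp [Complex.inner, complexVelocity]

theorem circleIntegral_complexVelocity_eq {K : Set ℂ} (hK : IsCompact K) {v : ℂ → ℂ}
    (hw : DifferentiableOn ℂ (complexVelocity v) Kᶜ) {r R : ℝ} (h0 : 0 < r)
    (hr : K ⊆ Metric.ball 0 r) (hrR : r ≤ R) :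
    (∮ z in C(0, R), complexVelocity v z) = ∮ z in C(0, r), complexVelocity v z := by
  have hΩ := hK.isClosed.isOpen_compl
  refine Complex.circleIntegral_eq_of_differentiable_on_annulus_off_countable h0 hrR
    countable_empty (hw.continuousOn.mono fun z hz => ?_) fun z hz => ?_
  · exact fun h => hz.2 (hr h)
  · have hmem : z ∈ Kᶜ := fun h => hz.1.2 (Metric.ball_subset_closedBall (hr h))
    exact (hw z hmem).differentiableAt (hΩ.mem_nhds hmem)

theorem pos_of_subset_ball {K : Set ℂ} (hne : K.Nonempty) {R : ℝ} (hR : K ⊆ Metric.ball 0 R) :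
    0 < R := by
  obtain ⟨z, hz⟩ := hne
  exact (norm_nonneg z).trans_lt (mem_ball_zero_iff.1 (hR hz))

theorem sphere_subset_compl {K : Set ℂ} {R : ℝ} (hR : K ⊆ Metric.ball 0 R) :
    Metric.sphere 0 R ⊆ Kᶜ := fun z hz =>
  mem_compl_of_le_norm hR (by rw [mem_sphere_zero_iff_norm] at hz; exact hz.ge)

/-- The circulation exists: all circles around the body give the same value. -/
theorem IsFlow.exists_hasCirculation {K E : Set ℂ} (hK : IsCompact K) (hne : K.Nonempty)
    {v : ℂ → ℂ} (hv : IsFlow K E v) : ∃ Γ, HasCirculation K v Γ := by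
  have hw := hv.differentiableOn_complexVelocity hK.isClosed
  obtain ⟨R₀, hR₀⟩ := hK.isBounded.subset_ball (0 : ℂ)
  refine ⟨(∮ z in C(0, R₀), complexVelocity v z).re, fun R hR => ?_⟩
  rw [integral_inner_circleMap_eq (pos_of_subset_ball hne hR).le
    (hw.continuousOn.mono (sphere_subset_compl hR))]
  congr 1
  rcases le_total R R₀ with h | h
  · exact (circleIntegral_complexVelocity_eq hK hw (pos_of_subset_ball hne hR) hR h).symm
  · exact circleIntegral_complexVelocity_eq hK hw (pos_of_subset_ball hne hR₀) hR₀ h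

/-- Expansion at infinity of a complex velocity vanishing there. -/
theorem exists_expansion_at_infinity {K : Set ℂ} (hK : IsCompact K) {v : ℂ → ℂ}
    (hw : DifferentiableOn ℂ (complexVelocity v) Kᶜ) (h0 : HasVelocityAtInfinity v 0) :
    ∃ (a : ℂ) (C R : ℝ), 1 ≤ R ∧ K ⊆ Metric.ball 0 R ∧ 0 ≤ C ∧
      ∀ z, R ≤ ‖z‖ → ‖complexVelocity v z - a / z‖ ≤ C / ‖z‖ ^ 2 := by
  have hΩ := hK.isClosed.isOpen_compl
  obtain ⟨R₀, hR₀⟩ := hK.isBounded.subset_ball (0 : ℂ)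
  have hinv : Tendsto (Inv.inv : ℂ → ℂ) (𝓝[≠] 0) (Bornology.cobounded ℂ) :=
    tendsto_inv₀_nhdsNE_zero
  -- In the coordinate `ζ = 1/z` the velocity extends by `0` to an analytic `f`. The coefficient `a`
  -- is `dslope f 0 0`, and the remainder is `ζ` times the `O(ζ)` variation of `dslope f 0`.
  let f : ℂ → ℂ := Function.update (fun ζ => complexVelocity v ζ⁻¹) 0 0
  have hf0 : f 0 = 0 := Function.update_self _ _ _
  have hfne : ∀ ζ, ζ ≠ 0 → f ζ = complexVelocity v ζ⁻¹ := fun ζ hζ =>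
    Function.update_of_ne hζ _ _
  have hfan : AnalyticAt ℂ f 0 := by
    refine Complex.analyticAt_of_differentiable_on_punctured_nhds_of_continuousAt ?_ ?_
    · filter_upwards [(tendsto_norm_cobounded_atTop.comp hinv).eventually_gt_atTop R₀,
        self_mem_nhdsWithin] with ζ hζ hζ0
      have hmem : ζ⁻¹ ∈ Kᶜ := mem_compl_of_le_norm hR₀ (le_of_lt hζ)
      have h1 := ((hw _ hmem).differentiableAt (hΩ.mem_nhds hmem)).comp ζ
        (differentiableAt_inv hζ0)
      refine h1.congr_of_eventuallyEq ?_
      filter_upwards [isOpen_ne.mem_nhds hζ0] with y hy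
      exact hfne y hy
    · exact continuousAt_update_same.2 (h0.comp hinv)
  obtain ⟨s, hs, hfs⟩ := hfan.eventually_analyticAt.exists_mem
  have hfd : DifferentiableOn ℂ f s := fun ζ hζ =>
    (hfs ζ hζ).differentiableAt.differentiableWithinAt
  have hgd : DifferentiableAt ℂ (dslope f 0) 0 :=
    ((Complex.differentiableOn_dslope hs).2 hfd).differentiableAt hs
  obtain ⟨C, hCpos, hC⟩ := hgd.isBigO_sub.exists_pos
  have hev := tendsto_inv₀_cobounded.eventually hC.bound
  rw [← comap_norm_atTop, eventually_comap] at hev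
  obtain ⟨R₁, hR₁⟩ := eventually_atTop.1 hev
  refine ⟨dslope f 0 0, C, max 1 (max R₀ R₁), le_max_left _ _, hR₀.trans (Metric.ball_subset_ball
    ((le_max_left _ _).trans (le_max_right _ _))), hCpos.le, fun z hz => ?_⟩
  have hz1 : 1 ≤ ‖z‖ := (le_max_left _ _).trans hz
  have hz0 : z ≠ 0 := by rintro rfl; simp at hz1; linarith
  have h1 := hR₁ ‖z‖ (((le_max_right _ _).trans (le_max_right _ _)).trans hz) z rfl
  have h2 : complexVelocity v z = z⁻¹ * dslope f 0 z⁻¹ := by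
    have h3 := sub_smul_dslope f 0 z⁻¹
    rw [hf0, sub_zero, sub_zero, smul_eq_mul, hfne _ (inv_ne_zero hz0), inv_inv] at h3
    exact h3.symm
  rw [h2, div_eq_mul_inv, mul_comm _ z⁻¹, ← mul_sub, norm_mul, norm_inv]
  rw [sub_zero, norm_inv] at h1
  calc ‖z‖⁻¹ * ‖dslope f 0 z⁻¹ - dslope f 0 0‖ ≤ ‖z‖⁻¹ * (C * ‖z‖⁻¹) := by gcongr
    _ = C / ‖z‖ ^ 2 := by field_simp

/-- The residue at infinity is given by the circle integrals around the body. -/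
theorem circleIntegral_eq_of_expansion {K : Set ℂ} (hK : IsCompact K) {v : ℂ → ℂ}
    (hw : DifferentiableOn ℂ (complexVelocity v) Kᶜ) {a : ℂ} {C R : ℝ} (hR : 1 ≤ R)
    (hKR : K ⊆ Metric.ball 0 R)
    (hexp : ∀ z, R ≤ ‖z‖ → ‖complexVelocity v z - a / z‖ ≤ C / ‖z‖ ^ 2) :
    (∮ z in C(0, R), complexVelocity v z) = 2 * Real.pi * Complex.I * a := by
  -- The circle may be enlarged to radius `ρ`, where the remainder contributes at most `2πρ · C /
  -- ρ²`.
  have hbd : ∀ ρ : ℝ, R ≤ ρ → ‖(∮ z in C(0, R), complexVelocity v z) -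
      2 * Real.pi * Complex.I * a‖ ≤ 2 * Real.pi * C / ρ := by
    intro ρ hρ
    have hρ0 : 0 < ρ := by linarith
    rw [← circleIntegral_complexVelocity_eq hK hw (by linarith) hKR hρ]
    have h1 : (∮ z in C(0, ρ), a / z) = 2 * Real.pi * Complex.I * a := by
      have h2 := circleIntegral.integral_sub_center_inv (0 : ℂ) hρ0.ne'
      have h3 := circleIntegral.integral_const_mul a (fun z : ℂ => (z - 0)⁻¹) 0 ρ
      rw [h2] at h3
      simp only [sub_zero, ← div_eq_mul_inv] at h3
      rw [h3]
      ring
    have hne : ∀ z ∈ Metric.sphere (0 : ℂ) ρ, z ≠ 0 := by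
      rintro z hz rfl
      simp at hz
      linarith
    rw [← h1, ← circleIntegral.integral_sub]
    · refine (circleIntegral.norm_integral_le_of_norm_le_const hρ0.le (C := C / ρ ^ 2)
        fun z hz => ?_).trans (le_of_eq ?_)
      · have hz' : ‖z‖ = ρ := by simpa using hz
        have := hexp z (by rw [hz']; exact hρ)
        rwa [hz'] at this
      · field_simp
    · exact (hw.continuousOn.mono (sphere_subset_compl (hKR.trans
        (Metric.ball_subset_ball hρ)))).circleIntegrable hρ0.le
    · exact (continuousOn_const.div continuousOn_id hne).circleIntegrable hρ0.le
  have hlim : Tendsto (fun ρ : ℝ => 2 * Real.pi * C / ρ) atTop (𝓝 0) :=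
    tendsto_const_nhds.div_atTop tendsto_id
  have := ge_of_tendsto hlim (eventually_atTop.2 ⟨R, hbd⟩)
  exact sub_eq_zero.1 (norm_le_zero_iff.1 this)

/-- A flow with a stream function has no flux through circles around the body. -/
theorem IsStreamFunction.im_circleIntegral_eq_zero {K : Set ℂ} {v : ℂ → ℂ} {F : ℂ → ℝ}
    (hF : IsStreamFunction K v F) (hw : DifferentiableOn ℂ (complexVelocity v) Kᶜ) {R : ℝ}
    (hR0 : 0 ≤ R) (hR : K ⊆ Metric.ball 0 R) :
    (∮ z in C(0, R), complexVelocity v z).im = 0 := by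
  have hcont := hw.continuousOn.mono (sphere_subset_compl hR)
  have hci : CircleIntegrable (complexVelocity v) 0 R := hcont.circleIntegrable hR0
  rw [circleIntegral, ← Complex.imCLM_apply,
    ← ContinuousLinearMap.intervalIntegral_comp_comm _ hci.out]
  -- The imaginary part of `w dz` is the differential of the single-valued function `F`, so its
  -- integral over a closed curve vanishes.
  have hd : ∀ θ : ℝ, HasDerivAt (fun θ => F (circleMap 0 R θ))
      (Complex.imCLM (deriv (circleMap 0 R) θ • complexVelocity v (circleMap 0 R θ))) θ := by
    intro θ
    have h1 := (hF.hasFDerivAt _ (sphere_subset_compl hR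
      (circleMap_mem_sphere 0 hR0 θ))).comp_hasDerivAt θ (hasDerivAt_circleMap 0 R θ)
    refine h1.congr_deriv ?_
    rw [fluxForm_apply, deriv_circleMap, Complex.imCLM_apply, smul_eq_mul, mul_comm]
    rfl
  rw [intervalIntegral.integral_eq_sub_of_hasDerivAt (fun θ _ => hd θ)]
  · have := periodic_circleMap 0 R 0
    rw [zero_add] at this
    rw [this, sub_self]
  · refine Continuous.intervalIntegrable ?_ _ _
    have h1 : Continuous fun θ => deriv (circleMap 0 R) θ := by
      simp only [deriv_circleMap]
      fun_prop
    have h2 : Continuous fun θ => complexVelocity v (circleMap 0 R θ) :=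
      hcont.comp_continuous (continuous_circleMap 0 R) fun θ => circleMap_mem_sphere 0 hR0 θ
    exact Complex.imCLM.continuous.comp (h1.smul h2)

theorem norm_complexVelocity (v : ℂ → ℂ) (z : ℂ) : ‖complexVelocity v z‖ = ‖v z‖ := by
  simp [complexVelocity]

/-! ### Flows of finite energy -/

/-- A flow of finite energy vanishes. -/
theorem IsStreamFunction.eq_zero_of_integrableOn {K E : Set ℂ} (hK : IsBody K E) {v : ℂ → ℂ}
    (hv : IsFlow K E v) {F : ℂ → ℝ} (hF : IsStreamFunction K v F)
    (hen : IntegrableOn (fun z => ‖v z‖ ^ 2) Kᶜ) {z : ℂ} (hz : z ∈ Kᶜ) : v z = 0 := by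
  have hΩ := hK.isCompact.isClosed.isOpen_compl
  have hneg : ∀ y ∈ Kᶜ, F y < 0 → v y = 0 := fun y hy h =>
    hF.eq_zero_of_neg hK hv (fun c _ => hen.mono_set inter_subset_left) hy h
  have hpos : ∀ y ∈ Kᶜ, 0 < F y → v y = 0 := by
    intro y hy h
    have hen' : IntegrableOn (fun z => ‖-v z‖ ^ 2) Kᶜ := by simpa using hen
    have := hF.neg.eq_zero_of_neg hK (hv.neg hK.isCompact)
      (fun c _ => hen'.mono_set inter_subset_left) hy (by linarith)
    simpa using this
  -- If `v z ≠ 0`, then `v` is nonzero near `z`. Both signs of `F` are excluded there, so `F` is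
  -- locally `0` and its differential, which determines `v z`, vanishes.
  by_contra hne
  have hcont : ContinuousAt v z := hv.differentiableOn.continuousOn.continuousAt (hΩ.mem_nhds hz)
  have hF0 : F =ᶠ[𝓝 z] fun _ => 0 := by
    filter_upwards [hcont.eventually_ne hne, hΩ.mem_nhds hz] with y hy hyΩ
    rcases lt_trichotomy (F y) 0 with h | h | h
    · exact absurd (hneg y hyΩ h) hy
    · exact h
    · exact absurd (hpos y hyΩ h) hy
  have h1 := (hF.hasFDerivAt z hz).congr_of_eventuallyEq hF0.symm
  exact hne (eq_zero_of_fluxForm_eq_zero (h1.unique (hasFDerivAt_const 0 z)))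

/-- Quadratic decay makes `‖v‖²` of order `‖z‖⁻⁴`, integrable at infinity in the plane. A residue
term `a / z` would make the energy diverge logarithmically. -/
theorem IsFlow.integrableOn_of_le {K E : Set ℂ} {v : ℂ → ℂ}
    (hv : IsFlow K E v) {C R : ℝ} (hR : 1 ≤ R) (hKR : K ⊆ Metric.ball 0 R)
    (hexp : ∀ z, R ≤ ‖z‖ → ‖v z‖ ≤ C / ‖z‖ ^ 2) : IntegrableOn (fun z => ‖v z‖ ^ 2) Kᶜ := by
  have hsub : Kᶜ ⊆ (Kᶜ ∩ Metric.ball 0 R) ∪ {z | R ≤ ‖z‖} := by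
    intro z hz
    rcases lt_or_ge ‖z‖ R with h | h
    · exact Or.inl ⟨hz, by simpa using h⟩
    · exact Or.inr h
  refine IntegrableOn.mono_set (IntegrableOn.union (hv.square_integrable R) ?_) hsub
  have hcl : MeasurableSet {z : ℂ | R ≤ ‖z‖} :=
    (isClosed_le continuous_const continuous_norm).measurableSet
  have hint : Integrable fun z : ℂ => 16 * C ^ 2 * (1 + ‖z‖) ^ (-4 : ℝ) :=
    (integrable_one_add_norm (by rw [Complex.finrank_real_complex]; norm_num)).const_mul _
  refine Integrable.mono' hint.integrableOn ?_ ?_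
  · refine ContinuousOn.aestronglyMeasurable ?_ hcl
    exact ((hv.differentiableOn.continuousOn.mono fun z hz =>
      mem_compl_of_le_norm hKR hz).norm.pow 2)
  · rw [ae_restrict_iff' hcl]
    refine Eventually.of_forall fun z hz => ?_
    have hz1 : 1 ≤ ‖z‖ := hR.trans hz
    have h1 := pow_le_pow_left₀ (norm_nonneg _) (hexp z hz) 2
    rw [Real.norm_of_nonneg (by positivity)]
    refine h1.trans ?_
    rw [show (-4 : ℝ) = -((4 : ℕ) : ℝ) by norm_num, Real.rpow_neg (by positivity),
      Real.rpow_natCast, div_pow, div_eq_mul_inv]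
    have h2 : ((‖z‖ ^ 2) ^ 2)⁻¹ ≤ 16 * ((1 + ‖z‖) ^ 4)⁻¹ := by
      rw [← div_eq_mul_inv, le_div_iff₀ (by positivity), inv_mul_le_iff₀ (by positivity)]
      have h3 : (1 + ‖z‖) ^ 4 ≤ (2 * ‖z‖) ^ 4 := pow_le_pow_left₀ (by positivity) (by linarith) 4
      calc (1 + ‖z‖) ^ 4 ≤ (2 * ‖z‖) ^ 4 := h3
        _ = (‖z‖ ^ 2) ^ 2 * 16 := by ring
    calc C ^ 2 * ((‖z‖ ^ 2) ^ 2)⁻¹ ≤ C ^ 2 * (16 * ((1 + ‖z‖) ^ 4)⁻¹) := by gcongr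
      _ = 16 * C ^ 2 * ((1 + ‖z‖) ^ 4)⁻¹ := by ring

/-! ### Sign of the stream function for a nonzero residue -/

/-- If the residue at infinity is a positive multiple of `I`, then the stream function is positive
near infinity. -/
theorem IsStreamFunction.exists_pos_at_infinity {K : Set ℂ} (hK : IsCompact K) {v : ℂ → ℂ}
    {F : ℂ → ℝ} (hF : IsStreamFunction K v F) (hvc : ContinuousOn v Kᶜ) {b C R : ℝ} (hb : 0 < b)
    (hR : 1 ≤ R) (hKR : K ⊆ Metric.ball 0 R)
    (hexp : ∀ z, R ≤ ‖z‖ → ‖complexVelocity v z - (b * Complex.I) / z‖ ≤ C / ‖z‖ ^ 2) :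
    ∃ R' : ℝ, R ≤ R' ∧ ∀ z, R' < ‖z‖ → 0 < F z := by
  -- Beyond `2 C / b` the remainder `C / t²` is at most half of the main term `b / t`.
  set ρ := max R (2 * C / b) with hρ
  have hρR : R ≤ ρ := le_max_left _ _
  have hρ0 : 0 < ρ := by linarith
  have hFc : ContinuousOn F Kᶜ := (hF.contDiffOn hK.isClosed hvc).continuousOn
  obtain ⟨m, hm⟩ := (isCompact_sphere (0 : ℂ) ρ).bddBelow_image (hFc.mono
    (sphere_subset_compl (hKR.trans (Metric.ball_subset_ball hρR))))
  -- On every ray `F` grows at least like `(b / 2) log t`, starting from a lower bound `m` common to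
  -- the whole circle.
  have hray : ∀ e : ℂ, ‖e‖ = 1 → ∀ t : ℝ, ρ ≤ t →
      m + b / 2 * (Real.log t - Real.log ρ) ≤ F (t * e) := by
    intro e he t ht
    have hnorm : ∀ t : ℝ, ρ ≤ t → ‖(t : ℂ) * e‖ = t := fun t ht => by
      rw [norm_mul, he, mul_one, Complex.norm_of_nonneg (hρ0.le.trans ht)]
    have hd : ∀ t : ℝ, ρ ≤ t → HasDerivAt (fun t : ℝ => F (t * e) - b / 2 * Real.log t)
        ((complexVelocity v (t * e) * e).im - b / 2 * t⁻¹) t := by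
      intro t ht
      have h1 : HasDerivAt (fun t : ℝ => (t : ℂ) * e) e t := by
        simpa using (Complex.ofRealCLM.hasDerivAt (x := t)).mul_const e
      have hmem : (t : ℂ) * e ∈ Kᶜ :=
        mem_compl_of_le_norm hKR (by rw [hnorm t ht]; exact hρR.trans ht)
      have h2 := (hF.hasFDerivAt _ hmem).comp_hasDerivAt t h1
      rw [fluxForm_apply] at h2
      exact h2.sub ((Real.hasDerivAt_log (hρ0.trans_le ht).ne').const_mul (b / 2))
    have hmono : MonotoneOn (fun t : ℝ => F (t * e) - b / 2 * Real.log t) (Ici ρ) := by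
      refine monotoneOn_of_deriv_nonneg (convex_Ici ρ)
        (fun t ht => (hd t ht).continuousAt.continuousWithinAt)
        (fun t ht => (hd t (interior_subset ht)).differentiableAt.differentiableWithinAt) ?_
      intro t ht
      have ht' : ρ ≤ t := interior_subset ht
      have ht0 : 0 < t := hρ0.trans_le ht'
      rw [(hd t ht').deriv]
      have h1 := hexp (t * e) (by rw [hnorm t ht']; exact hρR.trans ht')
      rw [hnorm t ht'] at h1
      have he0 : e ≠ 0 := by rintro rfl; simp at he
      have ht0' : (t : ℂ) ≠ 0 := by exact_mod_cast ht0.ne'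
      have h2 : complexVelocity v (t * e) * e = ((b / t : ℝ) : ℂ) * Complex.I +
          (complexVelocity v (t * e) - (b * Complex.I) / (t * e)) * e := by
        push_cast
        field_simp
        ring
      have h3 : |((complexVelocity v (t * e) - (b * Complex.I) / (t * e)) * e).im| ≤ C / t ^ 2 := by
        refine (Complex.abs_im_le_norm _).trans ?_
        rwa [norm_mul, he, mul_one]
      rw [h2, Complex.add_im]
      have h4 : (((b / t : ℝ) : ℂ) * Complex.I).im = b / t := by
        simp only [Complex.mul_im, Complex.ofReal_re, Complex.I_im, Complex.ofReal_im,
          Complex.I_re]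
        ring
      rw [h4]
      have h5 : C / t ^ 2 ≤ b / 2 * t⁻¹ := by
        have h6 : 2 * C / b ≤ t := (le_max_right _ _).trans ht'
        rw [div_le_iff₀ hb] at h6
        rw [div_le_iff₀ (by positivity)]
        field_simp
        linarith
      have h7 := (abs_le.1 h3).1
      have h8 : b / t = b / 2 * t⁻¹ + b / 2 * t⁻¹ := by field_simp; ring
      linarith
    have h9 := hmono (self_mem_Ici (a := ρ)) ht ht
    have h10 : m ≤ F (ρ * e) := hm ⟨ρ * e, by simpa using hnorm ρ le_rfl, rfl⟩
    simp only at h9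
    linarith
  refine ⟨max ρ (ρ * Real.exp (2 * |m| / b)), hρR.trans (le_max_left _ _), fun z hz => ?_⟩
  have hz1 : ρ < ‖z‖ := (le_max_left _ _).trans_lt hz
  have hz2 : ρ * Real.exp (2 * |m| / b) < ‖z‖ := (le_max_right _ _).trans_lt hz
  have hz0 : 0 < ‖z‖ := hρ0.trans hz1
  have hz0' : (‖z‖ : ℂ) ≠ 0 := by exact_mod_cast hz0.ne'
  have h1 := hray (z / ‖z‖) (by rw [norm_div, Complex.norm_real, norm_norm, div_self hz0.ne'])
    ‖z‖ hz1.le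
  rw [mul_div_cancel₀ _ hz0'] at h1
  have h2 : Real.log ρ + 2 * |m| / b < Real.log ‖z‖ := by
    rw [← Real.log_exp (2 * |m| / b), ← Real.log_mul hρ0.ne' (Real.exp_pos _).ne']
    exact Real.log_lt_log (by positivity) hz2
  have h3 : |m| < b / 2 * (Real.log ‖z‖ - Real.log ρ) := by
    have : 2 * |m| / b < Real.log ‖z‖ - Real.log ρ := by linarith
    rw [div_lt_iff₀ hb] at this
    linarith
  linarith [neg_abs_le m]

/-- A stream function which is positive near infinity is nonnegative. -/
theorem IsStreamFunction.nonneg {K E : Set ℂ} (hK : IsBody K E) {v : ℂ → ℂ}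
    (hv : IsFlow K E v) {F : ℂ → ℝ} (hF : IsStreamFunction K v F) {R : ℝ}
    (hKR : K ⊆ Metric.ball 0 R) (hpos : ∀ z, R < ‖z‖ → 0 < F z) {z : ℂ} (hz : z ∈ Kᶜ) :
    0 ≤ F z := by
  have hΩ := hK.isCompact.isClosed.isOpen_compl
  -- Positivity near infinity confines the sublevel sets to a bounded region, so local square
  -- integrability suffices.
  have hen : ∀ c < 0, IntegrableOn (fun z => ‖v z‖ ^ 2) (Kᶜ ∩ {z | F z < c}) := by
    intro c hc
    refine (hv.square_integrable (R + 1)).mono_set fun y hy => ⟨hy.1, ?_⟩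
    rw [mem_ball_zero_iff]
    by_contra h
    have h1 := hpos y (by linarith)
    have h2 : F y < c := hy.2
    linarith
  -- Where `F < 0` the velocity vanishes, so the squared negative part has zero differential. It is
  -- then constant on the connected fluid and `0` far away.
  have hd : ∀ y ∈ Kᶜ, HasFDerivAt (fun y => max (-F y) 0 ^ 2) (0 : ℂ →L[ℝ] ℝ) y := by
    intro y hy
    have h1 := (hasDerivAt_max_zero_sq (-F y)).comp_hasFDerivAt y (hF.hasFDerivAt y hy).neg
    refine h1.congr_fderiv ?_
    rcases lt_or_ge (F y) 0 with h | h
    · rw [hF.eq_zero_of_neg hK hv hen hy h]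
      simp
    · rw [max_eq_right (by linarith)]
      simp
  have hfar : ((|R| + 1 : ℝ) : ℂ) ∈ Kᶜ := by
    refine mem_compl_of_le_norm hKR ?_
    rw [Complex.norm_of_nonneg (by positivity)]
    linarith [le_abs_self R]
  have hFfar : 0 < F ((|R| + 1 : ℝ) : ℂ) := by
    refine hpos _ ?_
    rw [Complex.norm_of_nonneg (by positivity)]
    linarith [le_abs_self R]
  have hconst := hΩ.is_const_of_fderiv_eq_zero (𝕜 := ℝ) hK.isConnected_compl.isPreconnected
    (fun y hy => (hd y hy).differentiableAt.differentiableWithinAt)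
    (fun y hy => (hd y hy).fderiv) hz hfar
  simp only [max_eq_right (show -F ((|R| + 1 : ℝ) : ℂ) ≤ 0 by linarith)] at hconst
  have h0 : max (-F z) 0 = 0 := by simpa using hconst
  linarith [le_max_left (-F z) 0]

/-! ### Harnack's inequality and strict positivity -/

/-- **Harnack's inequality** for the imaginary part of a holomorphic function on a disk. -/
theorem abs_im_sub_im_le_of_nonneg {f : ℂ → ℂ} {c : ℂ} {R : ℝ}
    (hf : DifferentiableOn ℂ f (Metric.ball c R)) (him : ∀ z ∈ Metric.ball c R, 0 ≤ (f z).im)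
    {z : ℂ} (hz : z ∈ Metric.ball c R) :
    |(f z).im - (f c).im| ≤ dist z c / R * ((f z).im + (f c).im) := by
  have hR : 0 < R := (dist_nonneg).trans_lt (Metric.mem_ball.1 hz)
  set s := dist z c / R with hs
  have hs0 : 0 ≤ s := by positivity
  have hs1 : s ≤ 1 := (div_le_one hR).2 (Metric.mem_ball.1 hz).le
  have hstrict : ∀ δ > 0, |(f z).im - (f c).im| ≤ s * ((f z).im + (f c).im + 2 * δ) := by
    intro δ hδ
    have hcb : c ∈ Metric.ball c R := Metric.mem_ball_self hR
    -- The shift makes the imaginary part strictly positive. The Cayley transform sending `h c` to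
    -- `0` then maps into the unit disk, where Schwarz's lemma applies.
    let h : ℂ → ℂ := fun y => f y + δ * Complex.I
    have hh : ∀ y ∈ Metric.ball c R, 0 < (h y).im := by
      intro y hy
      have := him y hy
      simp [h]
      linarith
    have hkey : ∀ y, ‖h y - (starRingEnd ℂ) (h c)‖ ^ 2 - ‖h y - h c‖ ^ 2 =
        4 * (h y).im * (h c).im := by
      intro y
      rw [← Complex.normSq_eq_norm_sq, ← Complex.normSq_eq_norm_sq, Complex.normSq_apply,
        Complex.normSq_apply]
      simp only [Complex.sub_re, Complex.sub_im, Complex.conj_re, Complex.conj_im]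
      ring
    have hlt : ∀ y ∈ Metric.ball c R, ‖h y - h c‖ < ‖h y - (starRingEnd ℂ) (h c)‖ := by
      intro y hy
      refine lt_of_pow_lt_pow_left₀ 2 (norm_nonneg _) ?_
      have := mul_pos (mul_pos four_pos (hh y hy)) (hh c hcb)
      linarith [hkey y]
    have hden : ∀ y ∈ Metric.ball c R, h y - (starRingEnd ℂ) (h c) ≠ 0 := fun y hy =>
      norm_pos_iff.1 ((norm_nonneg _).trans_lt (hlt y hy))
    have hhd : DifferentiableOn ℂ h (Metric.ball c R) := hf.add_const _
    have hg : DifferentiableOn ℂ (fun y => (h y - h c) / (h y - (starRingEnd ℂ) (h c)))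
        (Metric.ball c R) := (hhd.sub_const _).div (hhd.sub_const _) hden
    have hmaps : MapsTo (fun y => (h y - h c) / (h y - (starRingEnd ℂ) (h c)))
        (Metric.ball c R) (Metric.closedBall ((h c - h c) / (h c - (starRingEnd ℂ) (h c))) 1) := by
      intro y hy
      rw [sub_self, zero_div, mem_closedBall_zero_iff, norm_div]
      exact (div_le_one (norm_pos_iff.2 (hden y hy))).2 (hlt y hy).le
    have hsch := Complex.dist_le_div_mul_dist_of_mapsTo_ball hg hmaps hz
    rw [sub_self, zero_div, dist_zero_right, norm_div,
      div_le_iff₀ (norm_pos_iff.2 (hden z hz)), one_div_mul_eq_div, ← hs] at hsch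
    have h1 := pow_le_pow_left₀ (norm_nonneg _) hsch 2
    rw [mul_pow, ← Complex.normSq_eq_norm_sq, ← Complex.normSq_eq_norm_sq, Complex.normSq_apply,
      Complex.normSq_apply] at h1
    simp only [Complex.sub_re, Complex.sub_im, Complex.conj_re, Complex.conj_im] at h1
    have hs2 : s ^ 2 ≤ 1 := pow_le_one₀ hs0 hs1
    -- The real parts drop out of the squared Schwarz inequality because `s² ≤ 1`.
    have h2 : ((h z).im - (h c).im) ^ 2 ≤ (s * ((h z).im + (h c).im)) ^ 2 := by
      nlinarith [mul_nonneg (sub_nonneg.2 hs2) (sq_nonneg ((h z).re - (h c).re))]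
    have h3 := abs_le_of_sq_le_sq h2
      (mul_nonneg hs0 (add_nonneg (hh z hz).le (hh c hcb).le))
    have e1 : ∀ y, (h y).im = (f y).im + δ := fun y => by simp [h]
    rw [e1, e1] at h3
    refine le_trans (le_of_eq ?_) (h3.trans (le_of_eq ?_))
    · congr 1
      ring
    · ring
  refine le_of_forall_pos_le_add fun ε hε => ?_
  refine (hstrict (ε / 2) (half_pos hε)).trans ?_
  nlinarith

/-- Harnack's inequality for a nonnegative stream function, transported by a holomorphic map. -/
theorem IsStreamFunction.harnack {K : Set ℂ} {v : ℂ → ℂ} {F : ℂ → ℝ}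
    (hF : IsStreamFunction K v F) (hw : DifferentiableOn ℂ (complexVelocity v) Kᶜ)
    (hnn : ∀ z ∈ Kᶜ, 0 ≤ F z) {ψ : ℂ → ℂ} {c : ℂ} {R : ℝ}
    (hψ : DifferentiableOn ℂ ψ (Metric.ball c R)) (hmaps : MapsTo ψ (Metric.ball c R) Kᶜ) {z : ℂ}
    (hz : z ∈ Metric.ball c R) :
    |F (ψ z) - F (ψ c)| ≤ dist z c / R * (F (ψ z) + F (ψ c)) := by
  have hR : 0 < R := (dist_nonneg).trans_lt (Metric.mem_ball.1 hz)
  have hcb : c ∈ Metric.ball c R := Metric.mem_ball_self hR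
  have hd : DifferentiableOn ℂ (fun y => complexVelocity v (ψ y) * deriv ψ y)
      (Metric.ball c R) :=
    (hw.comp hψ hmaps).mul (hψ.deriv Metric.isOpen_ball)
  -- The pulled back form `(w ∘ ψ) ψ' dζ` has a primitive on the disk. Its imaginary part has the
  -- same differential as `F ∘ ψ`, and the constant is fixed at the centre.
  obtain ⟨f, hfc, hf⟩ := hd.isExactOn_ball.with_val_at c (F (ψ c) * Complex.I)
  have hψd : ∀ y ∈ Metric.ball c R, HasFDerivAt (fun y => F (ψ y)) ((fluxForm (v (ψ y))).comp
      ((deriv ψ y • (1 : ℂ →L[ℝ] ℂ)))) y := by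
    intro y hy
    have h1 := ((hψ y hy).differentiableAt
      (Metric.isOpen_ball.mem_nhds hy)).hasDerivAt.complexToReal_fderiv
    exact (hF.hasFDerivAt _ (hmaps hy)).comp y h1
  have hfd : ∀ y ∈ Metric.ball c R, HasFDerivAt (fun y => (f y).im) (Complex.imCLM.comp
      ((complexVelocity v (ψ y) * deriv ψ y) • (1 : ℂ →L[ℝ] ℂ))) y := fun y hy =>
    Complex.imCLM.hasFDerivAt.comp y (hf y hy).complexToReal_fderiv
  have hdiff : ∀ y ∈ Metric.ball c R,
      HasFDerivAt (fun y => (f y).im - F (ψ y)) (0 : ℂ →L[ℝ] ℝ) y := by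
    intro y hy
    refine ((hfd y hy).sub (hψd y hy)).congr_fderiv ?_
    refine ContinuousLinearMap.ext fun h => ?_
    simp only [sub_apply, ContinuousLinearMap.comp_apply, smul_apply, fluxForm_apply,
      Complex.imCLM_apply, smul_eq_mul, one_apply_eq_self, zero_apply]
    rw [mul_assoc]
    exact sub_self _
  have heq : ∀ y ∈ Metric.ball c R, (f y).im = F (ψ y) := by
    intro y hy
    have h1 := Metric.isOpen_ball.is_const_of_fderiv_eq_zero (𝕜 := ℝ)
      (convex_ball c R).isPreconnected
      (fun y hy => (hdiff y hy).differentiableAt.differentiableWithinAt)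
      (fun y hy => (hdiff y hy).fderiv) hy hcb
    simp only [hfc] at h1
    simp at h1
    linarith
  have h2 := abs_im_sub_im_le_of_nonneg
    (fun y hy => (hf y hy).differentiableAt.differentiableWithinAt)
    (fun y hy => by rw [heq y hy]; exact hnn _ (hmaps hy)) hz
  rwa [heq z hz, heq c hcb] at h2

/-- A nonnegative stream function which is positive somewhere is positive everywhere. -/
theorem IsStreamFunction.pos_of_nonneg {K : Set ℂ} (hK : IsClosed K) (hconn : IsPreconnected Kᶜ)
    {v : ℂ → ℂ} {F : ℂ → ℝ} (hF : IsStreamFunction K v F)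
    (hw : DifferentiableOn ℂ (complexVelocity v) Kᶜ) (hnn : ∀ z ∈ Kᶜ, 0 ≤ F z) {z₁ : ℂ}
    (hz₁ : z₁ ∈ Kᶜ) (hpos : 0 < F z₁) {z : ℂ} (hz : z ∈ Kᶜ) : 0 < F z := by
  refine lt_of_le_of_ne (hnn z hz) fun h0 => ?_
  have hFc : ContinuousOn F Kᶜ :=
    (hF.contDiffOn hK (continuousOn_of_complexVelocity hw)).continuousOn
  -- The zero set is open by Harnack's inequality about a zero, whose factor is less than `1`, and
  -- relatively closed by continuity.
  have hsub := hconn.subset_of_closure_inter_subset (u := Kᶜ ∩ {y | F y = 0}) ?_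
    ⟨z, hz, hz, h0.symm⟩ ?_
  · exact hpos.ne' (hsub hz₁).2
  · rw [Metric.isOpen_iff]
    rintro y ⟨hy, hy0⟩
    obtain ⟨R, hR, hball⟩ := Metric.isOpen_iff.1 hK.isOpen_compl y hy
    refine ⟨R, hR, fun x hx => ⟨hball hx, ?_⟩⟩
    have h1 := hF.harnack hw hnn differentiableOn_id hball hx
    simp only [id] at h1
    have hy0' : F y = 0 := hy0
    have h2 := hnn x (hball hx)
    rw [hy0', sub_zero, add_zero, abs_of_nonneg h2] at h1
    have h3 : dist x y / R < 1 := (div_lt_one hR).2 (Metric.mem_ball.1 hx)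
    change F x = 0
    nlinarith
  · rintro y ⟨hyc, hy⟩
    refine ⟨hy, ?_⟩
    have hcont : ContinuousAt F y := hFc.continuousAt (hK.isOpen_compl.mem_nhds hy)
    have : y ∈ closure {y | F y = 0} := closure_mono inter_subset_right hyc
    rw [mem_closure_iff_frequently] at this
    have h4 : F y ∈ ({0} : Set ℝ) := isClosed_singleton.mem_of_frequently_of_tendsto
      (this.mono fun x hx => hx) hcont
    exact h4

/-! ### Protruding corners -/

/-- The conformal map from the disk `|ζ - 1| < 1` into a sector of opening `κ π` with vertex `p`
and bisector direction `β`. -/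
noncomputable def sectorMap (p : ℂ) (ρ β κ : ℝ) (ζ : ℂ) : ℂ :=
  p + ρ * Complex.exp (β * Complex.I) * Complex.exp (κ * Complex.log ζ)

theorem sectorMap_eq {p : ℂ} {ρ β κ : ℝ} (ζ : ℂ) :
    sectorMap p ρ β κ ζ = p + ((ρ * Real.exp (κ * Real.log ‖ζ‖) : ℝ) : ℂ) *
      Complex.exp ((β + κ * ζ.arg : ℝ) * Complex.I) := by
  have h1 : Complex.log ζ = (Real.log ‖ζ‖ : ℂ) + ζ.arg * Complex.I := rfl
  rw [sectorMap, h1]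
  push_cast
  rw [mul_add, Complex.exp_add, add_mul, Complex.exp_add]
  ring_nf

theorem re_pos_of_mem_ball_one {ζ : ℂ} (h : ζ ∈ Metric.ball (1 : ℂ) 1) : 0 < ζ.re := by
  rw [Metric.mem_ball, dist_eq_norm] at h
  have h1 := (abs_lt.1 ((Complex.abs_re_le_norm (ζ - 1)).trans_lt h)).1
  simp at h1
  linarith

theorem differentiableOn_sectorMap (p : ℂ) (ρ β κ : ℝ) :
    DifferentiableOn ℂ (sectorMap p ρ β κ) (Metric.ball 1 1) := by
  intro ζ hζ
  have h1 : DifferentiableAt ℂ Complex.log ζ :=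
    Complex.differentiableAt_log (Or.inl (re_pos_of_mem_ball_one hζ))
  unfold sectorMap
  exact (((h1.const_mul _).cexp.const_mul _).const_add p).differentiableWithinAt

/-- At a protruding corner, a positive stream function grows faster than linearly, which is
incompatible with a bounded velocity. -/
theorem IsStreamFunction.false_of_isProtrudingCorner {K : Set ℂ} (hK : IsClosed K) {v : ℂ → ℂ}
    {F : ℂ → ℝ} (hF : IsStreamFunction K v F)
    (hw : DifferentiableOn ℂ (complexVelocity v) Kᶜ) (hpos : ∀ z ∈ Kᶜ, 0 < F z) {p : ℂ}
    (hp : IsProtrudingCorner K p) (hb : VelocityBoundedNear K v p) : False := by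
  obtain ⟨Θ, hΘ, hΘ2, hpf, α, hα⟩ := hp
  have hpi := Real.pi_pos
  -- Shrinking the sector by `ε` on each side leaves the opening `(Θ + π) / 2`, still larger than
  -- `π`, so that `κ > 1`.
  set ε := (Θ - Real.pi) / 4 with hε
  have hε0 : 0 < ε := by linarith
  obtain ⟨r, hr, hsec⟩ := hα ε hε0
  have hpK : p ∈ K := hK.frontier_subset hpf
  obtain ⟨r₂, hr₂, C, hC⟩ := hF.exists_abs_le p hpK hb
  set κ := (Θ - 2 * ε) / Real.pi with hκ
  have hκpi : κ * Real.pi = Θ - 2 * ε := by rw [hκ]; field_simp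
  have hκ1 : 1 < κ := by rw [hκ, one_lt_div hpi]; linarith
  have hκ2 : κ < 2 := by rw [hκ, div_lt_iff₀ hpi]; linarith
  -- On the disk `‖ζ‖ < 2`, and `κ < 2`, so `‖ζ‖ ^ κ ≤ 4` and the image stays within distance `r /
  -- 2` of the corner.
  set ρ := r / 8 with hρ
  have hρ0 : 0 < ρ := by positivity
  set ψ := sectorMap p ρ (α + Θ / 2) κ with hψ
  have hmaps : MapsTo ψ (Metric.ball 1 1) Kᶜ := by
    intro ζ hζ
    have hre := re_pos_of_mem_ball_one hζ
    have hζ0 : 0 < ‖ζ‖ := norm_pos_iff.2 fun h => by simp [h] at hre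
    have hζ2 : ‖ζ‖ < 2 := by
      rw [Metric.mem_ball, dist_eq_norm] at hζ
      have := norm_add_le (ζ - 1) 1
      rw [sub_add_cancel, norm_one] at this
      linarith
    have harg := abs_lt.1 (Complex.abs_arg_lt_pi_div_two_iff.2 (Or.inl hre))
    have hexp : Real.exp (κ * Real.log ‖ζ‖) ≤ 4 := by
      have h1 : κ * Real.log ‖ζ‖ ≤ 2 * Real.log 2 := by
        have h2 : Real.log ‖ζ‖ ≤ Real.log 2 := Real.log_le_log hζ0 hζ2.le
        have h3 : 0 < Real.log 2 := Real.log_pos one_lt_two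
        nlinarith
      calc Real.exp (κ * Real.log ‖ζ‖) ≤ Real.exp (2 * Real.log 2) := Real.exp_le_exp.2 h1
        _ = 4 := by
          rw [two_mul, Real.exp_add, Real.exp_log two_pos]
          norm_num
    have h4 := (hsec (ρ * Real.exp (κ * Real.log ‖ζ‖)) (Θ / 2 + κ * ζ.arg) (by positivity)
      (by nlinarith)).1 (by nlinarith) (by nlinarith)
    rw [hψ, sectorMap_eq]
    convert h4 using 4
    push_cast
    ring
  have h1b : (1 : ℂ) ∈ Metric.ball (1 : ℂ) 1 := Metric.mem_ball_self one_pos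
  have hψ1 : 0 < F (ψ 1) := hpos _ (hmaps h1b)
  -- Harnack's inequality gives `x F (ψ 1) ≤ (2 - x) F (ψ x)`, while bounded velocity gives `F (ψ x)
  -- ≤ C ρ x ^ κ`. As `κ > 1`, letting `x → 0` contradicts `F (ψ 1) > 0`.
  have hlow : ∀ x : ℝ, 0 < x → x < 1 → ρ * x ^ κ < r₂ →
      F (ψ 1) ≤ 2 * C * ρ * x ^ (κ - 1) := by
    intro x hx0 hx1 hxr
    have hxb : (x : ℂ) ∈ Metric.ball (1 : ℂ) 1 := by
      rw [Metric.mem_ball, dist_eq_norm, ← Complex.ofReal_one, ← Complex.ofReal_sub,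
        Complex.norm_real, Real.norm_eq_abs, abs_lt]
      constructor <;> linarith
    have hdist : dist (x : ℂ) 1 = 1 - x := by
      rw [dist_eq_norm, ← Complex.ofReal_one, ← Complex.ofReal_sub, Complex.norm_real,
        Real.norm_eq_abs, abs_of_neg (by linarith)]
      ring
    have hh := hF.harnack hw (fun z hz => (hpos z hz).le)
      (differentiableOn_sectorMap p ρ (α + Θ / 2) κ) hmaps hxb
    rw [← hψ, hdist, div_one] at hh
    have hh1 := (abs_le.1 hh).1
    have hnorm : ‖ψ x - p‖ = ρ * x ^ κ := by
      rw [hψ, sectorMap_eq, add_sub_cancel_left, norm_mul, Complex.norm_exp_ofReal_mul_I, mul_one,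
        Complex.norm_of_nonneg (by positivity), Complex.norm_of_nonneg hx0.le,
        Real.rpow_def_of_pos hx0, mul_comm κ]
    have hup := hC (ψ x) (by rw [Metric.mem_ball, dist_eq_norm, hnorm]; exact hxr)
    rw [hnorm] at hup
    have hup' := (le_abs_self _).trans hup
    have hFx : 0 < F (ψ x) := hpos _ (hmaps hxb)
    have h5 : x * F (ψ 1) ≤ x * (2 * C * ρ * x ^ (κ - 1)) := by
      have h6 : x * x ^ (κ - 1) = x ^ κ := by
        rw [← Real.rpow_one_add' hx0.le (by linarith)]
        congr 1
        ring
      calc x * F (ψ 1) ≤ 2 * F (ψ x) := by nlinarith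
        _ ≤ 2 * (C * (ρ * x ^ κ)) := by linarith
        _ = x * (2 * C * ρ * x ^ (κ - 1)) := by rw [← h6]; ring
    exact le_of_mul_le_mul_left h5 hx0
  have hlim1 : Tendsto (fun x : ℝ => 2 * C * ρ * x ^ (κ - 1)) (𝓝[>] 0) (𝓝 0) := by
    have h1 : ContinuousAt (fun x : ℝ => x ^ (κ - 1)) 0 :=
      Real.continuousAt_rpow_const 0 _ (Or.inr (by linarith))
    have h2 := (h1.tendsto.mono_left (nhdsWithin_le_nhds (s := Ioi 0))).const_mul (2 * C * ρ)
    rwa [Real.zero_rpow (by linarith), mul_zero] at h2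
  have hlim2 : Tendsto (fun x : ℝ => ρ * x ^ κ) (𝓝[>] 0) (𝓝 0) := by
    have h1 : ContinuousAt (fun x : ℝ => x ^ κ) 0 :=
      Real.continuousAt_rpow_const 0 _ (Or.inr (by linarith))
    have h2 := (h1.tendsto.mono_left (nhdsWithin_le_nhds (s := Ioi 0))).const_mul ρ
    rwa [Real.zero_rpow (by linarith), mul_zero] at h2
  have hle := ge_of_tendsto hlim1 (b := F (ψ 1)) (by
    filter_upwards [hlim2.eventually_lt_const hr₂, Ioo_mem_nhdsGT one_pos] with x hx hx1
    exact hlow x hx1.1 hx1.2 hx)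
  linarith

/-- If the residue at infinity is a positive multiple of `I`, the velocity is unbounded near every
protruding corner. -/
theorem IsFlow.false_of_residue_pos {K E : Set ℂ} (hK : IsBody K E) {v : ℂ → ℂ}
    (hv : IsFlow K E v) {F : ℂ → ℝ} (hF : IsStreamFunction K v F) {b C R : ℝ} (hb : 0 < b)
    (hR : 1 ≤ R) (hKR : K ⊆ Metric.ball 0 R)
    (hexp : ∀ z, R ≤ ‖z‖ → ‖complexVelocity v z - (b * Complex.I) / z‖ ≤ C / ‖z‖ ^ 2) {p : ℂ}
    (hp : IsProtrudingCorner K p) (hbp : VelocityBoundedNear K v p) : False := by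
  have hKc := hK.isCompact.isClosed
  have hw := hv.differentiableOn_complexVelocity hKc
  obtain ⟨R', hRR', hpos⟩ := hF.exists_pos_at_infinity hK.isCompact
    hv.differentiableOn.continuousOn hb hR hKR hexp
  have hKR' : K ⊆ Metric.ball 0 R' := hKR.trans (Metric.ball_subset_ball hRR')
  have hnorm : ‖((R' + 1 : ℝ) : ℂ)‖ = R' + 1 := Complex.norm_of_nonneg (by linarith)
  refine hF.false_of_isProtrudingCorner hKc hw (fun z hz => ?_) hp hbp
  exact hF.pos_of_nonneg hKc hK.isConnected_compl.isPreconnected hw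
    (fun z hz => hF.nonneg hK hv hKR' hpos hz) (z₁ := ((R' + 1 : ℝ) : ℂ))
    (mem_compl_of_le_norm hKR' (by linarith)) (hpos _ (by linarith)) hz

/-! ### Uniqueness -/

/-- A flow vanishing at infinity vanishes if it has no circulation. -/
theorem IsFlow.eq_zero_of_hasCirculation_zero {K E : Set ℂ} (hK : IsBody K E) {v : ℂ → ℂ}
    (hv : IsFlow K E v) (hinf : HasVelocityAtInfinity v 0) (hΓ : HasCirculation K v 0) {z : ℂ}
    (hz : z ∈ Kᶜ) : v z = 0 := by
  have hKc := hK.isCompact.isClosed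
  have hw := hv.differentiableOn_complexVelocity hKc
  obtain ⟨F, hF⟩ := hv.exists_isStreamFunction hK
  obtain ⟨a, C, R, hR, hKR, hC, hexp⟩ := exists_expansion_at_infinity hK.isCompact hw hinf
  have hres := circleIntegral_eq_of_expansion hK.isCompact hw hR hKR hexp
  have him := hF.im_circleIntegral_eq_zero hw (by linarith) hKR
  have hre := hΓ R hKR
  rw [integral_inner_circleMap_eq (by linarith)
    (hw.continuousOn.mono (sphere_subset_compl hKR))] at hre
  -- The real part is the circulation, zero by assumption; the imaginary part is the flux, zero
  -- because of the stream function.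
  have h0 : 2 * Real.pi * Complex.I * a = 0 := by
    rw [← hres]
    exact Complex.ext hre him
  have ha : a = 0 := by simpa [Real.pi_ne_zero] using h0
  refine hF.eq_zero_of_integrableOn hK hv (hv.integrableOn_of_le hR hKR (C := C) fun y hy => ?_) hz
  have := hexp y hy
  rwa [ha, zero_div, sub_zero, norm_complexVelocity] at this

/-- A flow vanishing at infinity and bounded near a protruding corner vanishes. -/
theorem IsFlow.eq_zero_of_isProtrudingCorner {K E : Set ℂ} (hK : IsBody K E) {v : ℂ → ℂ}
    (hv : IsFlow K E v) (hinf : HasVelocityAtInfinity v 0) {p : ℂ} (hp : IsProtrudingCorner K p)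
    (hb : VelocityBoundedNear K v p) {z : ℂ} (hz : z ∈ Kᶜ) : v z = 0 := by
  have hKc := hK.isCompact.isClosed
  have hw := hv.differentiableOn_complexVelocity hKc
  obtain ⟨F, hF⟩ := hv.exists_isStreamFunction hK
  obtain ⟨a, C, R, hR, hKR, hC, hexp⟩ := exists_expansion_at_infinity hK.isCompact hw hinf
  have hres := circleIntegral_eq_of_expansion hK.isCompact hw hR hKR hexp
  have him := hF.im_circleIntegral_eq_zero hw (by linarith) hKR
  have hare : a.re = 0 := by
    rw [hres] at him
    simpa [Real.pi_ne_zero] using him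
  have ha : a = (a.im : ℂ) * Complex.I := by
    apply Complex.ext <;> simp [hare]
  -- Zero flux has made `a` purely imaginary. Either sign contradicts boundedness at the corner, the
  -- negative one after replacing `v` by `-v`, and `a = 0` leaves finite energy.
  rcases lt_trichotomy a.im 0 with h | h | h
  · refine ((hv.neg hK.isCompact).false_of_residue_pos hK hF.neg (b := -a.im) (C := C)
      (by linarith) hR hKR (fun y hy => ?_) hp ?_).elim
    · have h1 := hexp y hy
      have h2 : complexVelocity (fun z => -v z) y - ((-a.im : ℝ) : ℂ) * Complex.I / y =
          -(complexVelocity v y - a / y) := by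
        conv_rhs => rw [ha]
        simp only [complexVelocity, map_neg, Complex.ofReal_neg]
        ring
      rwa [h2, norm_neg]
    · simpa [VelocityBoundedNear] using hb
  · refine hF.eq_zero_of_integrableOn hK hv (hv.integrableOn_of_le hR hKR (C := C)
      fun y hy => ?_) hz
    have := hexp y hy
    rwa [ha, h, Complex.ofReal_zero, zero_mul, zero_div, sub_zero, norm_complexVelocity] at this
  · refine (hv.false_of_residue_pos hK hF h (C := C) hR hKR (fun y hy => ?_) hp hb).elim
    rw [← ha]
    exact hexp y hy

theorem HasVelocityAtInfinity.sub {v₁ v₂ : ℂ → ℂ} {a : ℂ} (h₁ : HasVelocityAtInfinity v₁ a)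
    (h₂ : HasVelocityAtInfinity v₂ a) : HasVelocityAtInfinity (fun z => v₁ z - v₂ z) 0 := by
  have := Tendsto.sub h₁ h₂
  rw [sub_self] at this
  refine this.congr fun z => ?_
  simp [complexVelocity]

theorem IsFlow.hasCirculation_sub {K E : Set ℂ} (hne : K.Nonempty)
    {v₁ v₂ : ℂ → ℂ} (hv₁ : IsFlow K E v₁) (hv₂ : IsFlow K E v₂) {Γ₁ Γ₂ : ℝ}
    (h₁ : HasCirculation K v₁ Γ₁) (h₂ : HasCirculation K v₂ Γ₂) :
    HasCirculation K (fun z => v₁ z - v₂ z) (Γ₁ - Γ₂) := by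
  intro R hR
  have hR0 := (pos_of_subset_ball hne hR).le
  have hint : ∀ v, IsFlow K E v → IntervalIntegrable
      (fun θ => inner ℝ (v (circleMap 0 R θ)) (deriv (circleMap 0 R) θ)) volume 0
      (2 * Real.pi) := by
    intro v hv
    refine Continuous.intervalIntegrable ?_ _ _
    have h1 : Continuous fun θ => v (circleMap 0 R θ) :=
      hv.differentiableOn.continuousOn.comp_continuous (continuous_circleMap 0 R) fun θ =>
        sphere_subset_compl hR (circleMap_mem_sphere 0 hR0 θ)
    have h2 : Continuous fun θ => deriv (circleMap 0 R) θ := by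
      simp only [deriv_circleMap]
      fun_prop
    exact h1.inner h2
  simp only [inner_sub_left]
  rw [intervalIntegral.integral_sub (hint v₁ hv₁) (hint v₂ hv₂), h₁ R hR, h₂ R hR]

theorem HasCirculation.eq_of_eqOn {K : Set ℂ} (hK : IsCompact K) (hne : K.Nonempty)
    {v₁ v₂ : ℂ → ℂ} (h : EqOn v₁ v₂ Kᶜ) {Γ₁ Γ₂ : ℝ} (h₁ : HasCirculation K v₁ Γ₁)
    (h₂ : HasCirculation K v₂ Γ₂) : Γ₁ = Γ₂ := by
  obtain ⟨R, hR⟩ := hK.isBounded.subset_ball (0 : ℂ)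
  rw [← h₁ R hR, ← h₂ R hR]
  refine intervalIntegral.integral_congr fun θ _ => ?_
  have : v₁ (circleMap 0 R θ) = v₂ (circleMap 0 R θ) :=
    h (sphere_subset_compl hR (circleMap_mem_sphere 0 (pos_of_subset_ball hne hR).le θ))
  simp only [this]

theorem mainTheorem5 (K E : Set ℂ) (hK : IsBody K E) :
    (∀ v : ℂ → ℂ, IsFlow K E v →
      (∃ wInf : ℂ, HasVelocityAtInfinity v wInf) ∧ (∃ Γ : ℝ, HasCirculation K v Γ)) ∧
    (∀ v₁ v₂ : ℂ → ℂ, IsFlow K E v₁ → IsFlow K E v₂ →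
      ∀ (wInf : ℂ) (Γ : ℝ),
        HasVelocityAtInfinity v₁ wInf → HasVelocityAtInfinity v₂ wInf →
        HasCirculation K v₁ Γ → HasCirculation K v₂ Γ →
        Set.EqOn v₁ v₂ Kᶜ) ∧
    (∀ p : ℂ, IsProtrudingCorner K p →
      ∀ v₁ v₂ : ℂ → ℂ, IsFlow K E v₁ → IsFlow K E v₂ →
        VelocityBoundedNear K v₁ p → VelocityBoundedNear K v₂ p →
        ∀ (wInf : ℂ), HasVelocityAtInfinity v₁ wInf → HasVelocityAtInfinity v₂ wInf →
          Set.EqOn v₁ v₂ Kᶜ ∧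
          ∀ Γ₁ Γ₂ : ℝ, HasCirculation K v₁ Γ₁ → HasCirculation K v₂ Γ₂ → Γ₁ = Γ₂) := by

  have hne : K.Nonempty := hK.isConnected_interior.nonempty.mono interior_subset
  refine ⟨fun v hv => ⟨hv.exists_hasVelocityAtInfinity hK.isCompact,
    hv.exists_hasCirculation hK.isCompact hne⟩, ?_, ?_⟩
  · intro v₁ v₂ hv₁ hv₂ wInf Γ hw₁ hw₂ hΓ₁ hΓ₂ z hz
    have hΓ := hv₁.hasCirculation_sub hne hv₂ hΓ₁ hΓ₂
    rw [sub_self] at hΓ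
    exact sub_eq_zero.1 ((hv₁.sub hK.isCompact hv₂).eq_zero_of_hasCirculation_zero hK
      (hw₁.sub hw₂) hΓ hz)
  · intro p hp v₁ v₂ hv₁ hv₂ hb₁ hb₂ wInf hw₁ hw₂
    have heq : EqOn v₁ v₂ Kᶜ := fun z hz =>
      sub_eq_zero.1 ((hv₁.sub hK.isCompact hv₂).eq_zero_of_isProtrudingCorner hK (hw₁.sub hw₂) hp
        (hb₁.sub hb₂) hz)
    exact ⟨heq, fun Γ₁ Γ₂ hΓ₁ hΓ₂ => hΓ₁.eq_of_eqOn hK.isCompact hne heq hΓ₂⟩
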